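/- **Setting.** Let $\mathcal C$ be a braided monoidal category with unit object $\mathbb 1$ and braiding $\Psi$ in which idempotents split, and let $(B,m,\eta,\Delta,\varepsilon)$ be a bialgebra in $\mathcal C$. Associativity and unit constraints are suppressed, $\mathrm{id}$ denotes identities, and $gf=g\circ f$ means "first $f$". $\Psi$ without indices is the braiding of the two tensor factors on which it acts. **Strong Hopf data.** A *Hopf datum* $\mathfrak h$ on objects $(B_1,B_2)$ consists of an algebra $(B_1,m_1,\eta_1)$, a coalgebra $(B_2,\Delta_2,\varepsilon_2)$ and morphisms $\Delta_1:B_1\to B_1\otimes B_1$, $\varepsilon_1:B_1\to\mathbb 1$, $m_2:B_2\otimes B_2\to B_2$, $\eta_2:\mathbb 1\to B_2$, $\mu_l:B_2\otimes B_1\to B_1$, $\mu_r:B_2\otimes B_1\to B_2$, $\nu_l:B_1\to B_2\otimes B_1$, $\nu_r:B_2\to B_2\otimes B_1$, $\rho:B_2\to B_1\otimes B_1$, $\sigma:B_2\otimes B_2\to B_1$ such that, with $$\varphi_{1,2}=(m_2\otimes m_1)(\mathrm{id}\otimes\Psi_{B_1,B_2}\otimes\mathrm{id})(\nu_l\otimes\nu_r),\qquad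 \varphi_{2,1}=(\mu_l\otimes\mu_r)(\mathrm{id}\otimes\Psi_{B_2,B_1}\otimes\mathrm{id})(\Delta_2\otimes\Delta_1),$$ $$\hat\sigma=(\sigma\otimes m_2(\mu_r\otimes\mathrm{id}))(\mathrm{id}\otimes\Psi_{B_2,B_2}\otimes\mathrm{id})(\Delta_2\otimes(\nu_r\otimes\mathrm{id})\Delta_2),$$ $$\hat\rho=(m_1(\mathrm{id}\otimes\mu_l)\otimes m_1)(\mathrm{id}\otimes\Psi_{B_1,B_1}\otimes\mathrm{id})((\mathrm{id}\otimes\nu_l)\Delta_1\otimes\rho),$$ the following hold. * $\varepsilon_1$ is an algebra morphism, $\eta_2$ is a coalgebra morphism, $(B_1,\nu_l)$ is a left $B_2$-comodule, $(B_2,\mu_r)$ is a right $B_1$-module. * (Co)unital identities: $\Delta_1\eta_1=\eta_1\otimes\eta_1$, $(\mathrm{id}\otimes\varepsilon_1)\Delta_1=(\varepsilon_1\otimes\mathrm{id})\Delta_1=\mathrm{id}$; $\varepsilon_2m_2=\varepsilon_2\otimes\varepsilon_2$, $m_2(\mathrm{id}\otimes\eta_2)=m_2(\eta_2\otimes\mathrm{id})=\mathrm{id}$;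 $\mu_r(\eta_2\otimes\mathrm{id})=\eta_2\varepsilon_1$, $\varepsilon_2\mu_r=\varepsilon_2\otimes\varepsilon_1$; $(\mathrm{id}\otimes\varepsilon_1)\nu_l=\eta_2\varepsilon_1$, $\nu_l\eta_1=\eta_2\otimes\eta_1$; $\mu_l(\eta_2\otimes\mathrm{id})=\mathrm{id}$, $\mu_l(\mathrm{id}\otimes\eta_1)=\eta_1\varepsilon_2$, $\varepsilon_1\mu_l=\varepsilon_2\otimes\varepsilon_1$; $(\mathrm{id}\otimes\varepsilon_1)\nu_r=\mathrm{id}$, $(\varepsilon_2\otimes\mathrm{id})\nu_r=\eta_1\varepsilon_2$, $\nu_r\eta_2=\eta_2\otimes\eta_1$; $\sigma(\eta_2\otimes\mathrm{id})=\sigma(\mathrm{id}\otimes\eta_2)=\eta_1\varepsilon_2$, $\varepsilon_1\sigma=\varepsilon_2\otimes\varepsilon_2$; $(\mathrm{id}\otimes\varepsilon_1)\rho=(\varepsilon_1\otimes\mathrm{id})\rho=\eta_1\varepsilon_2$, $\rho\eta_2=\eta_1\otimes\eta_1$. * Weak (co)associativity: $m_2(m_2\otimes\mathrm{id})=m_2(\mu_r\otimes\mathrm{id})(\mathrm{id}\otimes\hat\sigma)$;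 $(\mathrm{id}\otimes\Delta_1)\Delta_1=(\hat\rho\otimes\mathrm{id})(\mathrm{id}\otimes\nu_l)\Delta_1$; $m_1(\mathrm{id}\otimes\mu_l)(\hat\sigma\otimes\mathrm{id})=m_1(\mathrm{id}\otimes\sigma)(\varphi_{2,1}\otimes\mathrm{id})(\mathrm{id}\otimes\varphi_{2,1})$; $(\mathrm{id}\otimes\hat\rho)(\nu_r\otimes\mathrm{id})\Delta_2=(\varphi_{1,2}\otimes\mathrm{id})(\mathrm{id}\otimes\varphi_{1,2})(\rho\otimes\mathrm{id})\Delta_2$. * Module-algebra and comodule-coalgebra compatibility: $\mu_l(\mathrm{id}\otimes m_1)=m_1(\mathrm{id}\otimes\mu_l)(\varphi_{2,1}\otimes\mathrm{id})$; $\mu_r(m_2\otimes\mathrm{id})=m_2(\mu_r\otimes\mathrm{id})(\mathrm{id}\otimes\varphi_{2,1})$; $(\mathrm{id}\otimes\Delta_1)\nu_l=(\varphi_{1,2}\otimes\mathrm{id})(\mathrm{id}\otimes\nu_l)\Delta_1$; $(\Delta_2\otimes\mathrm{id})\nu_r=(\mathrm{id}\otimes\varphi_{1,2})(\nu_r\otimes\mathrm{id})\Delta_2$.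 * Cocycle and cycle compatibility: $m_1(\mathrm{id}\otimes\sigma)(\hat\sigma\otimes\mathrm{id})=m_1(\mathrm{id}\otimes\sigma)(\varphi_{2,1}\otimes\mathrm{id})(\mathrm{id}\otimes\hat\sigma)$; $(\mathrm{id}\otimes\hat\rho)(\rho\otimes\mathrm{id})\Delta_2=(\hat\rho\otimes\mathrm{id})(\mathrm{id}\otimes\varphi_{1,2})(\rho\otimes\mathrm{id})\Delta_2$. * Algebra-coalgebra compatibility: $\Delta_1m_1=(m_1\otimes m_1)(\mathrm{id}\otimes\mu_l\otimes\mathrm{id}\otimes\mathrm{id})(\mathrm{id}\otimes\mathrm{id}\otimes\Psi\otimes\mathrm{id})(\mathrm{id}\otimes\nu_l\otimes\mathrm{id}\otimes\mathrm{id})(\Delta_1\otimes\Delta_1)$; $\Delta_2m_2=(m_2\otimes m_2)(\mathrm{id}\otimes\mathrm{id}\otimes\mu_r\otimes\mathrm{id})(\mathrm{id}\otimes\Psi\otimes\mathrm{id}\otimes\mathrm{id})(\mathrm{id}\otimes\mathrm{id}\otimes\nu_r\otimes\mathrm{id})(\Delta_2\otimes\Delta_2)$. * Module-coalgebra compatibility: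 $\Delta_2\mu_r=(m_2\otimes\mu_r)(\mu_r\otimes\Psi\otimes\mathrm{id})(\mathrm{id}\otimes\Psi\otimes\nu_l)(\Delta_2\otimes\Delta_1)$, and $$\hat\rho\,\varphi_{2,1}=(m_1\otimes m_1)(m_1\otimes\sigma\otimes\mathrm{id}\otimes\mu_l)(\mathrm{id}\otimes\varphi_{2,1}\otimes\Psi\otimes\mathrm{id}\otimes\mathrm{id})(\mathrm{id}\otimes\mathrm{id}\otimes\Psi\otimes\Psi\otimes\mathrm{id})(\mathrm{id}\otimes\varphi_{1,2}\otimes\Psi\otimes\mathrm{id}\otimes\mathrm{id})(\rho\otimes\Delta_2\otimes\mathrm{id}\otimes\nu_l)(\Delta_2\otimes\Delta_1).$$ * Comodule-algebra compatibility: $\nu_lm_1=(m_2\otimes m_1)(\mu_r\otimes\Psi\otimes\mathrm{id})(\mathrm{id}\otimes\Psi\otimes\nu_l)(\nu_l\otimes\Delta_1)$, and $$\varphi_{1,2}\,\hat\sigma=(m_2\otimes m_1)(\mu_r\otimes\mathrm{id}\otimes m_1\otimes\sigma)(\mathrm{id}\otimes\mathrm{id}\otimes\Psi\otimes\varphi_{2,1}\otimes\mathrm{id})(\mathrm{id}\otimes\Psi\otimes\Psi\otimes\mathrm{id}\otimes\mathrm{id})(\mathrm{id}\otimes\mathrm{id}\otimes\Psi\otimes\varphi_{1,2}\otimes\mathrm{id})(\nu_r\otimes\mathrm{id}\otimes\rho\otimes\Delta_2)(\Delta_2\otimes\Delta_2).$$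 * Module-comodule compatibility: $\varphi_{1,2}\varphi_{2,1}=(m_2\otimes m_1)(\mu_r\otimes\Psi\otimes\mu_l)(\mathrm{id}\otimes\Psi\otimes\Psi\otimes\mathrm{id})(\nu_r\otimes\Psi\otimes\nu_l)(\Delta_2\otimes\Delta_1)$. * Cycle-cocycle compatibility: $$\hat\rho\,\hat\sigma=(m_1\otimes m_1)(m_1\otimes\sigma\otimes m_1\otimes\sigma)(\mathrm{id}\otimes\varphi_{2,1}\otimes\Psi\otimes\varphi_{2,1}\otimes\mathrm{id})(\mathrm{id}\otimes\mathrm{id}\otimes\Psi\otimes\Psi\otimes\mathrm{id}\otimes\mathrm{id})(\mathrm{id}\otimes\varphi_{1,2}\otimes\Psi\otimes\varphi_{1,2}\otimes\mathrm{id})(\rho\otimes\Delta_2\otimes\rho\otimes\Delta_2)(\Delta_2\otimes\Delta_2).$$ The Hopf datum is *strong* if moreover * $(\mu_r\otimes\mathrm{id})(\mathrm{id}\otimes\Psi)(\nu_l\otimes\mathrm{id})=\nu_l\otimes\varepsilon_1$ and $(\mathrm{id}\otimes\mu_r)(\Psi\otimes\mathrm{id})(\mathrm{id}\otimes\nu_l)=\eta_2\otimes\mu_r$;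 * $(\sigma\otimes\mathrm{id}\otimes\mathrm{id})(\mathrm{id}\otimes\Psi\otimes\mathrm{id})(\nu_r\otimes\Psi)(\nu_l\otimes\mathrm{id}_{B_2})=\eta_1\otimes\eta_1\otimes\mathrm{id}\otimes\varepsilon_2$ and $(\mathrm{id}\otimes\mu_r)(\Psi\otimes\mu_l)(\mathrm{id}\otimes\Psi\otimes\mathrm{id})(\mathrm{id}\otimes\mathrm{id}\otimes\rho)=\eta_1\otimes\mathrm{id}_{B_2}\otimes\varepsilon_2\otimes\varepsilon_2$; * $(\sigma\otimes\mathrm{id})(\mathrm{id}\otimes\nu_l)=\eta_1\varepsilon_2\otimes\mathrm{id}$ and $(\mu_r\otimes\mathrm{id})(\mathrm{id}\otimes\rho)=\mathrm{id}\otimes\eta_1\varepsilon_2$; * on $B_2\otimes B_1\otimes B_2$, with $R=(\mathrm{id}\otimes\Psi\otimes\mathrm{id}\otimes\mathrm{id})(\mathrm{id}\otimes\mathrm{id}\otimes(\Delta_1\otimes\mathrm{id})\rho)$, $$(\mathrm{id}\otimes\mu_r\otimes\mathrm{id}\otimes\mathrm{id})(\mathrm{id}\otimes\mathrm{id}\otimes\mu_l\otimes\mathrm{id}\otimes\mathrm{id})(\Psi\otimes\mathrm{id}\otimes\Psi\otimes\mathrm{id})(\mathrm{id}\otimes\mathrm{id}\otimes\nu_l\otimes\mathrm{id}\otimes\mathrm{id})R=(\mathrm{id}\otimes\mu_r\otimes\mathrm{id}\otimes\mathrm{id})(\Psi\otimes\Psi\otimes\mathrm{id})R;$$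 * on $B_2\otimes B_2\otimes B_1\otimes B_2$, with $L=(\sigma(\mathrm{id}\otimes m_2)\otimes\mathrm{id}\otimes\mathrm{id})(\mathrm{id}\otimes\mathrm{id}\otimes\Psi\otimes\mathrm{id})$, $$L\,(\mathrm{id}\otimes\mathrm{id}\otimes\mu_r\otimes\mathrm{id}\otimes\mathrm{id})(\mathrm{id}\otimes\Psi\otimes\mathrm{id}\otimes\Psi)(\mathrm{id}\otimes\mathrm{id}\otimes(\nu_r\otimes\mathrm{id})\nu_l\otimes\mathrm{id})=L\,(\mathrm{id}\otimes\Psi\otimes\Psi)(\mathrm{id}\otimes\mathrm{id}\otimes\nu_l\otimes\mathrm{id}).$$ The *cross product bialgebra* $B_1\overset{\mathfrak h}{\bowtie}B_2$ of a strong Hopf datum is $B_1\otimes B_2$ with multiplication $(m_1\otimes\mathrm{id})(m_1\otimes\hat\sigma)(\mathrm{id}\otimes\varphi_{2,1}\otimes\mathrm{id})$, unit $\eta_1\otimes\eta_2$, comultiplication $(\mathrm{id}\otimes\varphi_{1,2}\otimes\mathrm{id})(\hat\rho\otimes\Delta_2)(\mathrm{id}\otimes\Delta_2)$ and counit $\varepsilon_1\otimes\varepsilon_2$.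 **Strong projection relations.** For $f,g,k\in\mathrm{End}(B)$ put $\Phi_f=(m\otimes\mathrm{id})(f\otimes\Psi)(\Delta\otimes\mathrm{id})$, $\Phi'_f=(\mathrm{id}\otimes m)(\Psi\otimes f)(\mathrm{id}\otimes\Delta)$, $\delta_{f,g,k}=(m\otimes\mathrm{id})(f\otimes g\otimes k)(\mathrm{id}\otimes\Delta)$. Endomorphisms $\Pi_1,\Pi_2$ of $B$ satisfy the strong projection relations if 1. $(\Pi_2\otimes\mathrm{id})\Phi_{\mathrm{id}}(\Pi_1\otimes\Pi_1)=(\Pi_2\otimes\mathrm{id})\Delta\Pi_1\otimes\varepsilon$ and $(\Pi_2\otimes\Pi_2)\Phi'_{\mathrm{id}}(\mathrm{id}\otimes\Pi_1)=\eta\otimes\Pi_2m(\mathrm{id}\otimes\Pi_1)$; 2. $((\Pi_1\otimes\Pi_1)\Phi_{\Pi_2}\otimes\mathrm{id})(\Pi_2\otimes\Psi)(\Delta\Pi_1\otimes\Pi_2)=\eta\otimes\eta\otimes\Pi_1\otimes\varepsilon$ and $(\Pi_1\otimes\Pi_2m)(\Psi\otimes\Pi_1)(\mathrm{id}\otimes\Phi'_{\Pi_1}(\Pi_2\otimes\Pi_2))=\eta\otimes\Pi_2\otimes\varepsilon\otimes\varepsilon$;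 3. $(\Pi_1\otimes\mathrm{id})\delta_{\Pi_2,\Pi_2,\mathrm{id}}(\mathrm{id}\otimes\Pi_1)=\eta\varepsilon\otimes\Pi_1$ and $(\Pi_2\otimes\mathrm{id})\delta_{\mathrm{id},\Pi_1,\Pi_1}(\mathrm{id}\otimes\Pi_2)=\Pi_2\otimes\eta\varepsilon$; 4. $(\Pi_1\otimes\Pi_2m(\mathrm{id}\otimes\Pi_1)\otimes\mathrm{id}\otimes\Pi_1)(\Psi\otimes\Phi_{\Pi_2}\otimes\mathrm{id})\big(\mathrm{id}\otimes(\Psi\otimes\mathrm{id}\otimes\mathrm{id})(\Pi_1\otimes(\Delta\Pi_1\otimes\mathrm{id})\Delta\Pi_2)\big)$ $=\big((\Pi_1\otimes\Pi_2m)(\Psi\otimes\mathrm{id})(\mathrm{id}\otimes\Delta)\otimes\Pi_1\otimes\Pi_1\big)\big(\mathrm{id}\otimes(\Psi\otimes\mathrm{id})(\mathrm{id}\otimes(\Pi_1\otimes\mathrm{id})\Delta\Pi_2)\big)$ and $\big((\Pi_1m(\mathrm{id}\otimes\Pi_2m)\otimes\Pi_2)(\mathrm{id}\otimes\mathrm{id}\otimes\Psi)\otimes\mathrm{id}\big)(\mathrm{id}\otimes\Phi'_{\Pi_1}\otimes\Psi)(\Pi_2\otimes\mathrm{id}\otimes(\Pi_2\otimes\mathrm{id})\Delta\Pi_1\otimes\Pi_2)$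 $=\big((\Pi_1m(\mathrm{id}\otimes\Pi_2)\otimes\mathrm{id})(\mathrm{id}\otimes\Psi)\otimes\mathrm{id}\big)\big(\Pi_2\otimes\Pi_2\otimes(m\otimes\mathrm{id})(\mathrm{id}\otimes\Psi)(\Delta\Pi_1\otimes\Pi_2)\big)$. **Theorem.** The following statements are equivalent. 1. There are objects $B_1,B_2$ and a strong Hopf datum $\mathfrak h$ on $(B_1,B_2)$ such that the cross product bialgebra $B_1\overset{\mathfrak h}{\bowtie}B_2$ is bialgebra isomorphic to $B$. 2. There are idempotents $\Pi_1,\Pi_2\in\mathrm{End}(B)$ satisfying the strong projection relations with $m(\Pi_1\otimes\Pi_1)=\Pi_1m(\Pi_1\otimes\Pi_1)$, $\Pi_1\eta=\eta$, $(\Pi_2\otimes\Pi_2)\Delta=(\Pi_2\otimes\Pi_2)\Delta\Pi_2$, $\varepsilon\Pi_2=\varepsilon$, such that $B\otimes B\xrightarrow{m(\Pi_1\otimes\Pi_2)}B\xrightarrow{(\Pi_1\otimes\Pi_2)\Delta}B\otimes B$ is a splitting of the idempotent $\Pi_1\otimes\Pi_2$. 3. There are objects $B_1,B_2$ and morphisms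 $B_1\xrightarrow{i_1}B\xrightarrow{p_1}B_1$, $B_2\xrightarrow{i_2}B\xrightarrow{p_2}B_2$ with $p_ji_j=\mathrm{id}_{B_j}$, where $i_1$ is an algebra morphism and $p_2$ a coalgebra morphism (for some algebra structure on $B_1$ and coalgebra structure on $B_2$), such that $m(i_1\otimes i_2)$ and $(p_1\otimes p_2)\Delta$ are mutually inverse isomorphisms between $B_1\otimes B_2$ and $B$, and the strong projection relations hold for $\Pi_j=i_jp_j$. Moreover the equivalence holds for corresponding data, and the correspondence is one-to-one: for given objects $B_1,B_2$ and morphisms $i_j:B_j\to B$, $p_j:B\to B_j$ the following are equivalent: * there are a strong Hopf datum $\mathfrak h$ on $(B_1,B_2)$ and a bialgebra isomorphism $\Lambda:B_1\overset{\mathfrak h}{\bowtie}B_2\to B$ with $i_1=\Lambda(\mathrm{id}\otimes\eta_2)$, $i_2=\Lambda(\eta_1\otimes\mathrm{id})$, $p_1=(\mathrm{id}\otimes\varepsilon_2)\Lambda^{-1}$, $p_2=(\varepsilon_1\otimes\mathrm{id})\Lambda^{-1}$; * there is exactly one such pair $(\mathfrak h,\Lambda)$; * $p_ji_j=\mathrm{id}$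 and $\Pi_j=i_jp_j$ satisfy all conditions in 2; * $i_1,p_1,i_2,p_2$ satisfy all conditions in 3. -/

import Mathlib

open CategoryTheory MonoidalCategory

universe v u

namespace CrossProduct

section

open scoped MonObj ComonObj

variable {C : Type u} [Category.{v} C] [MonoidalCategory C] [BraidedCategory C]

/-!
Conventions.  `f ≫ g` is "first `f`, then `g`"; `f ⊗≫ g` is the same composite with the canonical
associators and unitors inserted in between, so that the chains below can be read as string
diagrams from top to bottom in a strict category.  `(β_ X Y).hom` is the braiding
`X ⊗ Y ⟶ Y ⊗ X`.
-/

/-! ### Hopf data -/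

/-- The morphisms that constitute a Hopf datum on `(B₁, B₂)`: an algebra structure on `B₁`, a
coalgebra structure on `B₂`, and morphisms that need not satisfy any further law
(see `IsHopfDatum` for the axioms). -/
structure HopfDatumCore (B₁ B₂ : C) where
  /-- the algebra `(B₁, m₁, η₁)` -/
  alg₁ : MonObj B₁
  /-- the coalgebra `(B₂, Δ₂, ε₂)` -/
  coalg₂ : ComonObj B₂
  /-- the weak comultiplication `Δ₁` -/
  comul₁ : B₁ ⟶ B₁ ⊗ B₁
  /-- `ε₁` -/
  counit₁ : B₁ ⟶ 𝟙_ C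
  /-- the weak multiplication `m₂` -/
  mul₂ : B₂ ⊗ B₂ ⟶ B₂
  /-- `η₂` -/
  one₂ : 𝟙_ C ⟶ B₂
  /-- the weak left action `μ_l` -/
  actL : B₂ ⊗ B₁ ⟶ B₁
  /-- the right action `μ_r` -/
  actR : B₂ ⊗ B₁ ⟶ B₂
  /-- the left coaction `ν_l` -/
  coactL : B₁ ⟶ B₂ ⊗ B₁
  /-- the weak right coaction `ν_r` -/
  coactR : B₂ ⟶ B₂ ⊗ B₁
  /-- the cycle `ρ` -/
  cyc : B₂ ⟶ B₁ ⊗ B₁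
  /-- the cocycle `σ` -/
  coc : B₂ ⊗ B₂ ⟶ B₁

namespace HopfDatumCore

variable {B₁ B₂ : C} (h : HopfDatumCore B₁ B₂)

/-- `m₁` -/
abbrev mul₁ : B₁ ⊗ B₁ ⟶ B₁ := h.alg₁.mul

/-- `η₁` -/
abbrev one₁ : 𝟙_ C ⟶ B₁ := h.alg₁.one

/-- `Δ₂` -/
abbrev comul₂ : B₂ ⟶ B₂ ⊗ B₂ := h.coalg₂.comul

/-- `ε₂` -/
abbrev counit₂ : B₂ ⟶ 𝟙_ C := h.coalg₂.counit

/-- `φ_{1,2} = (m₂ ⊗ m₁) ∘ (id ⊗ Ψ ⊗ id) ∘ (ν_l ⊗ ν_r)` -/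
def phi12 : B₁ ⊗ B₂ ⟶ B₂ ⊗ B₁ :=
  (h.coactL ⊗ₘ h.coactR) ⊗≫
  (𝟙 B₂ ⊗ₘ (β_ B₁ B₂).hom ⊗ₘ 𝟙 B₁) ⊗≫
  (h.mul₂ ⊗ₘ h.mul₁)

/-- `φ_{2,1} = (μ_l ⊗ μ_r) ∘ (id ⊗ Ψ ⊗ id) ∘ (Δ₂ ⊗ Δ₁)` -/
def phi21 : B₂ ⊗ B₁ ⟶ B₁ ⊗ B₂ :=
  (h.comul₂ ⊗ₘ h.comul₁) ⊗≫
  (𝟙 B₂ ⊗ₘ (β_ B₂ B₁).hom ⊗ₘ 𝟙 B₁) ⊗≫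
  (h.actL ⊗ₘ h.actR)

/-- `σ̂ = (σ ⊗ m₂ ∘ (μ_r ⊗ id)) ∘ (id ⊗ Ψ ⊗ id) ∘ (Δ₂ ⊗ (ν_r ⊗ id) ∘ Δ₂)` -/
def sigmaHat : B₂ ⊗ B₂ ⟶ B₁ ⊗ B₂ :=
  (h.comul₂ ⊗ₘ (h.comul₂ ≫ (h.coactR ⊗ₘ 𝟙 B₂))) ⊗≫
  (𝟙 B₂ ⊗ₘ (β_ B₂ B₂).hom ⊗ₘ 𝟙 (B₁ ⊗ B₂)) ⊗≫
  (h.coc ⊗ₘ ((h.actR ⊗ₘ 𝟙 B₂) ≫ h.mul₂))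

/-- `ρ̂ = (m₁ ∘ (id ⊗ μ_l) ⊗ m₁) ∘ (id ⊗ Ψ ⊗ id) ∘ ((id ⊗ ν_l) ∘ Δ₁ ⊗ ρ)` -/
def rhoHat : B₁ ⊗ B₂ ⟶ B₁ ⊗ B₁ :=
  ((h.comul₁ ≫ (𝟙 B₁ ⊗ₘ h.coactL)) ⊗ₘ h.cyc) ⊗≫
  (𝟙 (B₁ ⊗ B₂) ⊗ₘ (β_ B₁ B₁).hom ⊗ₘ 𝟙 B₁) ⊗≫
  (((𝟙 B₁ ⊗ₘ h.actL) ≫ h.mul₁) ⊗ₘ h.mul₁)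

/-- The axioms of a Hopf datum. -/
structure IsHopfDatum : Prop where
  -- `ε₁` is an algebra morphism, `η₂` is a coalgebra morphism
  one₁_counit₁ : h.one₁ ≫ h.counit₁ = 𝟙 (𝟙_ C)
  mul₁_counit₁ : h.mul₁ ≫ h.counit₁ = (h.counit₁ ⊗ₘ h.counit₁) ⊗≫ 𝟙 (𝟙_ C)
  one₂_counit₂ : h.one₂ ≫ h.counit₂ = 𝟙 (𝟙_ C)
  one₂_comul₂ : h.one₂ ≫ h.comul₂ = 𝟙 (𝟙_ C) ⊗≫ (h.one₂ ⊗ₘ h.one₂)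
  -- `(B₁, ν_l)` is a left `B₂`-comodule
  coactL_coassoc : h.coactL ≫ (𝟙 B₂ ⊗ₘ h.coactL) = h.coactL ≫ (h.comul₂ ⊗ₘ 𝟙 B₁) ⊗≫ 𝟙 _
  coactL_counit₂ : h.coactL ≫ (h.counit₂ ⊗ₘ 𝟙 B₁) ⊗≫ 𝟙 B₁ = 𝟙 B₁
  -- `(B₂, μ_r)` is a right `B₁`-module
  actR_assoc : (h.actR ⊗ₘ 𝟙 B₁) ≫ h.actR = 𝟙 _ ⊗≫ (𝟙 B₂ ⊗ₘ h.mul₁) ≫ h.actR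
  one₁_actR : 𝟙 B₂ ⊗≫ (𝟙 B₂ ⊗ₘ h.one₁) ≫ h.actR = 𝟙 B₂
  -- (co)unital identities
  one₁_comul₁ : h.one₁ ≫ h.comul₁ = 𝟙 (𝟙_ C) ⊗≫ (h.one₁ ⊗ₘ h.one₁)
  comul₁_counit₁ : h.comul₁ ≫ (𝟙 B₁ ⊗ₘ h.counit₁) ⊗≫ 𝟙 B₁ = 𝟙 B₁
  counit₁_comul₁ : h.comul₁ ≫ (h.counit₁ ⊗ₘ 𝟙 B₁) ⊗≫ 𝟙 B₁ = 𝟙 B₁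
  mul₂_counit₂ : h.mul₂ ≫ h.counit₂ = (h.counit₂ ⊗ₘ h.counit₂) ⊗≫ 𝟙 (𝟙_ C)
  mul₂_one₂ : 𝟙 B₂ ⊗≫ (𝟙 B₂ ⊗ₘ h.one₂) ≫ h.mul₂ = 𝟙 B₂
  one₂_mul₂ : 𝟙 B₂ ⊗≫ (h.one₂ ⊗ₘ 𝟙 B₂) ≫ h.mul₂ = 𝟙 B₂
  one₂_actR : 𝟙 B₁ ⊗≫ (h.one₂ ⊗ₘ 𝟙 B₁) ≫ h.actR = h.counit₁ ≫ h.one₂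
  actR_counit₂ : h.actR ≫ h.counit₂ = (h.counit₂ ⊗ₘ h.counit₁) ⊗≫ 𝟙 (𝟙_ C)
  coactL_counit₁ : h.coactL ≫ (𝟙 B₂ ⊗ₘ h.counit₁) ⊗≫ 𝟙 B₂ = h.counit₁ ≫ h.one₂
  one₁_coactL : h.one₁ ≫ h.coactL = 𝟙 (𝟙_ C) ⊗≫ (h.one₂ ⊗ₘ h.one₁)
  one₂_actL : 𝟙 B₁ ⊗≫ (h.one₂ ⊗ₘ 𝟙 B₁) ≫ h.actL = 𝟙 B₁
  one₁_actL : 𝟙 B₂ ⊗≫ (𝟙 B₂ ⊗ₘ h.one₁) ≫ h.actL = h.counit₂ ≫ h.one₁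
  actL_counit₁ : h.actL ≫ h.counit₁ = (h.counit₂ ⊗ₘ h.counit₁) ⊗≫ 𝟙 (𝟙_ C)
  coactR_counit₁ : h.coactR ≫ (𝟙 B₂ ⊗ₘ h.counit₁) ⊗≫ 𝟙 B₂ = 𝟙 B₂
  coactR_counit₂ : h.coactR ≫ (h.counit₂ ⊗ₘ 𝟙 B₁) ⊗≫ 𝟙 B₁ = h.counit₂ ≫ h.one₁
  one₂_coactR : h.one₂ ≫ h.coactR = 𝟙 (𝟙_ C) ⊗≫ (h.one₂ ⊗ₘ h.one₁)
  one₂_coc : 𝟙 B₂ ⊗≫ (h.one₂ ⊗ₘ 𝟙 B₂) ≫ h.coc = h.counit₂ ≫ h.one₁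
  coc_one₂ : 𝟙 B₂ ⊗≫ (𝟙 B₂ ⊗ₘ h.one₂) ≫ h.coc = h.counit₂ ≫ h.one₁
  coc_counit₁ : h.coc ≫ h.counit₁ = (h.counit₂ ⊗ₘ h.counit₂) ⊗≫ 𝟙 (𝟙_ C)
  cyc_counit₁ : h.cyc ≫ (𝟙 B₁ ⊗ₘ h.counit₁) ⊗≫ 𝟙 B₁ = h.counit₂ ≫ h.one₁
  counit₁_cyc : h.cyc ≫ (h.counit₁ ⊗ₘ 𝟙 B₁) ⊗≫ 𝟙 B₁ = h.counit₂ ≫ h.one₁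
  one₂_cyc : h.one₂ ≫ h.cyc = 𝟙 (𝟙_ C) ⊗≫ (h.one₁ ⊗ₘ h.one₁)
  -- weak associativity of `m₂`
  mul₂_assoc :
    (h.mul₂ ⊗ₘ 𝟙 B₂) ≫ h.mul₂ =
      𝟙 _ ⊗≫ (𝟙 B₂ ⊗ₘ h.sigmaHat) ⊗≫ (h.actR ⊗ₘ 𝟙 B₂) ≫ h.mul₂
  -- weak coassociativity of `Δ₁`
  comul₁_coassoc :
    h.comul₁ ≫ (𝟙 B₁ ⊗ₘ h.comul₁) =
      h.comul₁ ≫ (𝟙 B₁ ⊗ₘ h.coactL) ⊗≫ (h.rhoHat ⊗ₘ 𝟙 B₁) ⊗≫ 𝟙 _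
  -- weak associativity of `μ_l`
  actL_assoc :
    𝟙 (B₂ ⊗ B₂ ⊗ B₁) ⊗≫ (h.sigmaHat ⊗ₘ 𝟙 B₁) ⊗≫ (𝟙 B₁ ⊗ₘ h.actL) ≫ h.mul₁ =
      (𝟙 B₂ ⊗ₘ h.phi21) ⊗≫ (h.phi21 ⊗ₘ 𝟙 B₂) ⊗≫ (𝟙 B₁ ⊗ₘ h.coc) ≫ h.mul₁
  -- weak coassociativity of `ν_r`
  coactR_coassoc :
    h.comul₂ ≫ (h.coactR ⊗ₘ 𝟙 B₂) ⊗≫ (𝟙 B₂ ⊗ₘ h.rhoHat) =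
      h.comul₂ ≫ (h.cyc ⊗ₘ 𝟙 B₂) ⊗≫ (𝟙 B₁ ⊗ₘ h.phi12) ⊗≫ (h.phi12 ⊗ₘ 𝟙 B₁) ⊗≫
        𝟙 (B₂ ⊗ B₁ ⊗ B₁)
  -- module-algebra compatibility
  mul₁_actL :
    (𝟙 B₂ ⊗ₘ h.mul₁) ≫ h.actL =
      𝟙 _ ⊗≫ (h.phi21 ⊗ₘ 𝟙 B₁) ⊗≫ (𝟙 B₁ ⊗ₘ h.actL) ≫ h.mul₁
  mul₂_actR :
    (h.mul₂ ⊗ₘ 𝟙 B₁) ≫ h.actR =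
      𝟙 _ ⊗≫ (𝟙 B₂ ⊗ₘ h.phi21) ⊗≫ (h.actR ⊗ₘ 𝟙 B₂) ≫ h.mul₂
  -- comodule-coalgebra compatibility
  coactL_comul₁ :
    h.coactL ≫ (𝟙 B₂ ⊗ₘ h.comul₁) =
      h.comul₁ ≫ (𝟙 B₁ ⊗ₘ h.coactL) ⊗≫ (h.phi12 ⊗ₘ 𝟙 B₁) ⊗≫ 𝟙 _
  coactR_comul₂ :
    h.coactR ≫ (h.comul₂ ⊗ₘ 𝟙 B₁) =
      h.comul₂ ≫ (h.coactR ⊗ₘ 𝟙 B₂) ⊗≫ (𝟙 B₂ ⊗ₘ h.phi12) ⊗≫ 𝟙 _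
  -- cocycle and cycle compatibilities
  coc_compat :
    𝟙 (B₂ ⊗ B₂ ⊗ B₂) ⊗≫ (h.sigmaHat ⊗ₘ 𝟙 B₂) ⊗≫ (𝟙 B₁ ⊗ₘ h.coc) ≫ h.mul₁ =
      (𝟙 B₂ ⊗ₘ h.sigmaHat) ⊗≫ (h.phi21 ⊗ₘ 𝟙 B₂) ⊗≫ (𝟙 B₁ ⊗ₘ h.coc) ≫ h.mul₁
  cyc_compat :
    h.comul₂ ≫ (h.cyc ⊗ₘ 𝟙 B₂) ⊗≫ (𝟙 B₁ ⊗ₘ h.rhoHat) =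
      h.comul₂ ≫ (h.cyc ⊗ₘ 𝟙 B₂) ⊗≫ (𝟙 B₁ ⊗ₘ h.phi12) ⊗≫ (h.rhoHat ⊗ₘ 𝟙 B₁) ⊗≫
        𝟙 (B₁ ⊗ B₁ ⊗ B₁)
  -- algebra-coalgebra compatibility
  mul₁_comul₁ :
    h.mul₁ ≫ h.comul₁ =
      (h.comul₁ ⊗ₘ h.comul₁) ⊗≫
      (𝟙 B₁ ⊗ₘ h.coactL ⊗ₘ 𝟙 B₁ ⊗ₘ 𝟙 B₁) ⊗≫
      (𝟙 B₁ ⊗ₘ 𝟙 B₂ ⊗ₘ (β_ B₁ B₁).hom ⊗ₘ 𝟙 B₁) ⊗≫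
      (𝟙 B₁ ⊗ₘ h.actL ⊗ₘ 𝟙 B₁ ⊗ₘ 𝟙 B₁) ⊗≫
      (h.mul₁ ⊗ₘ h.mul₁)
  mul₂_comul₂ :
    h.mul₂ ≫ h.comul₂ =
      (h.comul₂ ⊗ₘ h.comul₂) ⊗≫
      (𝟙 B₂ ⊗ₘ 𝟙 B₂ ⊗ₘ h.coactR ⊗ₘ 𝟙 B₂) ⊗≫
      (𝟙 B₂ ⊗ₘ (β_ B₂ B₂).hom ⊗ₘ 𝟙 B₁ ⊗ₘ 𝟙 B₂) ⊗≫
      (𝟙 B₂ ⊗ₘ 𝟙 B₂ ⊗ₘ h.actR ⊗ₘ 𝟙 B₂) ⊗≫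
      (h.mul₂ ⊗ₘ h.mul₂)
  -- module-coalgebra compatibility
  phi21_rhoHat :
    h.phi21 ≫ h.rhoHat =
      (h.comul₂ ⊗ₘ h.comul₁) ⊗≫
      (h.cyc ⊗ₘ h.comul₂ ⊗ₘ 𝟙 B₁ ⊗ₘ h.coactL) ⊗≫
      (𝟙 B₁ ⊗ₘ h.phi12 ⊗ₘ (β_ B₂ B₁).hom ⊗ₘ 𝟙 B₂ ⊗ₘ 𝟙 B₁) ⊗≫
      (𝟙 B₁ ⊗ₘ 𝟙 B₂ ⊗ₘ (β_ B₁ B₁).hom ⊗ₘ (β_ B₂ B₂).hom ⊗ₘ 𝟙 B₁) ⊗≫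
      (𝟙 B₁ ⊗ₘ h.phi21 ⊗ₘ (β_ B₁ B₂).hom ⊗ₘ 𝟙 B₂ ⊗ₘ 𝟙 B₁) ⊗≫
      (h.mul₁ ⊗ₘ h.coc ⊗ₘ 𝟙 B₁ ⊗ₘ h.actL) ⊗≫
      (h.mul₁ ⊗ₘ h.mul₁)
  actR_comul₂ :
    h.actR ≫ h.comul₂ =
      (h.comul₂ ⊗ₘ h.comul₁) ⊗≫
      (𝟙 B₂ ⊗ₘ (β_ B₂ B₁).hom ⊗ₘ h.coactL) ⊗≫
      (h.actR ⊗ₘ (β_ B₂ B₂).hom ⊗ₘ 𝟙 B₁) ⊗≫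
      (h.mul₂ ⊗ₘ h.actR)
  -- comodule-algebra compatibility
  mul₁_coactL :
    h.mul₁ ≫ h.coactL =
      (h.coactL ⊗ₘ h.comul₁) ⊗≫
      (𝟙 B₂ ⊗ₘ (β_ B₁ B₁).hom ⊗ₘ h.coactL) ⊗≫
      (h.actR ⊗ₘ (β_ B₁ B₂).hom ⊗ₘ 𝟙 B₁) ⊗≫
      (h.mul₂ ⊗ₘ h.mul₁)
  sigmaHat_phi12 :
    h.sigmaHat ≫ h.phi12 =
      (h.comul₂ ⊗ₘ h.comul₂) ⊗≫
      (h.coactR ⊗ₘ 𝟙 B₂ ⊗ₘ h.cyc ⊗ₘ h.comul₂) ⊗≫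
      (𝟙 B₂ ⊗ₘ 𝟙 B₁ ⊗ₘ (β_ B₂ B₁).hom ⊗ₘ h.phi12 ⊗ₘ 𝟙 B₂) ⊗≫
      (𝟙 B₂ ⊗ₘ (β_ B₁ B₁).hom ⊗ₘ (β_ B₂ B₂).hom ⊗ₘ 𝟙 B₁ ⊗ₘ 𝟙 B₂) ⊗≫
      (𝟙 B₂ ⊗ₘ 𝟙 B₁ ⊗ₘ (β_ B₁ B₂).hom ⊗ₘ h.phi21 ⊗ₘ 𝟙 B₂) ⊗≫
      (h.actR ⊗ₘ 𝟙 B₂ ⊗ₘ h.mul₁ ⊗ₘ h.coc) ⊗≫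
      (h.mul₂ ⊗ₘ h.mul₁)
  -- module-comodule compatibility
  phi21_phi12 :
    h.phi21 ≫ h.phi12 =
      (h.comul₂ ⊗ₘ h.comul₁) ⊗≫
      (h.coactR ⊗ₘ (β_ B₂ B₁).hom ⊗ₘ h.coactL) ⊗≫
      (𝟙 B₂ ⊗ₘ (β_ B₁ B₁).hom ⊗ₘ (β_ B₂ B₂).hom ⊗ₘ 𝟙 B₁) ⊗≫
      (h.actR ⊗ₘ (β_ B₁ B₂).hom ⊗ₘ h.actL) ⊗≫
      (h.mul₂ ⊗ₘ h.mul₁)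
  -- cycle-cocycle compatibility
  sigmaHat_rhoHat :
    h.sigmaHat ≫ h.rhoHat =
      (h.comul₂ ⊗ₘ h.comul₂) ⊗≫
      (h.cyc ⊗ₘ h.comul₂ ⊗ₘ h.cyc ⊗ₘ h.comul₂) ⊗≫
      (𝟙 B₁ ⊗ₘ h.phi12 ⊗ₘ (β_ B₂ B₁).hom ⊗ₘ h.phi12 ⊗ₘ 𝟙 B₂) ⊗≫
      (𝟙 B₁ ⊗ₘ 𝟙 B₂ ⊗ₘ (β_ B₁ B₁).hom ⊗ₘ (β_ B₂ B₂).hom ⊗ₘ 𝟙 B₁ ⊗ₘ 𝟙 B₂) ⊗≫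
      (𝟙 B₁ ⊗ₘ h.phi21 ⊗ₘ (β_ B₁ B₂).hom ⊗ₘ h.phi21 ⊗ₘ 𝟙 B₂) ⊗≫
      (h.mul₁ ⊗ₘ h.coc ⊗ₘ h.mul₁ ⊗ₘ h.coc) ⊗≫
      (h.mul₁ ⊗ₘ h.mul₁)

/-- A Hopf datum is strong if it satisfies these additional identities. -/
structure IsStrongHopfDatum : Prop extends h.IsHopfDatum where
  coactL_actR :
    (h.coactL ⊗ₘ 𝟙 B₁) ⊗≫
      (𝟙 B₂ ⊗ₘ (β_ B₁ B₁).hom) ⊗≫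
      (h.actR ⊗ₘ 𝟙 B₁) =
    (h.coactL ⊗ₘ h.counit₁) ⊗≫ 𝟙 (B₂ ⊗ B₁)
  coactL_actR' :
    (𝟙 B₂ ⊗ₘ h.coactL) ⊗≫
      ((β_ B₂ B₂).hom ⊗ₘ 𝟙 B₁) ⊗≫
      (𝟙 B₂ ⊗ₘ h.actR) =
    𝟙 (B₂ ⊗ B₁) ⊗≫ (h.one₂ ⊗ₘ h.actR)
  coactL_coactR_coc :
    (h.coactL ⊗ₘ 𝟙 B₂) ⊗≫
      (h.coactR ⊗ₘ (β_ B₁ B₂).hom) ⊗≫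
      (𝟙 B₂ ⊗ₘ (β_ B₁ B₂).hom ⊗ₘ 𝟙 B₁) ⊗≫
      (h.coc ⊗ₘ 𝟙 B₁ ⊗ₘ 𝟙 B₁) =
    𝟙 (B₁ ⊗ B₂) ⊗≫ (h.one₁ ⊗ₘ h.one₁ ⊗ₘ 𝟙 B₁ ⊗ₘ h.counit₂) ⊗≫ 𝟙 (B₁ ⊗ B₁ ⊗ B₁)
  cyc_actL_actR :
    (𝟙 B₂ ⊗ₘ 𝟙 B₂ ⊗ₘ h.cyc) ⊗≫
      (𝟙 B₂ ⊗ₘ (β_ B₂ B₁).hom ⊗ₘ 𝟙 B₁) ⊗≫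
      ((β_ B₂ B₁).hom ⊗ₘ h.actL) ⊗≫
      (𝟙 B₁ ⊗ₘ h.actR) =
    𝟙 (B₂ ⊗ B₂ ⊗ B₂) ⊗≫ (h.one₁ ⊗ₘ 𝟙 B₂ ⊗ₘ h.counit₂ ⊗ₘ h.counit₂) ⊗≫ 𝟙 (B₁ ⊗ B₂)
  coactL_coc :
    (𝟙 B₂ ⊗ₘ h.coactL) ⊗≫ (h.coc ⊗ₘ 𝟙 B₁) = ((h.counit₂ ≫ h.one₁) ⊗ₘ 𝟙 B₁)
  cyc_actR :
    (𝟙 B₂ ⊗ₘ h.cyc) ⊗≫ (h.actR ⊗ₘ 𝟙 B₁) = (𝟙 B₂ ⊗ₘ (h.counit₂ ≫ h.one₁))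
  cyc_comul₁_actR :
    (𝟙 B₂ ⊗ₘ 𝟙 B₁ ⊗ₘ h.cyc) ⊗≫
      (𝟙 B₂ ⊗ₘ 𝟙 B₁ ⊗ₘ h.comul₁ ⊗ₘ 𝟙 B₁) ⊗≫
      (𝟙 B₂ ⊗ₘ (β_ B₁ B₁).hom ⊗ₘ 𝟙 B₁ ⊗ₘ 𝟙 B₁) ⊗≫
      (𝟙 B₂ ⊗ₘ 𝟙 B₁ ⊗ₘ h.coactL ⊗ₘ 𝟙 B₁ ⊗ₘ 𝟙 B₁) ⊗≫
      ((β_ B₂ B₁).hom ⊗ₘ 𝟙 B₂ ⊗ₘ (β_ B₁ B₁).hom ⊗ₘ 𝟙 B₁) ⊗≫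
      (𝟙 B₁ ⊗ₘ 𝟙 B₂ ⊗ₘ h.actL ⊗ₘ 𝟙 B₁ ⊗ₘ 𝟙 B₁) ⊗≫
      (𝟙 B₁ ⊗ₘ h.actR ⊗ₘ 𝟙 B₁ ⊗ₘ 𝟙 B₁) =
    (𝟙 B₂ ⊗ₘ 𝟙 B₁ ⊗ₘ h.cyc) ⊗≫
      (𝟙 B₂ ⊗ₘ 𝟙 B₁ ⊗ₘ h.comul₁ ⊗ₘ 𝟙 B₁) ⊗≫
      (𝟙 B₂ ⊗ₘ (β_ B₁ B₁).hom ⊗ₘ 𝟙 B₁ ⊗ₘ 𝟙 B₁) ⊗≫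
      ((β_ B₂ B₁).hom ⊗ₘ (β_ B₁ B₁).hom ⊗ₘ 𝟙 B₁) ⊗≫
      (𝟙 B₁ ⊗ₘ h.actR ⊗ₘ 𝟙 B₁ ⊗ₘ 𝟙 B₁)
  coactL_mul₂_coc :
    (𝟙 B₂ ⊗ₘ 𝟙 B₂ ⊗ₘ h.coactL ⊗ₘ 𝟙 B₂) ⊗≫
      (𝟙 B₂ ⊗ₘ 𝟙 B₂ ⊗ₘ h.coactR ⊗ₘ 𝟙 B₁ ⊗ₘ 𝟙 B₂) ⊗≫
      (𝟙 B₂ ⊗ₘ (β_ B₂ B₂).hom ⊗ₘ 𝟙 B₁ ⊗ₘ (β_ B₁ B₂).hom) ⊗≫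
      (𝟙 B₂ ⊗ₘ 𝟙 B₂ ⊗ₘ h.actR ⊗ₘ 𝟙 B₂ ⊗ₘ 𝟙 B₁) ⊗≫
      (𝟙 B₂ ⊗ₘ 𝟙 B₂ ⊗ₘ (β_ B₂ B₂).hom ⊗ₘ 𝟙 B₁) ⊗≫
      (𝟙 B₂ ⊗ₘ h.mul₂ ⊗ₘ 𝟙 B₂ ⊗ₘ 𝟙 B₁) ⊗≫
      (h.coc ⊗ₘ 𝟙 B₂ ⊗ₘ 𝟙 B₁) =
    (𝟙 B₂ ⊗ₘ 𝟙 B₂ ⊗ₘ h.coactL ⊗ₘ 𝟙 B₂) ⊗≫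
      (𝟙 B₂ ⊗ₘ (β_ B₂ B₂).hom ⊗ₘ (β_ B₁ B₂).hom) ⊗≫
      (𝟙 B₂ ⊗ₘ 𝟙 B₂ ⊗ₘ (β_ B₂ B₂).hom ⊗ₘ 𝟙 B₁) ⊗≫
      (𝟙 B₂ ⊗ₘ h.mul₂ ⊗ₘ 𝟙 B₂ ⊗ₘ 𝟙 B₁) ⊗≫
      (h.coc ⊗ₘ 𝟙 B₂ ⊗ₘ 𝟙 B₁)

/-! ### The cross product bialgebra of a Hopf datum -/

/-- `m_B = (m₁ ⊗ id) ∘ (m₁ ⊗ σ̂) ∘ (id ⊗ φ_{2,1} ⊗ id)` on `B = B₁ ⊗ B₂` -/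
def crossMul : (B₁ ⊗ B₂) ⊗ (B₁ ⊗ B₂) ⟶ B₁ ⊗ B₂ :=
  𝟙 ((B₁ ⊗ B₂) ⊗ (B₁ ⊗ B₂)) ⊗≫
  (𝟙 B₁ ⊗ₘ h.phi21 ⊗ₘ 𝟙 B₂) ⊗≫
  (h.mul₁ ⊗ₘ h.sigmaHat) ⊗≫
  (h.mul₁ ⊗ₘ 𝟙 B₂)

/-- `η_B = η₁ ⊗ η₂` -/
def crossOne : 𝟙_ C ⟶ B₁ ⊗ B₂ :=
  𝟙 (𝟙_ C) ⊗≫ (h.one₁ ⊗ₘ h.one₂)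

/-- `Δ_B = (id ⊗ φ_{1,2} ⊗ id) ∘ (ρ̂ ⊗ Δ₂) ∘ (id ⊗ Δ₂)` on `B = B₁ ⊗ B₂` -/
def crossComul : B₁ ⊗ B₂ ⟶ (B₁ ⊗ B₂) ⊗ (B₁ ⊗ B₂) :=
  (𝟙 B₁ ⊗ₘ h.comul₂) ⊗≫
  (h.rhoHat ⊗ₘ h.comul₂) ⊗≫
  (𝟙 B₁ ⊗ₘ h.phi12 ⊗ₘ 𝟙 B₂) ⊗≫
  𝟙 ((B₁ ⊗ B₂) ⊗ (B₁ ⊗ B₂))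

/-- `ε_B = ε₁ ⊗ ε₂` -/
def crossCounit : B₁ ⊗ B₂ ⟶ 𝟙_ C :=
  (h.counit₁ ⊗ₘ h.counit₂) ⊗≫ 𝟙 (𝟙_ C)

/-- The bialgebra structure `S` on `B₁ ⊗ B₂` is the cross product structure defined by `h`. -/
structure IsCrossProductBialgebra (S : BimonObj (B₁ ⊗ B₂)) : Prop where
  mul_eq : S.mul = h.crossMul
  one_eq : S.one = h.crossOne
  comul_eq : S.comul = h.crossComul
  counit_eq : S.counit = h.crossCounit

/-- `e` is an isomorphism of bialgebras from the cross product bialgebra of `h` onto `B`. -/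
def IsBialgebraIso (B : C) [BimonObj B] (e : B₁ ⊗ B₂ ≅ B) : Prop :=
  ∃ S : BimonObj (B₁ ⊗ B₂), h.IsCrossProductBialgebra S ∧ IsBimonHom e.hom

/-- `i₁, p₁, i₂, p₂` are the injections and projections of `B` obtained from the isomorphism
`e : B₁ ⊗ B₂ ≅ B`, namely `i₁ = e ∘ (id ⊗ η₂)`, `p₁ = (id ⊗ ε₂) ∘ e⁻¹`, `i₂ = e ∘ (η₁ ⊗ id)` and
`p₂ = (ε₁ ⊗ id) ∘ e⁻¹`. -/
structure Induces (B : C) (e : B₁ ⊗ B₂ ≅ B) (i₁ : B₁ ⟶ B) (p₁ : B ⟶ B₁) (i₂ : B₂ ⟶ B)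
    (p₂ : B ⟶ B₂) : Prop where
  inj₁_eq : i₁ = (ρ_ B₁).inv ≫ (𝟙 B₁ ⊗ₘ h.one₂) ≫ e.hom
  proj₁_eq : p₁ = e.inv ≫ (𝟙 B₁ ⊗ₘ h.counit₂) ≫ (ρ_ B₁).hom
  inj₂_eq : i₂ = (λ_ B₂).inv ≫ (h.one₁ ⊗ₘ 𝟙 B₂) ≫ e.hom
  proj₂_eq : p₂ = e.inv ≫ (h.counit₁ ⊗ₘ 𝟙 B₂) ≫ (λ_ B₂).hom

end HopfDatumCore

/-! ### Idempotents, injections and projections of a bialgebra -/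

variable (B : C) [BimonObj B]

/-- Idempotents `Π₁, Π₂` of `B` such that `m ∘ (Π₁ ⊗ Π₂)` and `(Π₁ ⊗ Π₂) ∘ Δ` split the
idempotent `Π₁ ⊗ Π₂`. -/
structure IsIdempotentPair (P₁ P₂ : B ⟶ B) : Prop where
  idem₁ : P₁ ≫ P₁ = P₁
  idem₂ : P₂ ≫ P₂ = P₂
  mul_eq : (P₁ ⊗ₘ P₁) ≫ μ[B] = (P₁ ⊗ₘ P₁) ≫ μ[B] ≫ P₁
  one_eq : η[B] ≫ P₁ = η[B]
  comul_eq : Δ[B] ≫ (P₂ ⊗ₘ P₂) = P₂ ≫ Δ[B] ≫ (P₂ ⊗ₘ P₂)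
  counit_eq : P₂ ≫ ε[B] = ε[B]
  split_id : (Δ[B] ≫ (P₁ ⊗ₘ P₂)) ≫ ((P₁ ⊗ₘ P₂) ≫ μ[B]) = 𝟙 B
  split_idem : ((P₁ ⊗ₘ P₂) ≫ μ[B]) ≫ (Δ[B] ≫ (P₁ ⊗ₘ P₂)) = (P₁ ⊗ₘ P₂)

/-- Injections `i_j : B_j ⟶ B` and projections `p_j : B ⟶ B_j` with `p_j ∘ i_j = id`, `i₁` an
algebra morphism, `p₂` a coalgebra morphism, such that `m ∘ (i₁ ⊗ i₂)` and `(p₁ ⊗ p₂) ∘ Δ` are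
mutually inverse. -/
structure IsProjectionPair {B₁ B₂ : C} (i₁ : B₁ ⟶ B) (p₁ : B ⟶ B₁) (i₂ : B₂ ⟶ B) (p₂ : B ⟶ B₂) :
    Prop where
  retract₁ : i₁ ≫ p₁ = 𝟙 B₁
  retract₂ : i₂ ≫ p₂ = 𝟙 B₂
  isMonHom : ∃ _ : MonObj B₁, IsMonHom i₁
  isComonHom : ∃ _ : ComonObj B₂, IsComonHom p₂
  inv₁ : ((i₁ ⊗ₘ i₂) ≫ μ[B]) ≫ (Δ[B] ≫ (p₁ ⊗ₘ p₂)) = 𝟙 (B₁ ⊗ B₂)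
  inv₂ : (Δ[B] ≫ (p₁ ⊗ₘ p₂)) ≫ ((i₁ ⊗ₘ i₂) ≫ μ[B]) = 𝟙 B

/-- `Φ_f = (m ⊗ id) ∘ (f ⊗ Ψ) ∘ (Δ ⊗ id)` -/
def Phi (f : B ⟶ B) : B ⊗ B ⟶ B ⊗ B :=
  (Δ[B] ⊗ₘ 𝟙 B) ⊗≫ (f ⊗ₘ (β_ B B).hom) ⊗≫ (μ[B] ⊗ₘ 𝟙 B)

/-- The `π`-rotation `(id ⊗ m) ∘ (Ψ ⊗ f) ∘ (id ⊗ Δ)` of `Φ_f`. -/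
def PhiRot (f : B ⟶ B) : B ⊗ B ⟶ B ⊗ B :=
  (𝟙 B ⊗ₘ Δ[B]) ⊗≫ ((β_ B B).hom ⊗ₘ f) ⊗≫ (𝟙 B ⊗ₘ μ[B])

/-- `(m ⊗ id) ∘ (f ⊗ g ⊗ k) ∘ (id ⊗ Δ)`; for `f, g, k` among `Π₀ = id, Π₁, Π₂` this is
`δ_{(i,j,k)}`. -/
def delta (f g k : B ⟶ B) : B ⊗ B ⟶ B ⊗ B :=
  (𝟙 B ⊗ₘ Δ[B]) ⊗≫ (f ⊗ₘ g ⊗ₘ k) ⊗≫ (μ[B] ⊗ₘ 𝟙 B)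

/-- The strong projection relations for `Π₁, Π₂`.  The primed relations are the `π`-symmetric
counterparts, obtained by rotating the string diagrams by the angle `π` and exchanging `m ↔ Δ`,
`η ↔ ε`, `Π₁ ↔ Π₂`. -/
structure IsStrongProjection (P₁ P₂ : B ⟶ B) : Prop where
  rel_a :
    (P₁ ⊗ₘ P₁) ≫ Phi B (𝟙 B) ≫ (P₂ ⊗ₘ 𝟙 B) =
      ((P₁ ≫ Δ[B] ≫ (P₂ ⊗ₘ 𝟙 B)) ⊗ₘ ε[B]) ⊗≫ 𝟙 (B ⊗ B)
  rel_a' :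
    (𝟙 B ⊗ₘ P₁) ≫ PhiRot B (𝟙 B) ≫ (P₂ ⊗ₘ P₂) =
      𝟙 (B ⊗ B) ⊗≫ (η[B] ⊗ₘ ((𝟙 B ⊗ₘ P₁) ≫ μ[B] ≫ P₂))
  rel_b :
    ((P₁ ≫ Δ[B]) ⊗ₘ P₂) ⊗≫
      (P₂ ⊗ₘ (β_ B B).hom) ⊗≫
      ((Phi B P₂ ≫ (P₁ ⊗ₘ P₁)) ⊗ₘ 𝟙 B) ⊗≫ 𝟙 (B ⊗ B ⊗ B) =
    𝟙 (B ⊗ B) ⊗≫ (η[B] ⊗ₘ η[B] ⊗ₘ P₁ ⊗ₘ ε[B]) ⊗≫ 𝟙 (B ⊗ B ⊗ B)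
  rel_b' :
    𝟙 (B ⊗ B ⊗ B) ⊗≫
      (𝟙 B ⊗ₘ ((P₂ ⊗ₘ P₂) ≫ PhiRot B P₁)) ⊗≫
      ((β_ B B).hom ⊗ₘ P₁) ⊗≫
      (P₁ ⊗ₘ (μ[B] ≫ P₂)) =
    𝟙 (B ⊗ B ⊗ B) ⊗≫ (η[B] ⊗ₘ P₂ ⊗ₘ ε[B] ⊗ₘ ε[B]) ⊗≫ 𝟙 (B ⊗ B)
  rel_c :
    (𝟙 B ⊗ₘ P₁) ≫ delta B P₂ P₂ (𝟙 B) ≫ (P₁ ⊗ₘ 𝟙 B) = ((ε[B] ≫ η[B]) ⊗ₘ P₁)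
  rel_c' :
    (𝟙 B ⊗ₘ P₂) ≫ delta B (𝟙 B) P₁ P₁ ≫ (P₂ ⊗ₘ 𝟙 B) = (P₂ ⊗ₘ (ε[B] ≫ η[B]))
  rel_d :
    (𝟙 B ⊗ₘ ((P₁ ⊗ₘ (P₂ ≫ Δ[B] ≫ ((P₁ ≫ Δ[B]) ⊗ₘ 𝟙 B))) ⊗≫
        ((β_ B B).hom ⊗ₘ 𝟙 B ⊗ₘ 𝟙 B))) ⊗≫
      ((β_ B B).hom ⊗ₘ Phi B P₂ ⊗ₘ 𝟙 B) ⊗≫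
      (P₁ ⊗ₘ ((𝟙 B ⊗ₘ P₁) ≫ μ[B] ≫ P₂) ⊗ₘ 𝟙 B ⊗ₘ P₁) =
    (𝟙 B ⊗ₘ ((𝟙 B ⊗ₘ (P₂ ≫ Δ[B] ≫ (P₁ ⊗ₘ 𝟙 B))) ⊗≫
        ((β_ B B).hom ⊗ₘ 𝟙 B))) ⊗≫
      (((𝟙 B ⊗ₘ Δ[B]) ⊗≫ ((β_ B B).hom ⊗ₘ 𝟙 B) ⊗≫ (P₁ ⊗ₘ (μ[B] ≫ P₂))) ⊗ₘ P₁ ⊗ₘ P₁) ⊗≫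
      𝟙 (B ⊗ B ⊗ B ⊗ B)
  rel_d' :
    (P₂ ⊗ₘ 𝟙 B ⊗ₘ (P₁ ≫ Δ[B] ≫ (P₂ ⊗ₘ 𝟙 B)) ⊗ₘ P₂) ⊗≫
      (𝟙 B ⊗ₘ PhiRot B P₁ ⊗ₘ (β_ B B).hom) ⊗≫
      (((𝟙 B ⊗ₘ 𝟙 B ⊗ₘ (β_ B B).hom) ⊗≫
        (((𝟙 B ⊗ₘ (μ[B] ≫ P₂)) ≫ μ[B] ≫ P₁) ⊗ₘ P₂)) ⊗ₘ 𝟙 B) ⊗≫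
      𝟙 (B ⊗ B ⊗ B) =
    (P₂ ⊗ₘ P₂ ⊗ₘ (((P₁ ≫ Δ[B]) ⊗ₘ P₂) ⊗≫ (𝟙 B ⊗ₘ (β_ B B).hom) ⊗≫ (μ[B] ⊗ₘ 𝟙 B))) ⊗≫
      (((𝟙 B ⊗ₘ (β_ B B).hom) ⊗≫
        (((𝟙 B ⊗ₘ P₂) ≫ μ[B] ≫ P₁) ⊗ₘ 𝟙 B)) ⊗ₘ 𝟙 B) ⊗≫
      𝟙 (B ⊗ B ⊗ B)

end

end CrossProduct

open CrossProduct

-- Everything passes through one equational notion, `IsSplitPair`: maps i_j, p_j with p_j i_j = id,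
-- where products of elements of B₁ stay in B₁ and Π₁η = η, dually for Π₂ with Δ and ε, and where
-- m(i₁ ⊗ i₂) and (p₁ ⊗ p₂)Δ are mutually inverse. The idempotent and the projection descriptions
-- are reformulations of it. Splitting of idempotents in C serves only to pass from Π₁, Π₂ to maps
-- i_j, p_j.
--
-- From B to a Hopf datum: each structure morphism of `Splitting.datum` is a structure morphism of B
-- enclosed between injections and projections. The crux is that φ₂,₁, φ₁,₂, σ̂ and ρ̂, which are
-- built from these pieces, collapse to (p ⊗ p)Δm(i ⊗ i) with the appropriate indices (`phi21_eq`,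
-- `phi12_eq`, `sigmaHat_eq`, `rhoHat_eq`). This is the bialgebra law of B with projections inserted
-- on the inner strands. Relations 1 and 2 make the insertion legitimate: a strand is split by id =
-- m(Π₁ ⊗ Π₂)Δ and the unwanted factor is removed. After the collapse each axiom is associativity,
-- coassociativity or the bialgebra law of B, cut along the same splitting of the identity. Among
-- the axioms, relation 3 is needed only for Δ₁m₁ and Δ₂m₂. Relation 4 is needed only for the last
-- two identities of a strong datum.
--
-- From a Hopf datum to B: the unit and counit identities alone show that the cross product,
-- restricted along id ⊗ η₂, η₁ ⊗ id, id ⊗ ε₂ and ε₁ ⊗ id, returns the structure morphisms of the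
-- datum. Hence the induced maps form a split pair, the datum equals `Splitting.datum` of that pair,
-- and Λ = m(i₁ ⊗ i₂). This gives uniqueness. For such a datum the additional strong identities and
-- the projection relations are the same equations, up to redundant projections and sliding maps
-- through braidings.
--
-- The diagrammatic computations are carried out by reflection. A string diagram is a list of gates
-- with positions, a derivation is a list of rewriting steps, and `diagEq_of_check` turns a
-- successful evaluation of the checker into an equality of morphisms. The setup is symmetric under
-- rotation by π with m ↔ Δ, η ↔ ε, Π₁ ↔ Π₂, so most laws occur in dual pairs.

namespace CrossProduct

namespace Diagram

-- Syntax of string diagrams.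

section Diagrams

variable {K G : Type}

/-- The possible sources and targets of a box: at most two strands. -/
inductive Shape (K : Type)
  | nil
  | one (a : K)
  | two (a b : K)
  deriving DecidableEq

/-- Put the strands of a shape in front of a word. -/
def Shape.word : Shape K → List K → List K
  | nil, w => w
  | one a, w => a :: w
  | two a b, w => a :: b :: w

/-- The number of strands of a shape. -/
def Shape.length : Shape K → ℕ
  | nil => 0
  | one _ => 1
  | two _ _ => 2

/-- Recognise a word that begins with the strands of a shape. -/
def Shape.split [DecidableEq K] : (s : Shape K) → (w : List K) → Option {r // s.word r = w}
  | nil, w => some ⟨w, rfl⟩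
  | one _, [] => none
  | one a, b :: w => if h : a = b then some ⟨w, by simp [word, h]⟩ else none
  | two _ _, [] => none
  | two _ _, [_] => none
  | two a b, c :: d :: w =>
      if h : a = c ∧ b = d then some ⟨w, by simp [word, h.1, h.2]⟩ else none

/-- The sources and targets of a set `G` of boxes, for strands of the kinds `K`. -/
class Signature (K G : Type) where
  dom : G → Shape K
  cod : G → Shape K

/-- The elementary morphisms of string diagrams: boxes, braidings and inverse braidings. -/
inductive Gate (K G : Type)
  | box (g : G)
  | braid (positive : Bool) (a b : K)
  deriving DecidableEq

variable [Signature K G]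

/-- The source of a gate. -/
def Gate.dom : Gate K G → Shape K
  | box g => Signature.dom g
  | braid _ a b => .two a b

/-- The target of a gate. -/
def Gate.cod : Gate K G → Shape K
  | box g => Signature.cod g
  | braid _ a b => .two b a

/-- A string diagram is a list of gates, each with the number of strands to its left. -/
abbrev Diag (K G : Type) := List (ℕ × Gate K G)

/-- Add `n` strands on the left. -/
def shift (n : ℕ) (d : Diag K G) : Diag K G := d.map fun l => (l.1 + n, l.2)

variable [DecidableEq K]

/-- The target of a single gate. -/
def actWord : ℕ → Gate K G → List K → Option (List K)
  | 0, g, w => (g.dom.split w).map fun r => g.cod.word r.1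
  | _ + 1, _, [] => none
  | k + 1, g, a :: w => (actWord k g w).map (a :: ·)

/-- The target of a diagram. -/
def target : Diag K G → List K → Option (List K)
  | [], w => some w
  | l :: d, w => (actWord l.1 l.2 w).bind (target d)

end Diagrams

-- Interpretation of diagrams in a braided monoidal category.

section Semantics

variable {K G : Type} [Signature K G]
variable {C : Type u} [Category.{v} C] [MonoidalCategory C]

/-- The object of a shape. -/
def Shape.ob (obj : K → C) : Shape K → C
  | nil => 𝟙_ C
  | one a => obj a
  | two a b => obj a ⊗ obj b

/-- The tensor product of a word, bracketed to the right. -/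
def tens (obj : K → C) : List K → C
  | [] => 𝟙_ C
  | a :: w => obj a ⊗ tens obj w

/-- Whisker with a shape. -/
def Shape.whisk (obj : K → C) : (s : Shape K) → {w w' : List K} → (tens obj w ⟶ tens obj w') →
    (tens obj (s.word w) ⟶ tens obj (s.word w'))
  | nil, _, _, f => f
  | one a, _, _, f => obj a ◁ f
  | two a b, _, _, f => obj a ◁ obj b ◁ f

/-- A shape in front of a word. -/
def Shape.iso (obj : K → C) : (s : Shape K) → (w : List K) →
    (s.ob obj ⊗ tens obj w ≅ tens obj (s.word w))
  | nil, _ => λ_ _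
  | one _, _ => Iso.refl _
  | two _ _, _ => α_ _ _ _

/-- Apply a morphism between shapes at the left end of a word. -/
def front (obj : K → C) {s t : Shape K} (f : s.ob obj ⟶ t.ob obj) (w : List K) :
    tens obj (s.word w) ⟶ tens obj (t.word w) :=
  (s.iso obj w).inv ≫ f ▷ tens obj w ≫ (t.iso obj w).hom

lemma Shape.whisk_iso (obj : K → C) (s : Shape K) {w w' : List K}
    (f : tens obj w ⟶ tens obj w') :
    (s.iso obj w).hom ≫ s.whisk obj f = s.ob obj ◁ f ≫ (s.iso obj w').hom := by
  cases s with
  | nil => simp [iso, whisk, Shape.ob, Shape.word]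
  | one a =>
    simp only [iso, whisk, Shape.ob, Shape.word, Iso.refl_hom]
    exact (Category.id_comp _).trans (Category.comp_id _).symm
  | two a b =>
    simp only [iso, whisk, Shape.ob, Shape.word]
    exact (associator_naturality_right _ _ f).symm

lemma Shape.iso_whisk (obj : K → C) (s : Shape K) {w w' : List K}
    (f : tens obj w ⟶ tens obj w') :
    s.whisk obj f = (s.iso obj w).inv ≫ s.ob obj ◁ f ≫ (s.iso obj w').hom := by
  rw [← Shape.whisk_iso, Iso.inv_hom_id_assoc]

/-- This is the interchange law in its simplest position: a box at the left end commutes with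
anything to the right of its strands. -/
lemma front_naturality (obj : K → C) {s t : Shape K} (g : s.ob obj ⟶ t.ob obj) {w w' : List K}
    (f : tens obj w ⟶ tens obj w') :
    front obj g w ≫ t.whisk obj f = s.whisk obj f ≫ front obj g w' := by
  simp only [front, Category.assoc, Shape.iso_whisk, Iso.hom_inv_id_assoc]
  rw [whisker_exchange_assoc]

variable [BraidedCategory C]

/-- An interpretation of a signature in a braided monoidal category. -/
structure Interp (K G : Type) [Signature K G] (C : Type u) [Category.{v} C]
    [MonoidalCategory C] [BraidedCategory C] where
  obj : K → C
  box : ∀ g : G, (Signature.dom g : Shape K).ob obj ⟶ (Signature.cod g : Shape K).ob obj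

/-- The braiding or the inverse braiding. -/
def brd : Bool → (X Y : C) → (X ⊗ Y ⟶ Y ⊗ X)
  | true, X, Y => (β_ X Y).hom
  | false, X, Y => (β_ Y X).inv

variable (I : Interp K G C)

/-- The morphism of a gate. -/
def Interp.gate : (g : Gate K G) → (g.dom.ob I.obj ⟶ g.cod.ob I.obj)
  | .box g => I.box g
  | .braid s a b => brd s (I.obj a) (I.obj b)

/-- A morphism out of the object of a word, with its target. -/
abbrev Arrow' (obj : K → C) (w : List K) := Σ w' : List K, (tens obj w ⟶ tens obj w')

variable [DecidableEq K]

/-- The morphism of a single gate at the given position. -/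
def act : ℕ → Gate K G → (w : List K) → Option (Arrow' I.obj w)
  | 0, g, w => (g.dom.split w).map fun r =>
      ⟨g.cod.word r.1, eqToHom (congrArg _ r.2.symm) ≫ front I.obj (I.gate g) r.1⟩
  | _ + 1, _, [] => none
  | k + 1, g, a :: w => (act k g w).map fun x => ⟨a :: x.1, I.obj a ◁ x.2⟩

/-- The morphism of a diagram. -/
def eval : Diag K G → (w : List K) → Option (Arrow' I.obj w)
  | [], w => some ⟨w, 𝟙 _⟩
  | l :: d, w => (act I l.1 l.2 w).bind fun x => (eval d x.1).map fun y => ⟨y.1, x.2 ≫ y.2⟩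

@[simp] lemma Shape.split_word (s : Shape K) (r : List K) : s.split (s.word r) = some ⟨r, rfl⟩ := by
  cases s <;> simp [split, word]

@[simp] lemma act_zero (g : Gate K G) (r : List K) :
    act I 0 g (g.dom.word r) = some ⟨g.cod.word r, front I.obj (I.gate g) r⟩ := by
  simp [act]

lemma act_zero_of_not {g : Gate K G} {w : List K} (h : ∀ r, g.dom.word r ≠ w) :
    act I 0 g w = none := by
  rw [act, Option.map_eq_none_iff]
  cases hs : g.dom.split w with
  | none => rfl
  | some r => exact absurd r.2 (h r.1)

lemma act_add_length (s : Shape K) (k : ℕ) (g : Gate K G) (r : List K) :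
    act I (k + s.length) g (s.word r) =
      (act I k g r).map fun x => ⟨s.word x.1, s.whisk I.obj x.2⟩ := by
  cases s
  · simp [Shape.length, Shape.word, Shape.whisk]
  · rfl
  · simp only [Shape.length, Shape.word, Shape.whisk, act, Option.map_map]
    rfl

/-- A gate to the right of the strands of `s` leaves them alone, so they were already present before
it acted. Evaluation is partial, and this shows that the two orders of an interchange are undefined
together. -/
lemma act_add_length_word (s : Shape K) (k : ℕ) (g : Gate K G) (w : List K)
    (x : Arrow' I.obj w) (h : act I (k + s.length) g w = some x) (r : List K)
    (hr : s.word r = x.1) : ∃ r', s.word r' = w := by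
  cases s with
  | nil => exact ⟨w, rfl⟩
  | one a =>
    cases w with
    | nil => simp [Shape.length, act] at h
    | cons b w =>
      simp only [Shape.length, act, Option.map_eq_some_iff] at h
      obtain ⟨y, -, rfl⟩ := h
      simp only [Shape.word, List.cons.injEq] at hr
      exact ⟨w, by simp [Shape.word, hr.1]⟩
  | two a b =>
    match w with
    | [] => simp [Shape.length, act] at h
    | [c] => simp [Shape.length, act] at h
    | c :: d :: w =>
      simp only [Shape.length, act, Option.map_eq_some_iff] at h
      obtain ⟨y, ⟨z, -, rfl⟩, rfl⟩ := h
      simp only [Shape.word, List.cons.injEq] at hr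
      exact ⟨w, by simp [Shape.word, hr.1, hr.2.1]⟩

lemma eval_cons (l : ℕ × Gate K G) (d : Diag K G) (w : List K) :
    eval I (l :: d) w =
      (act I l.1 l.2 w).bind fun x => (eval I d x.1).map fun y => ⟨y.1, x.2 ≫ y.2⟩ := rfl

lemma eval_singleton (l : ℕ × Gate K G) (w : List K) : eval I [l] w = act I l.1 l.2 w := by
  simp only [eval, Option.map_some, Category.comp_id]
  cases act I l.1 l.2 w <;> rfl

lemma eval_append (d d' : Diag K G) (w : List K) :
    eval I (d ++ d') w =
      (eval I d w).bind fun x => (eval I d' x.1).map fun y => ⟨y.1, x.2 ≫ y.2⟩ := by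
  induction d generalizing w with
  | nil => simp [eval]
  | cons l d ih =>
    rw [List.cons_append, eval_cons, eval_cons]
    cases act I l.1 l.2 w with
    | none => rfl
    | some x =>
      simp only [Option.bind_some, ih]
      cases eval I d x.1 with
      | none => rfl
      | some y => simp [Function.comp_def]

lemma eval_append_congr {d₁ d₂ : Diag K G} (d : Diag K G) {w : List K}
    (h : eval I d₁ w = eval I d₂ w) : eval I (d₁ ++ d) w = eval I (d₂ ++ d) w := by
  rw [eval_append, eval_append, h]

lemma eval_congr_append (d : Diag K G) {d₁ d₂ : Diag K G} (h : ∀ w, eval I d₁ w = eval I d₂ w)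
    (w : List K) : eval I (d ++ d₁) w = eval I (d ++ d₂) w := by
  rw [eval_append, eval_append]
  simp only [h]

lemma eval_shift_one (d : Diag K G) (a : K) (w : List K) :
    eval I (shift 1 d) (a :: w) = (eval I d w).map fun x => ⟨a :: x.1, I.obj a ◁ x.2⟩ := by
  induction d generalizing w with
  | nil => simp only [shift, List.map_nil, eval, Option.map_some, whiskerLeft_id]; rfl
  | cons l d ih =>
    have : shift 1 (l :: d) = (l.1 + 1, l.2) :: shift 1 d := rfl
    rw [this, eval_cons, eval_cons]
    simp only [act]
    cases act I l.1 l.2 w with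
    | none => rfl
    | some x =>
      simp only [Option.map_some, Option.bind_some, ih, Option.map_map]
      cases eval I d x.1 with
      | none => rfl
      | some y => simp only [Option.map_some, Function.comp_apply,
          MonoidalCategory.whiskerLeft_comp]; rfl

end Semantics

section

variable {K G : Type}

lemma shift_shift (m n : ℕ) (d : Diag K G) : shift m (shift n d) = shift (n + m) d := by
  simp [shift, Function.comp_def, add_assoc]

lemma shift_zero (d : Diag K G) : shift 0 d = d := by
  simp [shift]

end

end Diagram

end CrossProduct

namespace CrossProduct

namespace Diagram

-- Interchange of gates, normal forms and the extraction of a block of gates.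

section Interchange

variable {K G : Type} [Signature K G]

/-- Interchange two consecutive gates that act on different strands. -/
def swap (x y : ℕ × Gate K G) : Option ((ℕ × Gate K G) × (ℕ × Gate K G)) :=
  if y.1 + y.2.dom.length ≤ x.1 then
    some (y, (x.1 - y.2.dom.length + y.2.cod.length, x.2))
  else if x.1 + x.2.cod.length ≤ y.1 then
    some ((y.1 - x.2.cod.length + x.2.dom.length, y.2), x)
  else none

/-- Insert a gate at the end of a reversed diagram and move it in front of all the gates that lie
to its right. -/
def insertRev (y : ℕ × Gate K G) : Diag K G → Diag K G
  | [] => [y]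
  | x :: d =>
      if y.1 + y.2.dom.length ≤ x.1 then
        (x.1 - y.2.dom.length + y.2.cod.length, x.2) :: insertRev y d
      else y :: x :: d

/-- Normal form of the reverse of a diagram up to interchange, appended to a reversed diagram. -/
def normRev : Diag K G → Diag K G → Diag K G
  | [], acc => acc
  | l :: d, acc => normRev d (insertRev l acc)

/-- Normal form of a diagram up to interchange. -/
def norm (d : Diag K G) : Diag K G := (normRev d []).reverse

/-- Move a gate from the end of a reversed diagram to its beginning. -/
def moveUp (y : ℕ × Gate K G) : Diag K G → Option ((ℕ × Gate K G) × Diag K G)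
  | [] => some (y, [])
  | x :: d =>
      (swap x y).bind fun p => (moveUp p.1 d).map fun q => (q.1, p.2 :: q.2)

/-- Collect the gates with the given (increasing) indices into a block.  The first three diagrams,
which are reversed, contain the gates before the block, the gates of the block and the gates after
the block. -/
def gather : Diag K G → Diag K G → Diag K G → ℕ → List ℕ → Diag K G →
    Option (Diag K G × Diag K G × Diag K G)
  | pre, blk, aft, _, [], d => some (pre, blk.reverse, aft.reverse ++ d)
  | _, _, _, _, _ :: _, [] => none
  | pre, blk, aft, n, i :: is, l :: d =>
      if n = i then
        (moveUp l aft).bind fun p => gather pre (p.1 :: blk) p.2 (n + 1) is d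
      else
        match (moveUp l aft).bind fun p => (moveUp p.1 blk).map fun q => (p, q) with
        | some (p, q) => gather (q.1 :: pre) q.2 p.2 (n + 1) (i :: is) d
        | none => gather pre blk (l :: aft) (n + 1) (i :: is) d

variable {C : Type u} [Category.{v} C] [MonoidalCategory C] [BraidedCategory C]
variable (I : Interp K G C) [DecidableEq K]

/-- When the word begins with the source of `g`, this is `front_naturality`. Otherwise neither order
evaluates. -/
lemma eval_interchange_zero (g h : Gate K G) (l : ℕ) (w : List K) :
    eval I [(0, g), (l + g.cod.length, h)] w = eval I [(l + g.dom.length, h), (0, g)] w := by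
  rw [eval_cons, eval_cons]
  simp only [eval_singleton]
  by_cases hw : ∃ r, g.dom.word r = w
  · obtain ⟨r, rfl⟩ := hw
    simp only [act_zero, Option.bind_some, act_add_length, Option.map_map]
    cases act I l h r with
    | none => rfl
    | some x =>
      simp only [Option.map_some, Option.bind_some, act_zero, Function.comp_def,
        front_naturality]
  · push Not at hw
    rw [act_zero_of_not I hw, Option.bind_none]
    cases hx : act I (l + g.dom.length) h w with
    | none => rfl
    | some x =>
      rw [Option.bind_some, act_zero_of_not, Option.map_none]
      intro r hr
      obtain ⟨r', hr'⟩ := act_add_length_word I g.dom l h w x hx r hr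
      exact hw r' hr'

lemma eval_interchange (k l : ℕ) (g h : Gate K G) (w : List K) :
    eval I [(k, g), (l + g.cod.length + k, h)] w =
      eval I [(l + g.dom.length + k, h), (k, g)] w := by
  induction k generalizing w with
  | zero => exact eval_interchange_zero I g h l w
  | succ k ih =>
    cases w with
    | nil => simp [eval_cons, act, ← add_assoc]
    | cons a w =>
      have h1 := eval_shift_one I [(k, g), (l + g.cod.length + k, h)] a w
      have h2 := eval_shift_one I [(l + g.dom.length + k, h), (k, g)] a w
      rw [ih] at h1
      exact h1.trans h2.symm

lemma eval_swap {x y : ℕ × Gate K G} {p} (h : swap x y = some p) (w : List K) :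
    eval I [x, y] w = eval I [p.1, p.2] w := by
  obtain ⟨k, g⟩ := x
  obtain ⟨l, h'⟩ := y
  unfold swap at h
  split_ifs at h with h1 h2
  · cases h
    -- The guard of `swap` bounds the offset from below, so its truncated subtraction is exact and
    -- can be removed by this substitution.
    obtain ⟨m, rfl⟩ : ∃ m, k = m + h'.dom.length + l := ⟨k - h'.dom.length - l, by grind⟩
    have : m + h'.dom.length + l - h'.dom.length + h'.cod.length = m + h'.cod.length + l := by
      omega
    simp only [this]
    exact (eval_interchange I l m h' g w).symm
  · cases h
    obtain ⟨m, rfl⟩ : ∃ m, l = m + g.cod.length + k := ⟨l - g.cod.length - k, by grind⟩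
    have : m + g.cod.length + k - g.cod.length + g.dom.length = m + g.dom.length + k := by
      omega
    simp only [this]
    exact eval_interchange I k m g h' w

lemma eval_insertRev (y : ℕ × Gate K G) (d : Diag K G) (w : List K) :
    eval I (insertRev y d).reverse w = eval I (d.reverse ++ [y]) w := by
  induction d with
  | nil => rfl
  | cons x d ih =>
    unfold insertRev
    split_ifs with h
    · rw [List.reverse_cons, eval_append_congr I _ ih, List.append_assoc, List.reverse_cons,
        List.append_assoc]
      refine eval_congr_append I _ (fun w => ?_) w
      exact (eval_swap I (by unfold swap; rw [if_pos h]) w).symm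
    · simp

lemma eval_normRev (d acc : Diag K G) (w : List K) :
    eval I (normRev d acc).reverse w = eval I (acc.reverse ++ d) w := by
  induction d generalizing acc with
  | nil => simp [normRev]
  | cons l d ih =>
    rw [normRev, ih, eval_append_congr I _ (eval_insertRev I l acc w)]
    simp

/-- Only invariance of the value is needed. That equivalent diagrams have the same normal form is
neither proved nor used: if they differ, a check merely fails. -/
lemma eval_norm (d : Diag K G) (w : List K) : eval I (norm d) w = eval I d w := by
  rw [norm, eval_normRev]
  rfl

lemma eval_moveUp {y : ℕ × Gate K G} {d : Diag K G} {q} (h : moveUp y d = some q)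
    (w : List K) : eval I (q.1 :: q.2.reverse) w = eval I (d.reverse ++ [y]) w := by
  induction d generalizing y q with
  | nil => cases h; rfl
  | cons x d ih =>
    simp only [moveUp, Option.bind_eq_some_iff, Option.map_eq_some_iff] at h
    obtain ⟨p, hp, q, hq, rfl⟩ := h
    have := ih hq
    rw [List.reverse_cons, ← List.cons_append, eval_append_congr I _ this, List.reverse_cons,
      List.append_assoc, List.append_assoc]
    exact eval_congr_append I _ (fun w => (eval_swap I hp w).symm) w

/-- The invariant of the recursion is the value of the four pieces in the order before the block,
block, after the block, unread gates. Every transfer between pieces is a sequence of interchanges.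
-/
lemma eval_gather {pre blk aft : Diag K G} {n : ℕ} {is : List ℕ} {d : Diag K G} {r}
    (h : gather pre blk aft n is d = some r) (w : List K) :
    eval I (r.1.reverse ++ (r.2.1 ++ r.2.2)) w =
      eval I (pre.reverse ++ (blk.reverse ++ (aft.reverse ++ d))) w := by
  induction d generalizing pre blk aft n is with
  | nil =>
    cases is with
    | nil => cases h; simp
    | cons i is => simp [gather] at h
  | cons l d ih =>
    cases is with
    | nil => cases h; simp
    | cons i is =>
      have key : ∀ {p}, moveUp l aft = some p → ∀ w,
          eval I (p.1 :: (p.2.reverse ++ d)) w = eval I (aft.reverse ++ l :: d) w := by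
        intro p hp w
        have := eval_append_congr I d (eval_moveUp I hp w)
        simpa using this
      unfold gather at h
      split_ifs at h with hn
      · rw [Option.bind_eq_some_iff] at h
        obtain ⟨p, hp, h⟩ := h
        rw [ih h]
        refine eval_congr_append I _ (fun w => ?_) w
        rw [List.reverse_cons, List.append_assoc]
        exact eval_congr_append I _ (fun w => key hp w) w
      -- A gate outside the block is moved in front of the block if it commutes with everything
      -- collected there and after it; otherwise it stays behind the block.
      · split at h
        · rename_i p q hpq
          simp only [Option.bind_eq_some_iff, Option.map_eq_some_iff, Prod.mk.injEq] at hpq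
          obtain ⟨p, hp, q, hq, rfl, rfl⟩ := hpq
          rw [ih h, List.reverse_cons, List.append_assoc]
          refine eval_congr_append I _ (fun w => ?_) w
          have := eval_append_congr I (p.2.reverse ++ d) (eval_moveUp I hq w)
          simp only [List.cons_append, List.append_assoc, List.nil_append] at this ⊢
          rw [this]
          exact eval_congr_append I _ (fun w => key hp w) w
        · rw [ih h]
          simp

end Interchange

-- The braiding and its inverse, treated uniformly.

section Braid

variable {C : Type u} [Category.{v} C] [MonoidalCategory C] [BraidedCategory C]

lemma brd_naturality_left (s : Bool) {X Y : C} (f : X ⟶ Y) (Z : C) :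
    f ▷ Z ≫ brd s Y Z = brd s X Z ≫ Z ◁ f := by
  cases s
  · exact BraidedCategory.braiding_inv_naturality_left f Z
  · exact BraidedCategory.braiding_naturality_left f Z

lemma brd_naturality_right (s : Bool) (X : C) {Y Z : C} (f : Y ⟶ Z) :
    X ◁ f ≫ brd s X Z = brd s X Y ≫ f ▷ X := by
  cases s
  · exact BraidedCategory.braiding_inv_naturality_right X f
  · exact BraidedCategory.braiding_naturality_right X f

/-- The inverse braiding is again a braiding, with the two hexagons exchanged; hence one rule with a
sign covers over- and undercrossings. -/
lemma brd_tensor_left (s : Bool) (X Y Z : C) :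
    brd s (X ⊗ Y) Z = (α_ X Y Z).hom ≫ X ◁ brd s Y Z ≫ (α_ X Z Y).inv ≫ brd s X Z ▷ Y ≫
      (α_ Z X Y).hom := by
  cases s
  · exact BraidedCategory.braiding_tensor_right_inv Z X Y
  · exact BraidedCategory.braiding_tensor_left_hom X Y Z

lemma brd_tensor_right (s : Bool) (X Y Z : C) :
    brd s X (Y ⊗ Z) = (α_ X Y Z).inv ≫ brd s X Y ▷ Z ≫ (α_ Y X Z).hom ≫ Y ◁ brd s X Z ≫
      (α_ Y Z X).inv := by
  cases s
  · exact BraidedCategory.braiding_tensor_left_inv Y Z X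
  · exact BraidedCategory.braiding_tensor_right_hom X Y Z

lemma brd_unit_left (s : Bool) (X : C) : brd s (𝟙_ C) X = (λ_ X).hom ≫ (ρ_ X).inv := by
  cases s <;> simp [brd]

lemma brd_unit_right (s : Bool) (X : C) : brd s X (𝟙_ C) = (ρ_ X).hom ≫ (λ_ X).inv := by
  cases s <;> simp [brd]

lemma brd_cancel (s : Bool) (X Y : C) : brd s X Y ≫ brd (!s) Y X = 𝟙 _ := by
  cases s <;> simp [brd]

end Braid
end Diagram

end CrossProduct

namespace CrossProduct

namespace Diagram

-- Rewriting rules and the checker of derivations.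

section Checker

variable {K G : Type}

/-- A rewriting rule for diagrams with the given source. -/
structure Rule (K G : Type) where
  word : List K
  lhs : Diag K G
  rhs : Diag K G

/-- The strand `z` to the right of a shape crosses to its left. -/
def crossRight (s : Bool) (z : K) : Shape K → Diag K G
  | .nil => []
  | .one a => [(0, .braid s a z)]
  | .two a b => [(1, .braid s b z), (0, .braid s a z)]

/-- The strand `z` to the left of a shape crosses to its right. -/
def crossLeft (s : Bool) (z : K) : Shape K → Diag K G
  | .nil => []
  | .one a => [(0, .braid s z a)]
  | .two a b => [(0, .braid s z a), (1, .braid s z b)]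

/-- References to rewriting rules: members of a list of rules, naturality of the braiding in the
left or right argument, and cancellation of braidings. -/
inductive Ref (K : Type)
  | thm (j : ℕ)
  | natR (s : Bool) (z : K)
  | natL (s : Bool) (z : K)
  | cancel (s : Bool) (a b : K)

/-- Steps of a derivation: rewrite the gates with the given indices from left to right or from
right to left, or insert, after the gates with the given indices and to the right of `k` strands,
the right (left) hand side of a rule whose other side is empty. -/
inductive Step (K : Type)
  | rw (ref : Ref K) (is : List ℕ)
  | wr (ref : Ref K) (is : List ℕ)
  | ins (ref : Ref K) (is : List ℕ) (k : ℕ)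
  | sni (ref : Ref K) (is : List ℕ) (k : ℕ)

variable [Signature K G]

/-- Naturality of the braiding in its left argument. -/
def Rule.natR (s : Bool) (z : K) (g : Gate K G) : Rule K G :=
  ⟨g.dom.word [z], (0, g) :: crossRight s z g.cod, crossRight s z g.dom ++ [(1, g)]⟩

/-- Naturality of the braiding in its right argument. -/
def Rule.natL (s : Bool) (z : K) (g : Gate K G) : Rule K G :=
  ⟨z :: g.dom.word [], (1, g) :: crossLeft s z g.cod, crossLeft s z g.dom ++ [(0, g)]⟩

/-- A braiding followed by its inverse. -/
def Rule.cancel (s : Bool) (a b : K) : Rule K G :=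
  ⟨[a, b], [(0, .braid s a b), (0, .braid (!s) b a)], []⟩

/-- The rule that a reference refers to. -/
def Ref.rule (rules : List (Rule K G)) : Ref K → Option (ℕ × Gate K G) → Option (Rule K G)
  | thm j, _ => rules[j]?
  | natR s z, some l => some (.natR s z l.2)
  | natL s z, some l => some (.natL s z l.2)
  | natR _ _, none => none
  | natL _ _, none => none
  | cancel s a b, _ => some (.cancel s a b)

/-- The offset of the first gate of a diagram. -/
def firstOffset : Diag K G → ℕ
  | [] => 0
  | l :: _ => l.1

variable [DecidableEq K] [DecidableEq G]

/-- Replace the middle part `blk` of a diagram by the diagram `rhs` shifted by `k`. -/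
def replace (u word : List K) (lhs rhs pre blk post : Diag K G) (k : ℕ) : Option (Diag K G) :=
  (target pre u).bind fun w =>
    if blk = shift k lhs ∧ (w.take k).length = k ∧ word.isPrefixOf (w.drop k) = true then
      some (norm (pre ++ (shift k rhs ++ post)))
    else none

/-- Carry out a step of a derivation. -/
def Step.run (rules : List (Rule K G)) (u : List K) (d : Diag K G) :
    Step K → Option (Diag K G)
  | rw ref is =>
      (gather [] [] [] 0 is d).bind fun q => (ref.rule rules (norm q.2.1).head?).bind fun R =>
        replace u R.word (norm R.lhs) R.rhs q.1.reverse (norm q.2.1) q.2.2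
          (firstOffset (norm q.2.1) - firstOffset (norm R.lhs))
  | wr ref is =>
      (gather [] [] [] 0 is d).bind fun q =>
        (ref.rule rules (norm q.2.1).getLast?).bind fun R =>
          replace u R.word (norm R.rhs) R.lhs q.1.reverse (norm q.2.1) q.2.2
            (firstOffset (norm q.2.1) - firstOffset (norm R.rhs))
  | ins ref is k =>
      (gather [] [] [] 0 is d).bind fun q => (ref.rule rules none).bind fun R =>
        replace u R.word (norm R.lhs) R.rhs (q.1.reverse ++ q.2.1) [] q.2.2 k
  | sni ref is k =>
      (gather [] [] [] 0 is d).bind fun q => (ref.rule rules none).bind fun R =>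
        replace u R.word (norm R.rhs) R.lhs (q.1.reverse ++ q.2.1) [] q.2.2 k

/-- Carry out a derivation. -/
def runAll (rules : List (Rule K G)) (u : List K) : List (Step K) → Diag K G → Option (Diag K G)
  | [], d => some d
  | s :: l, d => (s.run rules u d).bind (runAll rules u l)

/-- Check that a derivation leads from the diagram `d` to the diagram `d'`. -/
def check (rules : List (Rule K G)) (u : List K) (l : List (Step K)) (d d' : Diag K G) : Bool :=
  decide (runAll rules u l (norm d) = some (norm d'))

end Checker

-- Soundness of the checker.

section Soundness

variable {K G : Type} [Signature K G] [DecidableEq K]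
variable {C : Type u} [Category.{v} C] [MonoidalCategory C] [BraidedCategory C]
variable (I : Interp K G C)

/-- Two diagrams with the given source are equal, whatever is to their right. -/
def DiagEq (u : List K) (d d' : Diag K G) : Prop := ∀ r, eval I d (u ++ r) = eval I d' (u ++ r)

/-- A rule holds in an interpretation. -/
def Rule.Holds (R : Rule K G) : Prop := DiagEq I R.word R.lhs R.rhs

variable {I}

/-- A rule is stated at the left end of a word with arbitrary strands `r` to its right. Whiskering
by `v` adds the strands to its left, so it applies at every position. -/
lemma DiagEq.shift {u : List K} {d d' : Diag K G} (h : DiagEq I u d d') (v r : List K) :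
    eval I (shift v.length d) (v ++ (u ++ r)) = eval I (shift v.length d') (v ++ (u ++ r)) := by
  induction v with
  | nil => simpa [shift_zero] using h r
  | cons a v ih =>
    have h1 := eval_shift_one I (Diagram.shift v.length d) a (v ++ (u ++ r))
    have h2 := eval_shift_one I (Diagram.shift v.length d') a (v ++ (u ++ r))
    rw [shift_shift] at h1 h2
    rw [List.length_cons, List.cons_append, h1, h2, ih]

variable (I)

lemma act_succ {k : ℕ} {g : Gate K G} {w : List K} {x : Arrow' I.obj w}
    (h : act I k g w = some x) (a : K) :
    act I (k + 1) g (a :: w) = some ⟨a :: x.1, I.obj a ◁ x.2⟩ := by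
  simp only [act, h, Option.map_some]

lemma eval_cons_some {l : ℕ × Gate K G} {d : Diag K G} {w : List K} {x : Arrow' I.obj w}
    {y : Arrow' I.obj x.1} (h : act I l.1 l.2 w = some x) (h' : eval I d x.1 = some y) :
    eval I (l :: d) w = some ⟨y.1, x.2 ≫ y.2⟩ := by
  rw [eval_cons, h, Option.bind_some, h', Option.map_some]

lemma eval_append_some {d d' : Diag K G} {w : List K} {x : Arrow' I.obj w}
    {y : Arrow' I.obj x.1} (h : eval I d w = some x) (h' : eval I d' x.1 = some y) :
    eval I (d ++ d') w = some ⟨y.1, x.2 ≫ y.2⟩ := by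
  rw [eval_append, h, Option.bind_some, h', Option.map_some]

lemma eval_singleton_some {l : ℕ × Gate K G} {w : List K} {x : Arrow' I.obj w}
    (h : act I l.1 l.2 w = some x) : eval I [l] w = some x := by
  rw [eval_singleton, h]

lemma exists_act_of_actWord {k : ℕ} {g : Gate K G} {u w : List K} (h : actWord k g u = some w)
    (r : List K) : ∃ f, act I k g (u ++ r) = some ⟨w ++ r, f⟩ := by
  induction k generalizing u w with
  | zero =>
    simp only [actWord, Option.map_eq_some_iff] at h
    obtain ⟨⟨v, rfl⟩, -, rfl⟩ := h
    have hw : ∀ s : Shape K, s.word v ++ r = s.word (v ++ r) := by intro s; cases s <;> rfl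
    rw [hw, hw]
    exact ⟨_, act_zero I g (v ++ r)⟩
  | succ k ih =>
    cases u with
    | nil => simp [actWord] at h
    | cons a u =>
      simp only [actWord, Option.map_eq_some_iff] at h
      obtain ⟨w, hw, rfl⟩ := h
      obtain ⟨f, hf⟩ := ih hw
      exact ⟨_, act_succ I hf a⟩

/-- `target` follows the words without building morphisms, so the checker can compute with it. Its
success guarantees that the evaluation is defined, with any further strands carried along on the
right. -/
lemma exists_eval_of_target {d : Diag K G} {u w : List K} (h : target d u = some w)
    (r : List K) : ∃ f, eval I d (u ++ r) = some ⟨w ++ r, f⟩ := by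
  induction d generalizing u with
  | nil => cases h; exact ⟨_, rfl⟩
  | cons l d ih =>
    simp only [target, Option.bind_eq_some_iff] at h
    obtain ⟨u', hu', h⟩ := h
    obtain ⟨f, hf⟩ := exists_act_of_actWord I hu' r
    obtain ⟨f', hf'⟩ := ih h
    exact ⟨f ≫ f', by rw [eval_cons, hf, Option.bind_some, hf']; rfl⟩

lemma act_braid (s : Bool) (a b : K) (w : List K) :
    act I 0 (.braid s a b) (a :: b :: w) =
      some ⟨b :: a :: w, (α_ (I.obj a) (I.obj b) (tens I.obj w)).inv ≫
        brd s (I.obj a) (I.obj b) ▷ tens I.obj w ≫ (α_ (I.obj b) (I.obj a) (tens I.obj w)).hom⟩ :=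
  act_zero I (.braid s a b) w

/-- The morphism of `crossRight`. -/
def crossRightHom (s : Bool) (z : K) (t : Shape K) (w : List K) :
    tens I.obj (t.word (z :: w)) ⟶ tens I.obj (z :: t.word w) :=
  (t.iso I.obj (z :: w)).inv ≫ (α_ (t.ob I.obj) (I.obj z) (tens I.obj w)).inv ≫
    brd s (t.ob I.obj) (I.obj z) ▷ tens I.obj w ≫
    (α_ (I.obj z) (t.ob I.obj) (tens I.obj w)).hom ≫ I.obj z ◁ (t.iso I.obj w).hom

/-- The morphism of `crossLeft`. -/
def crossLeftHom (s : Bool) (z : K) (t : Shape K) (w : List K) :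
    tens I.obj (z :: t.word w) ⟶ tens I.obj (t.word (z :: w)) :=
  I.obj z ◁ (t.iso I.obj w).inv ≫ (α_ (I.obj z) (t.ob I.obj) (tens I.obj w)).inv ≫
    brd s (I.obj z) (t.ob I.obj) ▷ tens I.obj w ≫
    (α_ (t.ob I.obj) (I.obj z) (tens I.obj w)).hom ≫ (t.iso I.obj (z :: w)).hom

/-- Crossing the strands of a shape one at a time is the braiding with their whole tensor product:
the unit coherence for no strand, a hexagon for two. -/
lemma eval_crossRight (s : Bool) (z : K) (t : Shape K) (w : List K) :
    eval I (crossRight s z t) (t.word (z :: w)) =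
      some ⟨z :: t.word w, crossRightHom I s z t w⟩ := by
  cases t with
  | nil =>
    have : crossRightHom I s z .nil w = 𝟙 (I.obj z ⊗ tens I.obj w) := by
      simp only [crossRightHom, Shape.iso, Shape.ob, brd_unit_left]
      show (λ_ (I.obj z ⊗ tens I.obj w)).inv ≫ _ = _
      monoidal
    rw [this]
    rfl
  | one a =>
    have : crossRightHom I s z (.one a) w =
        (α_ (I.obj a) (I.obj z) (tens I.obj w)).inv ≫
        brd s (I.obj a) (I.obj z) ▷ tens I.obj w ≫
        (α_ (I.obj z) (I.obj a) (tens I.obj w)).hom := by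
      simp only [crossRightHom, Shape.iso, Iso.refl_inv, Iso.refl_hom]
      refine (Category.id_comp _).trans ?_
      congr 2
      refine (congrArg _ (whiskerLeft_id _ _)).trans (Category.comp_id _)
    rw [this]
    exact (eval_singleton I _ _).trans (act_braid I s a z w)
  | two a b =>
    have : crossRightHom I s z (.two a b) w =
        (I.obj a ◁ ((α_ (I.obj b) (I.obj z) (tens I.obj w)).inv ≫
          brd s (I.obj b) (I.obj z) ▷ tens I.obj w ≫
          (α_ (I.obj z) (I.obj b) (tens I.obj w)).hom)) ≫
        (α_ (I.obj a) (I.obj z) (I.obj b ⊗ tens I.obj w)).inv ≫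
        brd s (I.obj a) (I.obj z) ▷ (I.obj b ⊗ tens I.obj w) ≫
        (α_ (I.obj z) (I.obj a) (I.obj b ⊗ tens I.obj w)).hom := by
      simp only [crossRightHom, Shape.iso, Shape.ob, brd_tensor_left]
      show (α_ (I.obj a) (I.obj b) (I.obj z ⊗ tens I.obj w)).inv ≫ _ = _
      monoidal
    rw [this]
    exact eval_cons_some I (x := ⟨a :: z :: b :: w, _⟩) (act_succ I (act_braid I s b z w) a)
      (eval_singleton_some I (l := (0, .braid s a z)) (act_braid I s a z (b :: w)))

lemma eval_crossLeft (s : Bool) (z : K) (t : Shape K) (w : List K) :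
    eval I (crossLeft s z t) (z :: t.word w) =
      some ⟨t.word (z :: w), crossLeftHom I s z t w⟩ := by
  cases t with
  | nil =>
    have : crossLeftHom I s z .nil w = 𝟙 (I.obj z ⊗ tens I.obj w) := by
      simp only [crossLeftHom, Shape.iso, Shape.ob, brd_unit_right]
      show _ ≫ _ ≫ _ ≫ _ ≫ (λ_ (I.obj z ⊗ tens I.obj w)).hom = _
      monoidal
    rw [this]
    rfl
  | one a =>
    have : crossLeftHom I s z (.one a) w =
        (α_ (I.obj z) (I.obj a) (tens I.obj w)).inv ≫
        brd s (I.obj z) (I.obj a) ▷ tens I.obj w ≫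
        (α_ (I.obj a) (I.obj z) (tens I.obj w)).hom := by
      simp only [crossLeftHom, Shape.iso, Iso.refl_inv, Iso.refl_hom]
      refine (congrArg (· ≫ _) (whiskerLeft_id _ _)).trans ((Category.id_comp _).trans ?_)
      congr 2
      exact Category.comp_id _
    rw [this]
    exact (eval_singleton I _ _).trans (act_braid I s z a w)
  | two a b =>
    have : crossLeftHom I s z (.two a b) w =
        ((α_ (I.obj z) (I.obj a) (I.obj b ⊗ tens I.obj w)).inv ≫
        brd s (I.obj z) (I.obj a) ▷ (I.obj b ⊗ tens I.obj w) ≫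
        (α_ (I.obj a) (I.obj z) (I.obj b ⊗ tens I.obj w)).hom) ≫
        (I.obj a ◁ ((α_ (I.obj z) (I.obj b) (tens I.obj w)).inv ≫
          brd s (I.obj z) (I.obj b) ▷ tens I.obj w ≫
          (α_ (I.obj b) (I.obj z) (tens I.obj w)).hom)) := by
      simp only [crossLeftHom, Shape.iso, Shape.ob, brd_tensor_right]
      show _ ≫ _ ≫ _ ≫ _ ≫ (α_ (I.obj a) (I.obj b) (I.obj z ⊗ tens I.obj w)).hom = _
      monoidal
    rw [this]
    exact eval_cons_some I (x := ⟨a :: z :: b :: w, _⟩) (act_braid I s z a (b :: w))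
      (eval_singleton_some I (l := (1, .braid s z b)) (act_succ I (act_braid I s z b w) a))

/-- The isomorphisms `i`, `j` stand for the rebracketings `Shape.iso`. Keeping them arbitrary gives
naturality of the braiding for all shapes of source and target at once, which is what `natR_holds`
needs. -/
lemma brd_conj_naturality_left (s : Bool) {P Q Z R PR QR PZR QZR : C} (f : P ⟶ Q)
    (i : P ⊗ R ≅ PR) (i' : Q ⊗ R ≅ QR) (j : P ⊗ Z ⊗ R ≅ PZR) (j' : Q ⊗ Z ⊗ R ≅ QZR) :
    (j.inv ≫ f ▷ (Z ⊗ R) ≫ j'.hom) ≫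
      (j'.inv ≫ (α_ Q Z R).inv ≫ brd s Q Z ▷ R ≫ (α_ Z Q R).hom ≫ Z ◁ i'.hom) =
    (j.inv ≫ (α_ P Z R).inv ≫ brd s P Z ▷ R ≫ (α_ Z P R).hom ≫ Z ◁ i.hom) ≫
      Z ◁ (i.inv ≫ f ▷ R ≫ i'.hom) := by
  have h := congrArg (· ▷ R) (brd_naturality_left s f Z)
  simp only [comp_whiskerRight] at h
  simp only [Category.assoc, Iso.hom_inv_id_assoc, MonoidalCategory.whiskerLeft_comp,
    whiskerLeft_hom_inv_assoc, whiskerRight_tensor]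
  rw [reassoc_of% h]
  simp

lemma brd_conj_naturality_right (s : Bool) {P Q Z R PR QR PZR QZR : C} (f : P ⟶ Q)
    (i : P ⊗ R ≅ PR) (i' : Q ⊗ R ≅ QR) (j : P ⊗ Z ⊗ R ≅ PZR) (j' : Q ⊗ Z ⊗ R ≅ QZR) :
    Z ◁ (i.inv ≫ f ▷ R ≫ i'.hom) ≫
      (Z ◁ i'.inv ≫ (α_ Z Q R).inv ≫ brd s Z Q ▷ R ≫ (α_ Q Z R).hom ≫ j'.hom) =
    (Z ◁ i.inv ≫ (α_ Z P R).inv ≫ brd s Z P ▷ R ≫ (α_ P Z R).hom ≫ j.hom) ≫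
      (j.inv ≫ f ▷ (Z ⊗ R) ≫ j'.hom) := by
  have h := congrArg (· ▷ R) (brd_naturality_right s Z f)
  simp only [comp_whiskerRight] at h
  simp only [Category.assoc, Iso.hom_inv_id_assoc, MonoidalCategory.whiskerLeft_comp,
    whiskerLeft_hom_inv_assoc, whiskerRight_tensor]
  have h' : Z ◁ f ▷ R ≫ (α_ Z Q R).inv = (α_ Z P R).inv ≫ (Z ◁ f) ▷ R := by simp
  rw [reassoc_of% h', reassoc_of% h]

lemma natR_holds (s : Bool) (z : K) (g : Gate K G) : (Rule.natR s z g).Holds I := by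
  intro r
  have hw : ∀ t : Shape K, t.word [z] ++ r = t.word (z :: r) := by intro t; cases t <;> rfl
  have h1 := eval_cons_some I (l := (0, g)) (act_zero I g (z :: r))
    (eval_crossRight I s z g.cod r)
  have h2 := eval_append_some I (eval_crossRight I s z g.dom r)
    (eval_singleton_some I (l := (1, g)) (act_succ I (act_zero I g r) z))
  have : front I.obj (I.gate g) (z :: r) ≫ crossRightHom I s z g.cod r =
      crossRightHom I s z g.dom r ≫ I.obj z ◁ front I.obj (I.gate g) r :=
    brd_conj_naturality_left s (I.gate g) (g.dom.iso I.obj r) (g.cod.iso I.obj r)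
    (g.dom.iso I.obj (z :: r)) (g.cod.iso I.obj (z :: r))
  have h3 := congrArg (fun f => some (⟨_, f⟩ : Arrow' I.obj (g.dom.word (z :: r)))) this
  show eval I (_ :: _) (g.dom.word [z] ++ r) = eval I (_ ++ _) (g.dom.word [z] ++ r)
  rw [hw]
  exact (h1.trans h3).trans h2.symm

lemma natL_holds (s : Bool) (z : K) (g : Gate K G) : (Rule.natL s z g).Holds I := by
  intro r
  have hw : ∀ t : Shape K, z :: t.word [] ++ r = z :: t.word r := by intro t; cases t <;> rfl
  have h1 := eval_cons_some I (l := (1, g)) (act_succ I (act_zero I g r) z)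
    (eval_crossLeft I s z g.cod r)
  have h2 := eval_append_some I (eval_crossLeft I s z g.dom r)
    (eval_singleton_some I (l := (0, g)) (act_zero I g (z :: r)))
  have : I.obj z ◁ front I.obj (I.gate g) r ≫ crossLeftHom I s z g.cod r =
      crossLeftHom I s z g.dom r ≫ front I.obj (I.gate g) (z :: r) :=
    brd_conj_naturality_right s (I.gate g) (g.dom.iso I.obj r) (g.cod.iso I.obj r)
    (g.dom.iso I.obj (z :: r)) (g.cod.iso I.obj (z :: r))
  have h3 := congrArg (fun f => some (⟨_, f⟩ : Arrow' I.obj (z :: g.dom.word r))) this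
  show eval I (_ :: _) (z :: g.dom.word [] ++ r) = eval I (_ ++ _) (z :: g.dom.word [] ++ r)
  rw [hw]
  exact (h1.trans h3).trans h2.symm

lemma cancel_holds (s : Bool) (a b : K) : (Rule.cancel s a b : Rule K G).Holds I := by
  intro r
  simp only [Rule.cancel, List.cons_append, List.nil_append, eval_cons, act_braid, eval,
    Option.bind_some, Option.map_some, Category.comp_id]
  have : ((α_ (I.obj a) (I.obj b) (tens I.obj r)).inv ≫
        brd s (I.obj a) (I.obj b) ▷ tens I.obj r ≫ (α_ (I.obj b) (I.obj a) (tens I.obj r)).hom) ≫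
      ((α_ (I.obj b) (I.obj a) (tens I.obj r)).inv ≫
        brd (!s) (I.obj b) (I.obj a) ▷ tens I.obj r ≫
          (α_ (I.obj a) (I.obj b) (tens I.obj r)).hom) = 𝟙 _ := by
    simp only [Category.assoc, Iso.hom_inv_id_assoc]
    rw [← comp_whiskerRight_assoc, brd_cancel]
    simp
  exact congrArg (fun f => some (⟨_, f⟩ : Arrow' I.obj (a :: b :: r))) this

/-- All rules of a list hold. -/
def AllHold (rules : List (Rule K G)) : Prop := ∀ R ∈ rules, R.Holds I

variable {I}

lemma AllHold.nil : AllHold I [] := by simp [AllHold]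

lemma AllHold.cons {R : Rule K G} {rules : List (Rule K G)} (h : R.Holds I)
    (h' : AllHold I rules) : AllHold I (R :: rules) := by
  simpa [AllHold] using ⟨h, h'⟩

lemma AllHold.append {rules rules' : List (Rule K G)} (h : AllHold I rules)
    (h' : AllHold I rules') : AllHold I (rules ++ rules') := by
  intro R hR
  rcases List.mem_append.1 hR with hR | hR
  exacts [h R hR, h' R hR]

lemma AllHold.concat {R : Rule K G} {rules : List (Rule K G)} (h : AllHold I rules)
    (h' : R.Holds I) : AllHold I (rules ++ [R]) :=
  h.append (.cons h' .nil)

lemma Ref.rule_holds {rules : List (Rule K G)} (h : AllHold I rules) {ref : Ref K}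
    {o : Option (ℕ × Gate K G)} {R : Rule K G} (hR : ref.rule rules o = some R) : R.Holds I := by
  cases ref with
  | thm j => exact h R (List.mem_of_getElem? hR)
  | natR s z =>
    cases o with
    | none => simp [Ref.rule] at hR
    | some l => cases hR; exact natR_holds I s z l.2
  | natL s z =>
    cases o with
    | none => simp [Ref.rule] at hR
    | some l => cases hR; exact natL_holds I s z l.2
  | cancel s a b => cases hR; exact cancel_holds I s a b

variable [DecidableEq G]

/-- The guard in `replace` says that after `pre` the word is the first `k` strands, then the source
of the rule, then some rest. The rule, shifted by `k`, can therefore be applied to the middle block.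
-/
lemma replace_sound {u word : List K} {lhs rhs pre blk post d : Diag K G} {k : ℕ}
    (h : DiagEq I word lhs rhs) (hd : replace u word lhs rhs pre blk post k = some d) :
    DiagEq I u (pre ++ (blk ++ post)) d := by
  intro r
  simp only [replace, Option.bind_eq_some_iff] at hd
  obtain ⟨w, hw, hd⟩ := hd
  split_ifs at hd with hc
  cases hd
  obtain ⟨rfl, hk, hp⟩ := hc
  obtain ⟨t, ht⟩ := List.isPrefixOf_iff_prefix.1 hp
  obtain ⟨f, hf⟩ := exists_eval_of_target I hw r
  rw [eval_norm, eval_append, eval_append I pre, hf, Option.bind_some, Option.bind_some]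
  have key : eval I (shift k lhs ++ post) (w ++ r) = eval I (shift k rhs ++ post) (w ++ r) := by
    apply eval_append_congr
    have := h.shift (w.take k) (t ++ r)
    rwa [hk, ← List.append_assoc word, ht, ← List.append_assoc, List.take_append_drop] at this
  simp only [key]

lemma Step.run_sound {rules : List (Rule K G)} (h : AllHold I rules) {u : List K}
    {d d' : Diag K G} {s : Step K} (hs : s.run rules u d = some d') : DiagEq I u d d' := by
  intro r
  cases s with
  | rw ref is =>
    simp only [Step.run, Option.bind_eq_some_iff] at hs
    obtain ⟨q, hq, R, hR, hs⟩ := hs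
    have h1 := eval_gather I hq (u ++ r)
    simp only [List.reverse_nil, List.nil_append] at h1
    -- The block and the side of the rule that it must match are compared in normal form, so the
    -- rule is first transferred to the normal form of that side.
    have h2 : DiagEq I R.word (norm R.lhs) R.rhs := fun r => by
      rw [eval_norm]; exact Ref.rule_holds h hR r
    rw [← h1, ← replace_sound h2 hs r]
    refine eval_congr_append I _ (fun w => ?_) _
    exact (eval_append_congr I _ (eval_norm I _ w)).symm
  | wr ref is =>
    simp only [Step.run, Option.bind_eq_some_iff] at hs
    obtain ⟨q, hq, R, hR, hs⟩ := hs
    have h1 := eval_gather I hq (u ++ r)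
    simp only [List.reverse_nil, List.nil_append] at h1
    have h2 : DiagEq I R.word (norm R.rhs) R.lhs := fun r => by
      rw [eval_norm]; exact (Ref.rule_holds h hR r).symm
    rw [← h1, ← replace_sound h2 hs r]
    refine eval_congr_append I _ (fun w => ?_) _
    exact (eval_append_congr I _ (eval_norm I _ w)).symm
  | ins ref is k =>
    simp only [Step.run, Option.bind_eq_some_iff] at hs
    obtain ⟨q, hq, R, hR, hs⟩ := hs
    have h1 := eval_gather I hq (u ++ r)
    simp only [List.reverse_nil, List.nil_append] at h1
    have h2 : DiagEq I R.word (norm R.lhs) R.rhs := fun r => by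
      rw [eval_norm]; exact Ref.rule_holds h hR r
    rw [← h1, ← replace_sound h2 hs r, List.nil_append, List.append_assoc]
  | sni ref is k =>
    simp only [Step.run, Option.bind_eq_some_iff] at hs
    obtain ⟨q, hq, R, hR, hs⟩ := hs
    have h1 := eval_gather I hq (u ++ r)
    simp only [List.reverse_nil, List.nil_append] at h1
    have h2 : DiagEq I R.word (norm R.rhs) R.lhs := fun r => by
      rw [eval_norm]; exact (Ref.rule_holds h hR r).symm
    rw [← h1, ← replace_sound h2 hs r, List.nil_append, List.append_assoc]

lemma runAll_sound {rules : List (Rule K G)} (h : AllHold I rules) {u : List K}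
    {l : List (Step K)} {d d' : Diag K G} (hs : runAll rules u l d = some d') :
    DiagEq I u d d' := by
  induction l generalizing d with
  | nil => cases hs; exact fun _ => rfl
  | cons s l ih =>
    simp only [runAll, Option.bind_eq_some_iff] at hs
    obtain ⟨e, he, hs⟩ := hs
    exact fun r => (Step.run_sound h he r).trans (ih hs r)

/-- A successful check proves an equality of diagrams. -/
theorem diagEq_of_check {rules : List (Rule K G)} (h : AllHold I rules) {u : List K}
    {d d' : Diag K G} (l : List (Step K)) (hc : check rules u l d d' = true) :
    DiagEq I u d d' := by
  intro r
  have := runAll_sound h (of_decide_eq_true hc) r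
  rwa [eval_norm, eval_norm] at this

/-- The derivations of a list of lemmas, each of which may use the preceding ones, are correct. -/
def checkAll (rules : List (Rule K G)) : List (Rule K G × List (Step K)) → Bool
  | [] => true
  | L :: Ls => check rules L.1.word L.2 L.1.lhs L.1.rhs && checkAll (rules ++ [L.1]) Ls

/-- Lemmas with correct derivations hold. -/
theorem AllHold.extend {rules : List (Rule K G)} (h : AllHold I rules)
    (Ls : List (Rule K G × List (Step K))) (hc : checkAll rules Ls = true) :
    AllHold I (rules ++ Ls.map Prod.fst) := by
  induction Ls generalizing rules with
  | nil => simpa using h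
  | cons L Ls ih =>
    simp only [checkAll, Bool.and_eq_true] at hc
    simpa using ih (h.concat (diagEq_of_check h L.2 hc.1)) hc.2

end Soundness

end Diagram

end CrossProduct

-- Drawing morphisms: from categorical expressions to diagrams.

namespace CrossProduct

namespace Diagram

/-- Numbers of strands, as formal sums. -/
inductive Width
  | zero
  | one
  | add (m n : Width)

/-- The number of strands. -/
def Width.toNat : Width → ℕ
  | zero => 0
  | one => 1
  | add m n => m.toNat + n.toNat

section Representation

variable {K G : Type} [Signature K G] [DecidableEq K]
variable {C : Type u} [Category.{v} C] [MonoidalCategory C] [BraidedCategory C]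
variable (I : Interp K G C)

/-- A presentation of an object as a tensor product of `n` strands. -/
class Flat (X : C) (n : outParam Width) where
  app : List K → List K
  iso : ∀ r, X ⊗ tens I.obj r ≅ tens I.obj (app r)
  whisk : ∀ (d : Diag K G) (r), eval I (shift n.toNat d) (app r) =
    (eval I d r).map fun x => ⟨app x.1, (iso r).inv ≫ X ◁ x.2 ≫ (iso x.1).hom⟩

/-- A single strand. -/
@[reducible] def Flat.obj (a : K) : Flat I (I.obj a) .one where
  app w := a :: w
  iso _ := Iso.refl _
  whisk d r := by
    refine (eval_shift_one I d a r).trans ?_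
    congr 1
    funext x
    exact congrArg (Sigma.mk _) ((Category.id_comp _).trans (Category.comp_id _)).symm

instance Flat.unit : Flat I (𝟙_ C) .zero where
  app w := w
  iso _ := λ_ _
  whisk d r := by
    rw [Width.toNat, shift_zero]
    cases eval I d r with
    | none => rfl
    | some x => simp

instance Flat.tensor (X Y : C) {m n : Width} [FX : Flat I X m] [FY : Flat I Y n] :
    Flat I (X ⊗ Y) (.add n m) where
  app w := FX.app (FY.app w)
  iso r := α_ _ _ _ ≪≫ whiskerLeftIso X (FY.iso r) ≪≫ FX.iso (FY.app r)
  whisk d r := by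
    rw [Width.toNat, ← shift_shift, FX.whisk, FY.whisk, Option.map_map]
    congr 1
    funext x
    simp

/-- A morphism between flat objects, on words. -/
def flat {X Y : C} {m n : Width} [FX : Flat I X m] [FY : Flat I Y n] (f : X ⟶ Y) (r : List K) :
    tens I.obj (FX.app r) ⟶ tens I.obj (FY.app r) :=
  (FX.iso r).inv ≫ f ▷ tens I.obj r ≫ (FY.iso r).hom

/-- The empty word is interpreted as the unit object, and whiskering with the unit object is
faithful. -/
lemma flat_injective {X Y : C} {m n : Width} [FX : Flat I X m] [FY : Flat I Y n] {f g : X ⟶ Y}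
    (h : flat I f [] = flat I g []) : f = g := by
  rw [flat, flat, Iso.cancel_iso_inv_left, Iso.cancel_iso_hom_right] at h
  exact (MonoidalCategory.whiskerRight_iff f g).1 h

/-- The diagram `d` represents the morphism `f`. -/
class Drawn {X Y : C} {m n : Width} [FX : Flat I X m] [FY : Flat I Y n] (f : X ⟶ Y)
    (d : outParam (Diag K G)) : Prop where
  eval_eq : ∀ r, eval I d (FX.app r) = some ⟨FY.app r, flat I f r⟩

variable {I}

/-- Morphisms that are represented by equal diagrams are equal. -/
theorem eq_of_diagEq {X Y : C} {m n : Width} [FX : Flat I X m] [FY : Flat I Y n] {f g : X ⟶ Y}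
    {d d' : Diag K G} [hf : Drawn I f d] [hg : Drawn I g d'] (u : List K)
    (h : DiagEq I u d d') (hu : u = FX.app []) : f = g := by
  have := h []
  rw [List.append_nil, hu, hf.eval_eq, hg.eval_eq] at this
  simp only [Option.some.injEq, Sigma.mk.injEq, heq_eq_eq, true_and] at this
  exact flat_injective I this

/-- A successful check proves an equality of morphisms. -/
theorem AllHold.eq_of_check [DecidableEq G] {rules : List (Rule K G)} (L : AllHold I rules)
    {X Y : C} {m n : Width} [FX : Flat I X m] [FY : Flat I Y n] {f g : X ⟶ Y} {d d' : Diag K G}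
    [hf : Drawn I f d] [hg : Drawn I g d'] (u : List K) (l : List (Step K))
    (hc : check rules u l d d' = true := by decide +kernel) (hu : u = FX.app [] := by rfl) :
    f = g :=
  eq_of_diagEq u (diagEq_of_check L l hc) hu

/-- An equality of morphisms gives rise to a rule. -/
theorem AllHold.cons_of_eq {X Y : C} {m n : Width} [FX : Flat I X m] [FY : Flat I Y n]
    {f g : X ⟶ Y} {d d' e e' : Diag K G} [hf : Drawn I f d] [hg : Drawn I g d'] {u : List K}
    {rules : List (Rule K G)} (h : f = g) (h' : AllHold I rules)
    (hu : ∀ r, u ++ r = FX.app r := by exact fun _ => rfl)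
    (hd : norm d = norm e := by decide +kernel) (hd' : norm d' = norm e' := by decide +kernel) :
    AllHold I (⟨u, e, e'⟩ :: rules) :=
  .cons (fun r => by
    rw [← eval_norm I e, ← eval_norm I e', ← hd, ← hd', eval_norm, eval_norm, hu, hf.eval_eq,
      hg.eval_eq, h]) h'

lemma Drawn.of_eq {X Y : C} {m n : Width} [Flat I X m] [Flat I Y n] {f g : X ⟶ Y}
    {d : Diag K G} (hf : Drawn I f d) (h : f = g) : Drawn I g d := h ▸ hf

instance Drawn.id (X : C) {n : Width} [FX : Flat I X n] : Drawn I (𝟙 X) [] where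
  eval_eq r := by simp [eval, flat]

instance Drawn.comp {X Y Z : C} {l m n : Width} [FX : Flat I X l] [FY : Flat I Y m]
    [FZ : Flat I Z n] (f : X ⟶ Y) (g : Y ⟶ Z) {d d' : Diag K G} [hf : Drawn I f d] [hg : Drawn I g d'] :
    Drawn I (f ≫ g) (d ++ d') where
  eval_eq r := by
    rw [eval_append, hf.eval_eq, Option.bind_some, hg.eval_eq, Option.map_some]
    simp [flat]

instance Drawn.whiskerRight {X Y : C} {m n l : Width} [FX : Flat I X m] [FY : Flat I Y n]
    (f : X ⟶ Y) (Z : C) [FZ : Flat I Z l] {d : Diag K G} [hf : Drawn I f d] :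
    Drawn I (f ▷ Z) d where
  eval_eq r := by
    refine (hf.eval_eq (FZ.app r)).trans ?_
    -- Strands added on the right do not change a diagram, since evaluation already allows any word
    -- `r` there. What remains is that the two bracketings agree.
    have h : (FX.iso (FZ.app r)).inv ≫ f ▷ tens I.obj (FZ.app r) ≫ (FY.iso (FZ.app r)).hom =
        (α_ X Z (tens I.obj r) ≪≫ whiskerLeftIso X (FZ.iso r) ≪≫ FX.iso (FZ.app r)).inv ≫
          (f ▷ Z) ▷ tens I.obj r ≫
          (α_ Y Z (tens I.obj r) ≪≫ whiskerLeftIso Y (FZ.iso r) ≪≫ FY.iso (FZ.app r)).hom := by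
      have h' : (α_ X Z (tens I.obj r)).inv ≫ f ▷ Z ▷ tens I.obj r ≫
          (α_ Y Z (tens I.obj r)).hom = f ▷ (Z ⊗ tens I.obj r) := by simp
      simp only [Iso.trans_inv, Iso.trans_hom, whiskerLeftIso_inv, whiskerLeftIso_hom,
        Category.assoc, reassoc_of% h']
      rw [whisker_exchange_assoc]
      simp
    exact congrArg (fun f => some (⟨_, f⟩ : Arrow' I.obj (FX.app (FZ.app r)))) h

instance Drawn.whiskerLeft {X Y : C} {m n l : Width} [FX : Flat I X m] [FY : Flat I Y n]
    (Z : C) [FZ : Flat I Z l] (f : X ⟶ Y) {d : Diag K G} [hf : Drawn I f d] :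
    Drawn I (Z ◁ f) (shift l.toNat d) where
  eval_eq r := by
    refine (FZ.whisk d (FX.app r)).trans ?_
    rw [hf.eval_eq]
    have h : (FZ.iso (FX.app r)).inv ≫
          Z ◁ ((FX.iso r).inv ≫ f ▷ tens I.obj r ≫ (FY.iso r).hom) ≫ (FZ.iso (FY.app r)).hom =
        (α_ Z X (tens I.obj r) ≪≫ whiskerLeftIso Z (FX.iso r) ≪≫ FZ.iso (FX.app r)).inv ≫
          (Z ◁ f) ▷ tens I.obj r ≫
          (α_ Z Y (tens I.obj r) ≪≫ whiskerLeftIso Z (FY.iso r) ≪≫ FZ.iso (FY.app r)).hom := by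
      simp
    exact congrArg (fun f => some (⟨_, f⟩ : Arrow' I.obj (FZ.app (FX.app r)))) h

instance Drawn.tensorHom {X Y X' Y' : C} {m n m' n' : Width} [FX : Flat I X m] [FY : Flat I Y n]
    [FX' : Flat I X' m'] [FY' : Flat I Y' n'] (f : X ⟶ Y) (g : X' ⟶ Y') {d d' : Diag K G}
    [hf : Drawn I f d] [hg : Drawn I g d'] : Drawn I (f ⊗ₘ g) (d ++ shift n.toNat d') :=
  (inferInstance : Drawn I (f ▷ X' ≫ Y ◁ g) (d ++ shift n.toNat d')).of_eq (tensorHom_def f g).symm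

/-- A morphism that is invisible in diagrams. -/
lemma Drawn.of_flat_hom {X Y : C} {m n : Width} [FX : Flat I X m] [FY : Flat I Y n] {f : X ⟶ Y}
    (h : ∀ r, (⟨FX.app r, 𝟙 _⟩ : Arrow' I.obj (FX.app r)) = ⟨FY.app r, flat I f r⟩) :
    Drawn I f [] where
  eval_eq r := congrArg some (h r)

instance Drawn.leftUnitor_hom (X : C) {n : Width} [FX : Flat I X n] : Drawn I (λ_ X).hom [] :=
  .of_flat_hom fun r => by
    have h : 𝟙 (tens I.obj (FX.app r)) =
        (α_ (𝟙_ C) X (tens I.obj r) ≪≫ whiskerLeftIso (𝟙_ C) (FX.iso r) ≪≫ λ_ _).inv ≫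
          (λ_ X).hom ▷ tens I.obj r ≫ (FX.iso r).hom := by
      simp
    exact congrArg (Sigma.mk (FX.app r)) h

instance Drawn.leftUnitor_inv (X : C) {n : Width} [FX : Flat I X n] : Drawn I (λ_ X).inv [] :=
  .of_flat_hom fun r => by
    have h : 𝟙 (tens I.obj (FX.app r)) =
        (FX.iso r).inv ≫ (λ_ X).inv ▷ tens I.obj r ≫
          (α_ (𝟙_ C) X (tens I.obj r) ≪≫ whiskerLeftIso (𝟙_ C) (FX.iso r) ≪≫ λ_ _).hom := by
      simp
    exact congrArg (Sigma.mk (FX.app r)) h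

instance Drawn.rightUnitor_hom (X : C) {n : Width} [FX : Flat I X n] : Drawn I (ρ_ X).hom [] :=
  .of_flat_hom fun r => by
    have h : 𝟙 (tens I.obj (FX.app r)) =
        (α_ X (𝟙_ C) (tens I.obj r) ≪≫ whiskerLeftIso X (λ_ _) ≪≫ FX.iso r).inv ≫
          (ρ_ X).hom ▷ tens I.obj r ≫ (FX.iso r).hom := by
      simp
    exact congrArg (Sigma.mk (FX.app r)) h

instance Drawn.rightUnitor_inv (X : C) {n : Width} [FX : Flat I X n] : Drawn I (ρ_ X).inv [] :=
  .of_flat_hom fun r => by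
    have h : 𝟙 (tens I.obj (FX.app r)) =
        (FX.iso r).inv ≫ (ρ_ X).inv ▷ tens I.obj r ≫
          (α_ X (𝟙_ C) (tens I.obj r) ≪≫ whiskerLeftIso X (λ_ _) ≪≫ FX.iso r).hom := by
      simp
    exact congrArg (Sigma.mk (FX.app r)) h

instance Drawn.associator_hom (X Y Z : C) {l m n : Width} [FX : Flat I X l] [FY : Flat I Y m]
    [FZ : Flat I Z n] : Drawn I (α_ X Y Z).hom [] :=
  .of_flat_hom fun r => by
    have h : 𝟙 (tens I.obj (FX.app (FY.app (FZ.app r)))) =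
        (α_ (X ⊗ Y) Z (tens I.obj r) ≪≫ whiskerLeftIso (X ⊗ Y) (FZ.iso r) ≪≫
          (α_ X Y _ ≪≫ whiskerLeftIso X (FY.iso (FZ.app r)) ≪≫ FX.iso _)).inv ≫
          (α_ X Y Z).hom ▷ tens I.obj r ≫
        (α_ X (Y ⊗ Z) (tens I.obj r) ≪≫ whiskerLeftIso X
          (α_ Y Z _ ≪≫ whiskerLeftIso Y (FZ.iso r) ≪≫ FY.iso _) ≪≫ FX.iso _).hom := by
      simp
    exact congrArg (Sigma.mk (FX.app (FY.app (FZ.app r)))) h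

instance Drawn.associator_inv (X Y Z : C) {l m n : Width} [FX : Flat I X l] [FY : Flat I Y m]
    [FZ : Flat I Z n] : Drawn I (α_ X Y Z).inv [] :=
  .of_flat_hom fun r => by
    have h : 𝟙 (tens I.obj (FX.app (FY.app (FZ.app r)))) =
        (α_ X (Y ⊗ Z) (tens I.obj r) ≪≫ whiskerLeftIso X
          (α_ Y Z _ ≪≫ whiskerLeftIso Y (FZ.iso r) ≪≫ FY.iso _) ≪≫ FX.iso _).inv ≫
          (α_ X Y Z).inv ▷ tens I.obj r ≫
        (α_ (X ⊗ Y) Z (tens I.obj r) ≪≫ whiskerLeftIso (X ⊗ Y) (FZ.iso r) ≪≫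
          (α_ X Y _ ≪≫ whiskerLeftIso X (FY.iso (FZ.app r)) ≪≫ FX.iso _)).hom := by
      simp
    exact congrArg (Sigma.mk (FX.app (FY.app (FZ.app r)))) h

/-- The coherence isomorphisms of `⊗≫` are invisible in diagrams. -/
class CohDrawn {X Y : C} {m n : Width} [FX : Flat I X m] [FY : Flat I Y n]
    (c : MonoidalCoherence X Y) : Prop where
  drawn : Drawn I c.iso.hom []

section

variable {l m n k : Width} (X Y Z W : C) [Flat I X l] [Flat I Y m] [Flat I Z n] [Flat I W k]

instance CohDrawn.refl : CohDrawn (I := I) (.refl X) :=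
  ⟨inferInstanceAs (Drawn I (𝟙 X) [])⟩

instance CohDrawn.whiskerLeft {c : MonoidalCoherence Y Z} [h : CohDrawn (I := I) c] :
    CohDrawn (I := I) (.whiskerLeft X Y Z) :=
  have := h.drawn
  ⟨inferInstanceAs (Drawn I (X ◁ c.iso.hom) (shift l.toNat []))⟩

instance CohDrawn.whiskerRight {c : MonoidalCoherence X Y} [h : CohDrawn (I := I) c] :
    CohDrawn (I := I) (.whiskerRight X Y Z) :=
  have := h.drawn
  ⟨inferInstanceAs (Drawn I (c.iso.hom ▷ Z) [])⟩

instance CohDrawn.tensor_right {c : MonoidalCoherence (𝟙_ C) Y} [h : CohDrawn (I := I) c] :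
    CohDrawn (I := I) (.tensor_right X Y) :=
  have := h.drawn
  ⟨inferInstanceAs (Drawn I ((ρ_ X).inv ≫ X ◁ c.iso.hom) ([] ++ shift l.toNat []))⟩

instance CohDrawn.tensor_right' {c : MonoidalCoherence Y (𝟙_ C)} [h : CohDrawn (I := I) c] :
    CohDrawn (I := I) (.tensor_right' X Y) :=
  have := h.drawn
  ⟨inferInstanceAs (Drawn I (X ◁ c.iso.hom ≫ (ρ_ X).hom) (shift l.toNat [] ++ []))⟩

instance CohDrawn.left {c : MonoidalCoherence X Y} [h : CohDrawn (I := I) c] :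
    CohDrawn (I := I) (.left X Y) :=
  have := h.drawn
  ⟨inferInstanceAs (Drawn I ((λ_ X).hom ≫ c.iso.hom) ([] ++ []))⟩

instance CohDrawn.left' {c : MonoidalCoherence X Y} [h : CohDrawn (I := I) c] :
    CohDrawn (I := I) (.left' X Y) :=
  have := h.drawn
  ⟨inferInstanceAs (Drawn I (c.iso.hom ≫ (λ_ Y).inv) ([] ++ []))⟩

instance CohDrawn.right {c : MonoidalCoherence X Y} [h : CohDrawn (I := I) c] :
    CohDrawn (I := I) (.right X Y) :=
  have := h.drawn
  ⟨inferInstanceAs (Drawn I ((ρ_ X).hom ≫ c.iso.hom) ([] ++ []))⟩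

instance CohDrawn.right' {c : MonoidalCoherence X Y} [h : CohDrawn (I := I) c] :
    CohDrawn (I := I) (.right' X Y) :=
  have := h.drawn
  ⟨inferInstanceAs (Drawn I (c.iso.hom ≫ (ρ_ Y).inv) ([] ++ []))⟩

instance CohDrawn.assoc {c : MonoidalCoherence (X ⊗ (Y ⊗ Z)) W} [h : CohDrawn (I := I) c] :
    CohDrawn (I := I) (.assoc X Y Z W) :=
  have := h.drawn
  ⟨inferInstanceAs (Drawn I ((α_ X Y Z).hom ≫ c.iso.hom) ([] ++ []))⟩

instance CohDrawn.assoc' {c : MonoidalCoherence W (X ⊗ (Y ⊗ Z))} [h : CohDrawn (I := I) c] :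
    CohDrawn (I := I) (.assoc' W X Y Z) :=
  have := h.drawn
  ⟨inferInstanceAs (Drawn I (c.iso.hom ≫ (α_ X Y Z).inv) ([] ++ []))⟩

variable {X Y Z W}

instance Drawn.monoidalComp {c : MonoidalCoherence Y Z} [h : CohDrawn (I := I) c] (f : X ⟶ Y)
    (g : Z ⟶ W) {d d' : Diag K G} [Drawn I f d] [Drawn I g d'] : Drawn I (f ⊗≫ g) (d ++ d') :=
  have := h.drawn
  inferInstanceAs (Drawn I (f ≫ c.iso.hom ≫ g) (d ++ ([] ++ d')))

end

section

variable {X Y : C} {m n : Width} [FX : Flat I X m] [FY : Flat I Y n]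

/-- A gate is drawn as a gate. -/
lemma Drawn.of_gate (g : Gate K G) (f : X ⟶ Y)
    (h : ∀ r, (⟨g.dom.word r, g.cod.word r, front I.obj (I.gate g) r⟩ : Σ w, Arrow' I.obj w) =
      ⟨FX.app r, FY.app r, flat I f r⟩) : Drawn I f [(0, g)] where
  eval_eq r := by
    have key : ∀ q q' : (Σ w : List K, Arrow' I.obj w), q = q' →
        eval I [(0, g)] q.1 = some q.2 →
        eval I [(0, g)] q'.1 = some q'.2 := by
      rintro q _ rfl
      exact fun h => h
    exact key _ _ (h r) (eval_singleton_some I (l := ((0, g) : ℕ × Gate K G)) (act_zero I g r))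

end

variable (I)

/-- The hypothesis collects source, target and morphism in one dependent triple. For a concrete
interpretation it holds by `rfl`, and no transport along equalities of shapes is needed. The same
device serves the other arities. -/
lemma drawn_two_one (g : Gate K G) (a b c : K) (f : I.obj a ⊗ I.obj b ⟶ I.obj c)
    (h : (⟨g.dom, g.cod, I.gate g⟩ : Σ s t : Shape K, (s.ob I.obj ⟶ t.ob I.obj)) =
      ⟨.two a b, .one c, f⟩) :
    let := Flat.obj I a; let := Flat.obj I b; let := Flat.obj I c
    Drawn I f [(0, g)] := by
  let := Flat.obj I a; let := Flat.obj I b; let := Flat.obj I c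
  refine Drawn.of_gate g f fun r => ?_
  have h' : (α_ (I.obj a) (I.obj b) (tens I.obj r)).inv ≫ f ▷ tens I.obj r ≫ 𝟙 _ =
      (α_ (I.obj a) (I.obj b) (tens I.obj r) ≪≫ whiskerLeftIso _ (Iso.refl _) ≪≫
        Iso.refl _).inv ≫ f ▷ tens I.obj r ≫ (Iso.refl _).hom := by simp
  refine (congrArg (fun q : Σ s t : Shape K, (s.ob I.obj ⟶ t.ob I.obj) =>
    (⟨q.1.word r, q.2.1.word r, front I.obj q.2.2 r⟩ : Σ w, Arrow' I.obj w)) h).trans ?_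
  exact congrArg (fun k => (⟨a :: b :: r, c :: r, k⟩ : Σ w, Arrow' I.obj w)) h'

lemma drawn_one_two (g : Gate K G) (a b c : K) (f : I.obj c ⟶ I.obj a ⊗ I.obj b)
    (h : (⟨g.dom, g.cod, I.gate g⟩ : Σ s t : Shape K, (s.ob I.obj ⟶ t.ob I.obj)) =
      ⟨.one c, .two a b, f⟩) :
    let := Flat.obj I a; let := Flat.obj I b; let := Flat.obj I c
    Drawn I f [(0, g)] := by
  let := Flat.obj I a; let := Flat.obj I b; let := Flat.obj I c
  refine Drawn.of_gate g f fun r => ?_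
  have h' : 𝟙 _ ≫ f ▷ tens I.obj r ≫ (α_ (I.obj a) (I.obj b) (tens I.obj r)).hom =
      (Iso.refl _).inv ≫ f ▷ tens I.obj r ≫ (α_ (I.obj a) (I.obj b) (tens I.obj r) ≪≫
        whiskerLeftIso _ (Iso.refl _) ≪≫ Iso.refl _).hom := by simp
  refine (congrArg (fun q : Σ s t : Shape K, (s.ob I.obj ⟶ t.ob I.obj) =>
    (⟨q.1.word r, q.2.1.word r, front I.obj q.2.2 r⟩ : Σ w, Arrow' I.obj w)) h).trans ?_
  exact congrArg (fun k => (⟨c :: r, a :: b :: r, k⟩ : Σ w, Arrow' I.obj w)) h'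

lemma drawn_two_two (g : Gate K G) (a b c d : K) (f : I.obj a ⊗ I.obj b ⟶ I.obj c ⊗ I.obj d)
    (h : (⟨g.dom, g.cod, I.gate g⟩ : Σ s t : Shape K, (s.ob I.obj ⟶ t.ob I.obj)) =
      ⟨.two a b, .two c d, f⟩) :
    let := Flat.obj I a; let := Flat.obj I b; let := Flat.obj I c; let := Flat.obj I d
    Drawn I f [(0, g)] := by
  let := Flat.obj I a; let := Flat.obj I b; let := Flat.obj I c; let := Flat.obj I d
  refine Drawn.of_gate g f fun r => ?_
  have h' : (α_ (I.obj a) (I.obj b) (tens I.obj r)).inv ≫ f ▷ tens I.obj r ≫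
      (α_ (I.obj c) (I.obj d) (tens I.obj r)).hom =
      (α_ (I.obj a) (I.obj b) (tens I.obj r) ≪≫ whiskerLeftIso _ (Iso.refl _) ≪≫
        Iso.refl _).inv ≫ f ▷ tens I.obj r ≫ (α_ (I.obj c) (I.obj d) (tens I.obj r) ≪≫
        whiskerLeftIso _ (Iso.refl _) ≪≫ Iso.refl _).hom := by simp
  refine (congrArg (fun q : Σ s t : Shape K, (s.ob I.obj ⟶ t.ob I.obj) =>
    (⟨q.1.word r, q.2.1.word r, front I.obj q.2.2 r⟩ : Σ w, Arrow' I.obj w)) h).trans ?_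
  exact congrArg (fun k => (⟨a :: b :: r, c :: d :: r, k⟩ : Σ w, Arrow' I.obj w)) h'

lemma drawn_one_one (g : Gate K G) (a c : K) (f : I.obj a ⟶ I.obj c)
    (h : (⟨g.dom, g.cod, I.gate g⟩ : Σ s t : Shape K, (s.ob I.obj ⟶ t.ob I.obj)) =
      ⟨.one a, .one c, f⟩) :
    let := Flat.obj I a; let := Flat.obj I c
    Drawn I f [(0, g)] := by
  let := Flat.obj I a; let := Flat.obj I c
  refine Drawn.of_gate g f fun r => ?_
  refine (congrArg (fun q : Σ s t : Shape K, (s.ob I.obj ⟶ t.ob I.obj) =>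
    (⟨q.1.word r, q.2.1.word r, front I.obj q.2.2 r⟩ : Σ w, Arrow' I.obj w)) h).trans ?_
  rfl

lemma drawn_zero_one (g : Gate K G) (c : K) (f : 𝟙_ C ⟶ I.obj c)
    (h : (⟨g.dom, g.cod, I.gate g⟩ : Σ s t : Shape K, (s.ob I.obj ⟶ t.ob I.obj)) =
      ⟨.nil, .one c, f⟩) :
    let := Flat.obj I c
    Drawn I f [(0, g)] := by
  let := Flat.obj I c
  refine Drawn.of_gate g f fun r => ?_
  refine (congrArg (fun q : Σ s t : Shape K, (s.ob I.obj ⟶ t.ob I.obj) =>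
    (⟨q.1.word r, q.2.1.word r, front I.obj q.2.2 r⟩ : Σ w, Arrow' I.obj w)) h).trans ?_
  rfl

lemma drawn_one_zero (g : Gate K G) (a : K) (f : I.obj a ⟶ 𝟙_ C)
    (h : (⟨g.dom, g.cod, I.gate g⟩ : Σ s t : Shape K, (s.ob I.obj ⟶ t.ob I.obj)) =
      ⟨.one a, .nil, f⟩) :
    let := Flat.obj I a
    Drawn I f [(0, g)] := by
  let := Flat.obj I a
  refine Drawn.of_gate g f fun r => ?_
  refine (congrArg (fun q : Σ s t : Shape K, (s.ob I.obj ⟶ t.ob I.obj) =>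
    (⟨q.1.word r, q.2.1.word r, front I.obj q.2.2 r⟩ : Σ w, Arrow' I.obj w)) h).trans ?_
  rfl

lemma drawn_braiding (a b : K) :
    let := Flat.obj I a; let := Flat.obj I b
    Drawn I (β_ (I.obj a) (I.obj b)).hom [(0, .braid true a b)] :=
  drawn_two_two I (.braid true a b) a b b a _ rfl

end Representation

end Diagram

end CrossProduct

-- The signature of a bialgebra with injections and projections.

namespace CrossProduct

open Diagram

/-- The objects `B`, `B₁` and `B₂`. -/
inductive Strand
  | b
  | x
  | y
  deriving DecidableEq

namespace Splitting

/-- The structure morphisms of `B`, the injections and the projections. -/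
inductive Box
  | mul
  | one
  | comul
  | counit
  | inj₁
  | proj₁
  | inj₂
  | proj₂
  deriving DecidableEq

instance : Signature Strand Box where
  dom
    | .mul => .two .b .b
    | .one => .nil
    | .comul => .one .b
    | .counit => .one .b
    | .inj₁ => .one .x
    | .proj₁ => .one .b
    | .inj₂ => .one .y
    | .proj₂ => .one .b
  cod
    | .mul => .one .b
    | .one => .one .b
    | .comul => .two .b .b
    | .counit => .nil
    | .inj₁ => .one .b
    | .proj₁ => .one .x
    | .inj₂ => .one .b
    | .proj₂ => .one .y

section

open scoped MonObj ComonObj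

variable {C : Type u} [Category.{v} C] [MonoidalCategory C] [BraidedCategory C]
variable (B : C) [BimonObj B] {B₁ B₂ : C} (i₁ : B₁ ⟶ B) (p₁ : B ⟶ B₁) (i₂ : B₂ ⟶ B) (p₂ : B ⟶ B₂)

/-- The interpretation of the boxes. -/
def interp : Interp Strand Box C where
  obj
    | .b => B
    | .x => B₁
    | .y => B₂
  box
    | .mul => μ[B]
    | .one => η[B]
    | .comul => Δ[B]
    | .counit => ε[B]
    | .inj₁ => i₁
    | .proj₁ => p₁
    | .inj₂ => i₂
    | .proj₂ => p₂

instance flat_b : Flat (interp B i₁ p₁ i₂ p₂) B .one := Flat.obj (interp B i₁ p₁ i₂ p₂) .b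
instance flat_x : Flat (interp B i₁ p₁ i₂ p₂) B₁ .one := Flat.obj (interp B i₁ p₁ i₂ p₂) .x
instance flat_y : Flat (interp B i₁ p₁ i₂ p₂) B₂ .one := Flat.obj (interp B i₁ p₁ i₂ p₂) .y

instance drawn_mul : Drawn (interp B i₁ p₁ i₂ p₂) μ[B] [(0, .box .mul)] :=
  drawn_two_one (interp B i₁ p₁ i₂ p₂) (.box .mul) .b .b .b _ rfl

instance drawn_one : Drawn (interp B i₁ p₁ i₂ p₂) η[B] [(0, .box .one)] :=
  drawn_zero_one (interp B i₁ p₁ i₂ p₂) (.box .one) .b _ rfl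

instance drawn_comul : Drawn (interp B i₁ p₁ i₂ p₂) Δ[B] [(0, .box .comul)] :=
  drawn_one_two (interp B i₁ p₁ i₂ p₂) (.box .comul) .b .b .b _ rfl

instance drawn_counit : Drawn (interp B i₁ p₁ i₂ p₂) ε[B] [(0, .box .counit)] :=
  drawn_one_zero (interp B i₁ p₁ i₂ p₂) (.box .counit) .b _ rfl

instance drawn_inj₁ : Drawn (interp B i₁ p₁ i₂ p₂) i₁ [(0, .box .inj₁)] :=
  drawn_one_one (interp B i₁ p₁ i₂ p₂) (.box .inj₁) .x .b _ rfl

instance drawn_inj₂ : Drawn (interp B i₁ p₁ i₂ p₂) i₂ [(0, .box .inj₂)] :=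
  drawn_one_one (interp B i₁ p₁ i₂ p₂) (.box .inj₂) .y .b _ rfl

instance drawn_proj₁ : Drawn (interp B i₁ p₁ i₂ p₂) p₁ [(0, .box .proj₁)] :=
  drawn_one_one (interp B i₁ p₁ i₂ p₂) (.box .proj₁) .b .x _ rfl

instance drawn_proj₂ : Drawn (interp B i₁ p₁ i₂ p₂) p₂ [(0, .box .proj₂)] :=
  drawn_one_one (interp B i₁ p₁ i₂ p₂) (.box .proj₂) .b .y _ rfl

instance braid_bb : Drawn (interp B i₁ p₁ i₂ p₂) (β_ B B).hom [(0, .braid true .b .b)] :=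
  drawn_braiding (interp B i₁ p₁ i₂ p₂) .b .b

instance braid_xx : Drawn (interp B i₁ p₁ i₂ p₂) (β_ B₁ B₁).hom [(0, .braid true .x .x)] :=
  drawn_braiding (interp B i₁ p₁ i₂ p₂) .x .x

instance braid_xy : Drawn (interp B i₁ p₁ i₂ p₂) (β_ B₁ B₂).hom [(0, .braid true .x .y)] :=
  drawn_braiding (interp B i₁ p₁ i₂ p₂) .x .y

instance braid_yx : Drawn (interp B i₁ p₁ i₂ p₂) (β_ B₂ B₁).hom [(0, .braid true .y .x)] :=
  drawn_braiding (interp B i₁ p₁ i₂ p₂) .y .x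

instance braid_yy : Drawn (interp B i₁ p₁ i₂ p₂) (β_ B₂ B₂).hom [(0, .braid true .y .y)] :=
  drawn_braiding (interp B i₁ p₁ i₂ p₂) .y .y

end

/-- A box or a braiding together with the number of strands to its left. -/
abbrev Layer := ℕ × Gate Strand Box

def mul (k : ℕ) : Layer := (k, .box .mul)
def one (k : ℕ) : Layer := (k, .box .one)
def comul (k : ℕ) : Layer := (k, .box .comul)
def counit (k : ℕ) : Layer := (k, .box .counit)
def inj₁ (k : ℕ) : Layer := (k, .box .inj₁)
def proj₁ (k : ℕ) : Layer := (k, .box .proj₁)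
def inj₂ (k : ℕ) : Layer := (k, .box .inj₂)
def proj₂ (k : ℕ) : Layer := (k, .box .proj₂)
def braid (s t : Strand) (k : ℕ) : Layer := (k, .braid true s t)

namespace Law

/-! Names of the rewriting rules that are listed below. -/

def assoc : Ref Strand := .thm 0
def unit_left : Ref Strand := .thm 1
def unit_right : Ref Strand := .thm 2
def coassoc : Ref Strand := .thm 3
def counit_left : Ref Strand := .thm 4
def counit_right : Ref Strand := .thm 5
def bialgebra : Ref Strand := .thm 6
def one_comul : Ref Strand := .thm 7
def mul_counit : Ref Strand := .thm 8
def one_counit : Ref Strand := .thm 9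
def inj₁_proj₁ : Ref Strand := .thm 10
def inj₂_proj₂ : Ref Strand := .thm 11
def split : Ref Strand := .thm 12
def unsplit : Ref Strand := .thm 13
def inj₁_mul : Ref Strand := .thm 14
def one_idem₁ : Ref Strand := .thm 15
def comul_proj₂ : Ref Strand := .thm 16
def idem₂_counit : Ref Strand := .thm 17
def one_idem₂ : Ref Strand := .thm 18
def idem₁_counit : Ref Strand := .thm 19
def inj₁_comul_proj : Ref Strand := .thm 20
def inj_mul_proj₂ : Ref Strand := .thm 21
def inj₂_comul_proj : Ref Strand := .thm 22
def inj_mul_proj₁ : Ref Strand := .thm 23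
def inj₁_proj₂ : Ref Strand := .thm 24
def inj₂_proj₁ : Ref Strand := .thm 25
def inj₁_mul_proj₂ : Ref Strand := .thm 26
def inj₁_comul_proj₂ : Ref Strand := .thm 27
def idem₂_mul_proj₂ : Ref Strand := .thm 28
def inj₁_comul_idem₁ : Ref Strand := .thm 29
def inj₁_mul_idem₁ : Ref Strand := .thm 30
def inj₂_comul_idem₂ : Ref Strand := .thm 31
def one_braid_mul : Ref Strand := .thm 32
def comul_braid_counit : Ref Strand := .thm 33
def split_mul : Ref Strand := .thm 34
def split_comul : Ref Strand := .thm 35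
def split_comul_left : Ref Strand := .thm 36
def split_mul_right : Ref Strand := .thm 37
def split_idem₂ : Ref Strand := .thm 38
def split_idem₁ : Ref Strand := .thm 39
def split_braid_mul : Ref Strand := .thm 40
def split_comul_braid_mul : Ref Strand := .thm 41
def idem₂_braid_mul : Ref Strand := .thm 42
def rel_a : Ref Strand := .thm 43
def rel_a' : Ref Strand := .thm 44
def rel_b : Ref Strand := .thm 45
def rel_b' : Ref Strand := .thm 46
def rel_c : Ref Strand := .thm 47
def rel_c' : Ref Strand := .thm 48
def rel_d : Ref Strand := .thm 49
def rel_d' : Ref Strand := .thm 50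
def res_a : Ref Strand := .thm 51
def res_a' : Ref Strand := .thm 52
def res_c : Ref Strand := .thm 53
def res_c' : Ref Strand := .thm 54
def res_b : Ref Strand := .thm 55
def res_b' : Ref Strand := .thm 56
def phi21_reduced : Ref Strand := .thm 57
def phi12_reduced : Ref Strand := .thm 58
def coact_idem₂ : Ref Strand := .thm 59
def act_idem₁ : Ref Strand := .thm 60
def phi21 : Ref Strand := .thm 61
def phi12 : Ref Strand := .thm 62
def sigmaHat : Ref Strand := .thm 63
def rhoHat : Ref Strand := .thm 64
def inj₁_mul_idem₁_comul : Ref Strand := .thm 65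
def idem₂_comul_proj₂ : Ref Strand := .thm 66

end Law

-- Rewriting laws of a split bialgebra and of the strong projection relations.

open Law

/-- The laws of a bialgebra with a pair of injections and projections. -/
def basicRules : List (Rule Strand Box) :=
  [ ⟨[.b, .b, .b], [mul 0, mul 0], [mul 1, mul 0]⟩,
    ⟨[.b], [one 0, mul 0], []⟩,
    ⟨[.b], [one 1, mul 0], []⟩,
    ⟨[.b], [comul 0, comul 0], [comul 0, comul 1]⟩,
    ⟨[.b], [comul 0, counit 0], []⟩,
    ⟨[.b], [comul 0, counit 1], []⟩,
    ⟨[.b, .b], [mul 0, comul 0], [comul 0, comul 2, braid .b .b 1, mul 0, mul 1]⟩,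
    ⟨[], [one 0, comul 0], [one 0, one 1]⟩,
    ⟨[.b, .b], [mul 0, counit 0], [counit 0, counit 0]⟩,
    ⟨[], [one 0, counit 0], []⟩,
    ⟨[.x], [inj₁ 0, proj₁ 0], []⟩,
    ⟨[.y], [inj₂ 0, proj₂ 0], []⟩,
    ⟨[.b], [comul 0, proj₁ 0, proj₂ 1, inj₁ 0, inj₂ 1, mul 0], []⟩,
    ⟨[.x, .y], [inj₁ 0, inj₂ 1, mul 0, comul 0, proj₁ 0, proj₂ 1], []⟩,
    ⟨[.x, .x], [inj₁ 0, inj₁ 1, mul 0, proj₁ 0, inj₁ 0], [inj₁ 0, inj₁ 1, mul 0]⟩,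
    ⟨[], [one 0, proj₁ 0, inj₁ 0], [one 0]⟩,
    ⟨[.b], [proj₂ 0, inj₂ 0, comul 0, proj₂ 0, proj₂ 1], [comul 0, proj₂ 0, proj₂ 1]⟩,
    ⟨[.b], [proj₂ 0, inj₂ 0, counit 0], [counit 0]⟩ ]

/-- Consequences of `basicRules`. -/
def basicLemmas : List (Rule Strand Box × List (Step Strand)) :=
  -- Since Π₁η = η, one has Π₂η = m(Π₁ ⊗ Π₂)(η ⊗ η) = m(Π₁ ⊗ Π₂)Δη = η. The next law is dual.
  [ (⟨[], [one 0, proj₂ 0, inj₂ 0], [one 0]⟩,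
      [.sni unit_left [0, 1, 2] 0, .wr one_idem₁ [0], .wr one_comul [0, 3],
      .rw split [1, 2, 3, 4, 5, 6]]),
    (⟨[.b], [proj₁ 0, inj₁ 0, counit 0], [counit 0]⟩,
      [.sni counit_right [] 0, .wr idem₂_counit [4], .wr mul_counit [3, 6],
      .rw split [0, 1, 2, 3, 4, 5]]),
    -- An element of B₁ is its product with Π₂η, so (p₁ ⊗ p₂)Δ sends it to itself tensored with p₂η.
    -- The next three laws are the dual and the versions for B₂.
    (⟨[.x], [inj₁ 0, comul 0, proj₁ 0, proj₂ 1], [one 1, proj₂ 1]⟩,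
      [.sni unit_right [0] 0, .wr one_idem₂ [1], .rw unsplit [0, 3, 4, 5, 6, 7]]),
    (⟨[.x, .y], [inj₁ 0, inj₂ 1, mul 0, proj₂ 0], [inj₁ 0, counit 0]⟩,
      [.sni counit_left [0, 1, 2] 0, .wr idem₁_counit [4], .rw unsplit [0, 1, 2, 3, 4, 7]]),
    (⟨[.y], [inj₂ 0, comul 0, proj₁ 0, proj₂ 1], [one 0, proj₁ 0]⟩,
      [.sni unit_left [0] 0, .wr one_idem₁ [0], .rw unsplit [2, 3, 4, 5, 6, 7]]),
    (⟨[.x, .y], [inj₁ 0, inj₂ 1, mul 0, proj₁ 0], [inj₂ 1, counit 1]⟩,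
      [.sni counit_right [0, 1, 2] 0, .wr idem₂_counit [5], .rw unsplit [0, 1, 2, 3, 4, 5]]),
    -- The two factors meet only in the unit: p₂i₁ and p₁i₂ factor through ε and η.
    (⟨[.x], [inj₁ 0, proj₂ 0], [inj₁ 0, counit 0, one 0, proj₂ 0]⟩,
      [.sni counit_left [0] 0, .wr idem₁_counit [2], .rw inj₁_comul_proj [0, 1, 2, 5],
      .wr idem₁_counit [1], .rw idem₁_counit [3, 4, 5]]),
    (⟨[.y], [inj₂ 0, proj₁ 0], [inj₂ 0, counit 0, one 0, proj₁ 0]⟩,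
      [.sni counit_right [0] 0, .wr idem₂_counit [3], .rw inj₂_comul_proj [0, 1, 2, 3]]),
    -- p₂ is invariant under left multiplication by B₁: split the right factor as Π₁·Π₂, multiply
    -- inside B₁, and apply p₂m(i₁ ⊗ i₂) = ε ⊗ id. The next law is the dual coinvariance of B₁.
    (⟨[.x, .b], [inj₁ 0, mul 0, proj₂ 0], [inj₁ 0, proj₂ 1, counit 0]⟩,
      [.sni split [] 1, .wr assoc [6, 7], .wr inj₁_mul [0, 3, 4], .rw inj_mul_proj₂ [6, 8, 9, 10],
      .rw inj₁_mul [0, 3, 4, 5, 6], .rw mul_counit [4, 5], .rw idem₁_counit [3, 4, 5],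
      .rw counit_left [2, 3]]),
    (⟨[.x], [inj₁ 0, comul 0, proj₂ 1], [one 1, inj₁ 0, proj₂ 1]⟩,
      [.sni split [0, 1] 0, .rw coassoc [1, 2], .wr comul_proj₂ [4, 5, 8],
      .rw inj₁_comul_proj [0, 1, 2, 4], .rw comul_proj₂ [2, 3, 4, 5, 8], .rw one_comul [1, 2],
      .rw one_idem₂ [1, 2, 3], .rw unit_right [1, 2]]),
    -- Under p₂ the left factor of a product matters only through Π₂: splitting it as Π₁·Π₂, the
    -- invariance above discards the part in B₁. Dually, the right leg of Δi₁ lies in B₁.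
    (⟨[.b, .b], [proj₂ 0, inj₂ 0, mul 0, proj₂ 0], [mul 0, proj₂ 0]⟩,
      [.sni counit_left [] 0, .wr idem₁_counit [1], .wr inj₁_mul_proj₂ [2, 3, 7], .wr assoc [5, 6],
      .rw split [0, 1, 2, 3, 4, 5]]),
    (⟨[.x], [inj₁ 0, comul 0, proj₁ 1, inj₁ 1], [inj₁ 0, comul 0]⟩,
      [.sni unit_right [0, 1, 2, 3] 1, .wr one_idem₂ [4], .wr inj₁_comul_proj₂ [0, 4, 5],
      .rw coassoc [1, 2], .rw split [2, 3, 4, 5, 6, 7]]),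
    -- Under p₁, a right factor multiplied from the left by B₁ matters only through Π₁. Dually, for
    -- an element of B₂ the left leg of Δ may be projected to B₂ once p₂ is applied to the right
    -- leg.
    (⟨[.x, .b], [inj₁ 0, mul 0, proj₁ 0], [inj₁ 0, proj₁ 1, inj₁ 1, mul 0, proj₁ 0]⟩,
      [.sni split [] 1, .wr assoc [6, 7], .wr inj₁_mul [0, 3, 4], .rw inj_mul_proj₁ [6, 8, 9, 10],
      .rw idem₂_counit [6, 7, 8], .rw counit_right [1, 6]]),
    (⟨[.y], [inj₂ 0, comul 0, proj₂ 1], [inj₂ 0, comul 0, proj₂ 0, inj₂ 0, proj₂ 1]⟩,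
      [.sni split [0, 1] 0, .rw coassoc [1, 2], .wr comul_proj₂ [4, 5, 8],
      .rw inj₂_comul_proj [0, 1, 2, 4], .rw one_idem₁ [0, 1, 2], .rw unit_left [0, 5]]),
    (⟨[.b, .b], [one 0, braid .b .b 0, mul 1], []⟩,
      [.rw (.natR true .b) [0, 1], .rw unit_left [0, 1]]),
    (⟨[.b, .b], [comul 0, braid .b .b 1, counit 2], []⟩,
      [.wr (.natR true .b) [1, 2], .rw counit_right [0, 1]]),
    -- The following laws combine id = m(Π₁ ⊗ Π₂)Δ with a neighbouring product, coproduct or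
    -- braiding, so that a splitting can be introduced or removed there in one step.
    (⟨[.b, .b], [comul 0, proj₁ 0, proj₂ 1, inj₁ 0, inj₂ 1, mul 1, mul 0], [mul 0]⟩,
      [.wr assoc [5, 6], .rw split [0, 1, 2, 3, 4, 5]]),
    (⟨[.b], [comul 0, comul 0, proj₁ 1, proj₂ 2, inj₁ 1, inj₂ 2, mul 1], [comul 0]⟩,
      [.rw coassoc [0, 1], .rw split [1, 2, 3, 4, 5, 6]]),
    (⟨[.b], [comul 0, comul 1, proj₁ 0, proj₂ 1, inj₁ 0, inj₂ 1, mul 0], [comul 0]⟩,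
      [.wr coassoc [0, 3], .rw split [1, 2, 3, 4, 5, 6]]),
    (⟨[.b, .b], [comul 1, proj₁ 1, proj₂ 2, inj₁ 1, inj₂ 2, mul 0, mul 0], [mul 0]⟩,
      [.rw assoc [3, 6], .rw split [0, 1, 2, 3, 4, 5]]),
    (⟨[.b],
       [comul 0, proj₁ 0, inj₁ 0, proj₂ 1, inj₂ 1, comul 1, mul 0, proj₂ 1],
       [comul 0, proj₂ 1]⟩,
      [.rw inj₂_comul_idem₂ [4, 5, 7], .rw comul_proj₂ [3, 4, 5, 6, 9],
      .rw split_comul_left [0, 1, 2, 3, 4, 5, 6]]),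
    (⟨[.x, .b],
       [inj₁ 0, comul 1, mul 0, proj₁ 0, inj₁ 0, proj₂ 1, inj₂ 1, mul 0],
       [inj₁ 0, mul 0]⟩,
      [.rw inj₁_mul_idem₁ [0, 2, 3], .rw inj₁_mul [0, 3, 4, 5, 6],
      .rw split_mul_right [1, 2, 3, 4, 5, 6, 7]]),
    (⟨[.b, .b, .b],
       [comul 2, proj₁ 2, inj₁ 2, proj₂ 3, inj₂ 3, braid .b .b 1, mul 0, braid .b .b 1, mul 0],
       [braid .b .b 1, mul 0]⟩,
      [.rw assoc [4, 8], .wr (.natL true .b) [3, 6, 7], .rw split [0, 1, 2, 3, 4, 5]]),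
    (⟨[.b, .b, .b],
       [comul 2, comul 3, proj₁ 2, inj₁ 2, proj₂ 3, inj₂ 3, braid .b .b 1, mul 0, braid .b .b 1,
       mul 0],
       [comul 2, braid .b .b 1, mul 0]⟩,
      [.wr coassoc [0, 5], .rw split_braid_mul [1, 2, 3, 4, 5, 6, 7, 8, 9]]),
    (⟨[.b, .b, .b],
       [proj₂ 0, inj₂ 0, braid .b .b 0, mul 1, proj₂ 1],
       [braid .b .b 0, mul 1, proj₂ 1]⟩,
      [.rw (.natR true .b) [1, 2], .rw (.natR true .b) [0, 1], .rw idem₂_mul_proj₂ [1, 2, 3, 4]]) ]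

/-- The strong projection relations. -/
def strongRules : List (Rule Strand Box) :=
  [ ⟨[.b, .b],
      [proj₁ 0, inj₁ 0, proj₁ 1, inj₁ 1, comul 0, braid .b .b 1, mul 0, proj₂ 0, inj₂ 0],
      [proj₁ 0, inj₁ 0, comul 0, proj₂ 0, inj₂ 0, counit 2]⟩,
    ⟨[.b, .b],
      [proj₁ 1, inj₁ 1, comul 1, braid .b .b 0, mul 1, proj₂ 0, inj₂ 0, proj₂ 1, inj₂ 1],
      [one 0, proj₁ 2, inj₁ 2, mul 1, proj₂ 1, inj₂ 1]⟩,
    ⟨[.b, .b],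
      [proj₁ 0, inj₁ 0, proj₂ 1, inj₂ 1, comul 0, proj₂ 0, inj₂ 0, braid .b .b 1, comul 0,
      proj₂ 0, inj₂ 0, braid .b .b 1, mul 0, proj₁ 0, inj₁ 0, proj₁ 1, inj₁ 1],
      [one 0, one 1, proj₁ 2, inj₁ 2, counit 3]⟩,
    ⟨[.b, .b, .b],
      [proj₂ 1, inj₂ 1, proj₂ 2, inj₂ 2, comul 2, braid .b .b 1, proj₁ 3, inj₁ 3, mul 2,
      braid .b .b 0, proj₁ 2, inj₁ 2, mul 1, proj₁ 0, inj₁ 0, proj₂ 1, inj₂ 1],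
      [one 0, proj₂ 1, inj₂ 1, counit 2, counit 2]⟩,
    ⟨[.b, .b],
      [proj₁ 1, inj₁ 1, comul 1, proj₂ 0, inj₂ 0, proj₂ 1, inj₂ 1, mul 0, proj₁ 0, inj₁ 0],
      [counit 0, proj₁ 0, inj₁ 0, one 0]⟩,
    ⟨[.b, .b],
      [proj₂ 1, inj₂ 1, comul 1, proj₁ 1, inj₁ 1, proj₁ 2, inj₁ 2, mul 0, proj₂ 0, inj₂ 0],
      [counit 1, proj₂ 0, inj₂ 0, one 1]⟩,
    ⟨[.b, .b, .b],
      [proj₁ 1, inj₁ 1, proj₂ 2, inj₂ 2, comul 2, proj₁ 2, inj₁ 2, comul 2, braid .b .b 1,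
      braid .b .b 0, comul 2, proj₂ 2, inj₂ 2, braid .b .b 3, mul 2, proj₁ 2, inj₁ 2, mul 1,
      proj₁ 0, inj₁ 0, proj₂ 1, inj₂ 1, proj₁ 3, inj₁ 3],
      [proj₂ 2, inj₂ 2, comul 2, proj₁ 2, inj₁ 2, braid .b .b 1, comul 1, braid .b .b 0, proj₁ 0,
      inj₁ 0, mul 1, proj₂ 1, inj₂ 1, proj₁ 2, inj₁ 2, proj₁ 3, inj₁ 3]⟩,
    ⟨[.b, .b, .b, .b],
      [proj₂ 0, inj₂ 0, proj₁ 2, inj₁ 2, proj₂ 3, inj₂ 3, comul 2, proj₂ 2, inj₂ 2, comul 2,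
      braid .b .b 1, proj₁ 3, inj₁ 3, mul 2, braid .b .b 3, braid .b .b 2, mul 1, proj₂ 1, inj₂ 1,
      mul 0, proj₁ 0, inj₁ 0, proj₂ 1, inj₂ 1],
      [proj₂ 0, inj₂ 0, proj₂ 1, inj₂ 1, proj₁ 2, inj₁ 2, comul 2, proj₂ 4, inj₂ 4, braid .b .b 3,
      mul 2, braid .b .b 1, proj₂ 1, inj₂ 1, mul 0, proj₁ 0, inj₁ 0]⟩ ]

/-- Consequences of the strong projection relations. -/
def strongLemmas : List (Rule Strand Box × List (Step Strand)) :=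
  -- Relations 1 and 3, freed from their outer projections: p_j i_j = id lets the inputs be taken in
  -- B_j and the outputs be left unprojected or in B_j.
  [ (⟨[.x, .x],
       [inj₁ 0, inj₁ 1, comul 0, braid .b .b 1, mul 0, proj₂ 0],
       [inj₁ 0, inj₁ 1, comul 0, counit 2, proj₂ 0]⟩,
      [.sni inj₁_proj₁ [] 0, .sni inj₁_proj₁ [] 1,
      .sni inj₂_proj₂ [0, 1, 2, 3, 4, 5, 6, 7, 8, 9] 0, .rw rel_a [1, 2, 3, 5, 6, 7, 8, 9, 10],
      .rw inj₂_proj₂ [5, 6], .rw inj₁_proj₁ [0, 1]]),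
    (⟨[.b, .x],
       [inj₁ 1, comul 1, braid .b .b 0, mul 1, proj₂ 0, proj₂ 1],
       [inj₁ 1, one 0, mul 1, proj₂ 0, proj₂ 1]⟩,
      [.sni inj₂_proj₂ [0, 1, 2, 3, 4, 5] 1, .sni inj₂_proj₂ [0, 1, 2, 3] 0, .sni inj₁_proj₁ [] 1,
      .rw rel_a' [1, 2, 3, 4, 5, 6, 8, 9, 10], .rw inj₁_proj₁ [2, 3], .rw inj₂_proj₂ [5, 6]]),
    (⟨[.y, .x],
       [inj₂ 0, inj₁ 1, comul 1, proj₂ 1, inj₂ 1, mul 0, proj₁ 0],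
       [inj₂ 0, inj₁ 1, counit 0, one 0, proj₁ 0]⟩,
      [.sni inj₁_proj₁ [] 1, .sni inj₁_proj₁ [0, 1, 2, 3, 4, 5, 6, 7, 8] 0, .sni inj₂_proj₂ [] 0,
      .rw rel_c [1, 2, 4, 5, 6, 7, 8, 9, 10, 11], .rw inj₁_proj₁ [4, 5]]),
    (⟨[.b, .y],
       [inj₂ 1, comul 1, proj₁ 1, inj₁ 1, mul 0, proj₂ 0, proj₁ 1],
       [inj₂ 1, counit 1, one 1, proj₂ 0, proj₁ 1]⟩,
      [.sni inj₂_proj₂ [0, 1, 2, 3, 4, 5] 0, .sni inj₂_proj₂ [] 1,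
      .sni inj₁_proj₁ [0, 1, 2, 3, 4, 5, 6, 7, 8, 9, 10] 1,
      .rw rel_c' [1, 2, 3, 4, 5, 6, 7, 8, 10, 11], .rw inj₂_proj₂ [1, 2]]),
    -- The second half of relation 2 with its middle input set to the unit; this is all the Hopf
    -- datum axioms need of it. The next law is dual: the first half of relation 2 with its middle
    -- output closed by the counit.
    (⟨[.b, .y],
       [inj₂ 1, comul 1, braid .b .b 0, proj₁ 2, inj₁ 2, proj₁ 0, mul 1, proj₂ 1],
       [proj₂ 0, inj₂ 1, counit 1, one 0, proj₁ 0]⟩,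
      [.sni inj₁_proj₁ [0, 1, 2, 3, 4] 2, .sni one_braid_mul [0, 1, 4, 5] 1, .wr one_idem₂ [0],
      .sni inj₂_proj₂ [] 1, .sni inj₁_proj₁ [0, 1, 2, 3, 4, 5, 6, 7, 8, 9] 0,
      .sni inj₂_proj₂ [0, 1, 2, 3, 4, 5, 6, 7, 8, 9, 10, 11, 12, 13, 14, 15, 16, 17, 18] 1,
      .rw rel_b' [1, 2, 4, 5, 6, 7, 8, 9, 10, 12, 13, 14, 15, 16, 17, 18, 19],
      .rw one_counit [5, 6], .rw inj₂_proj₂ [3, 4]]),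
    (⟨[.x, .y],
       [inj₁ 0, comul 0, inj₂ 2, proj₂ 0, inj₂ 0, braid .b .b 1, mul 0, proj₁ 0],
       [inj₂ 1, counit 1, one 0, proj₁ 0, inj₁ 1]⟩,
      [.sni inj₂_proj₂ [0, 1, 2] 0, .sni comul_braid_counit [0, 1, 2, 3, 6, 7] 0,
      .wr idem₁_counit [12], .sni inj₁_proj₁ [0, 1, 2, 3, 4, 5, 6, 7, 8, 9, 10, 11] 0,
      .sni inj₂_proj₂ [] 1, .sni inj₁_proj₁ [] 0,
      .rw rel_b [1, 2, 3, 4, 5, 6, 7, 8, 10, 11, 12, 13, 14, 15, 16, 18, 19],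
      .rw one_counit [2, 3], .rw inj₁_proj₁ [2, 3]]),
    -- In the bialgebra law for Δm(i₂ ⊗ i₁), three of the four inner strands may be projected for
    -- free. The fourth, the left leg of Δi₁, is split as Π₁·Π₂, and relation 1 removes the Π₂ part.
    -- The law for φ₁,₂ is dual.
    (⟨[.y, .x],
       [inj₂ 0, inj₁ 1, mul 0, comul 0, proj₁ 0, proj₂ 1],
       [inj₂ 0, inj₁ 1, comul 0, comul 2, proj₂ 0, inj₂ 0, proj₂ 1, inj₂ 1, proj₁ 2, inj₁ 2,
       proj₁ 3, inj₁ 3, braid .b .b 1, mul 0, mul 1, proj₁ 0, proj₂ 1]⟩,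
      [.rw bialgebra [2, 3], .wr idem₂_mul_proj₂ [7, 8], .wr (.natR true .b) [4, 7],
      .wr (.natR true .b) [5, 8], .rw inj₂_comul_idem₂ [0, 1, 2],
      .sni split [0, 1, 2, 3, 4, 5, 6, 7] 2, .rw coassoc [7, 8], .rw (.natL true .b) [13, 14],
      .wr assoc [15, 16], .rw (.natL true .b) [14, 15], .rw (.natL true .b) [13, 14],
      .wr inj₁_comul_idem₁ [6, 7], .rw res_a' [13, 14, 15, 16, 20, 21],
      .rw one_idem₂ [12, 13, 14], .rw unit_right [12, 13]]),
    (⟨[.x, .y],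
       [inj₁ 0, inj₂ 1, mul 0, comul 0, proj₂ 0, proj₁ 1],
       [inj₁ 0, inj₂ 1, comul 0, comul 2, braid .b .b 1, proj₂ 0, inj₂ 0, proj₂ 1, inj₂ 1,
       proj₁ 2, inj₁ 2, proj₁ 3, inj₁ 3, mul 0, mul 1, proj₂ 0, proj₁ 1]⟩,
      [.rw bialgebra [2, 3], .wr inj₁_comul_idem₁ [0, 1], .rw (.natR true .b) [3, 6],
      .rw (.natR true .b) [2, 5], .rw inj₁_mul_idem₁ [8, 9, 10], .sni split [0, 1, 2, 3, 4] 1,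
      .wr assoc [10, 11], .wr (.natL true .b) [4, 5], .rw coassoc [3, 4],
      .wr (.natL true .b) [4, 5], .wr (.natL true .b) [5, 6], .wr idem₂_mul_proj₂ [12, 13],
      .rw res_a [0, 1, 5, 6, 7, 8], .rw idem₁_counit [6, 7, 8], .rw counit_left [5, 6]]),
    -- When the right leg of an element of B₂ acts on b through Π₁ and p₂ is then applied, the left
    -- leg may be projected to B₂. It is split as Π₁·Π₂ and relations 1 and 2 remove the Π₁ part.
    -- This is why σ̂ can be written with a coaction that lands in B₂ ⊗ B₁. The next law is the dual
    -- statement for ρ̂.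
    (⟨[.b, .y],
       [inj₂ 1, comul 1, braid .b .b 0, proj₁ 2, inj₁ 2, mul 1, proj₂ 1],
       [inj₂ 1, comul 1, braid .b .b 0, proj₁ 2, inj₁ 2, proj₂ 0, inj₂ 0, mul 1, proj₂ 1]⟩,
      [.sni split [0, 1, 2] 0, .wr (.natL true .b) [2, 3], .rw coassoc [1, 2], .sni split [0, 1] 2,
      .rw bialgebra [10, 11], .rw (.natL true .b) [13, 14], .wr inj₁_comul_idem₁ [7, 8],
      .rw (.natR true .b) [11, 15], .rw inj₁_mul_idem₁ [20, 21, 22],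
      .rw inj₁_mul [20, 22, 23, 24, 25], .wr (.natR true .b) [14, 20],
      .rw inj₁_comul_idem₁ [7, 8, 10, 11], .wr assoc [21, 22], .wr (.natR true .b) [13, 14, 19],
      .wr idem₂_mul_proj₂ [21, 22], .wr (.natR true .b) [14, 19], .wr (.natR true .b) [15, 20],
      .wr idem₂_mul_proj₂ [17, 18], .rw res_a' [7, 8, 9, 10, 12, 13], .rw one_idem₂ [5, 6, 7],
      .rw unit_left [5, 16], .wr coassoc [1, 5], .rw inj₂_comul_idem₂ [0, 1, 11],
      .rw res_b [3, 4, 5, 6, 8, 9, 10, 11], .rw one_idem₁ [0, 1, 2], .rw unit_left [0, 14],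
      .rw idem₂_counit [4, 5, 6], .rw counit_left [3, 4], .rw inj₂_proj₂ [2, 3],
      .rw (.natR true .b) [1, 4], .rw (.natR true .b) [0, 3], .rw idem₂_mul_proj₂ [5, 6, 9, 10]]),
    (⟨[.x, .b],
       [inj₁ 0, comul 0, proj₂ 0, inj₂ 0, braid .b .b 1, mul 0, proj₁ 0],
       [inj₁ 0, comul 0, proj₁ 2, inj₁ 2, proj₂ 0, inj₂ 0, braid .b .b 1, mul 0, proj₁ 0]⟩,
      [.sni split [] 1, .rw (.natL true .b) [9, 10], .wr assoc [11, 12],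
      .sni split [0, 1, 2, 3, 4, 5, 6, 7, 8] 0, .rw bialgebra [8, 9], .wr (.natL true .b) [8, 9],
      .wr idem₂_mul_proj₂ [15, 16], .wr (.natR true .b) [10, 14], .rw inj₂_comul_idem₂ [3, 4, 5],
      .rw comul_proj₂ [2, 3, 4, 5, 7], .rw (.natR true .b) [5, 11],
      .rw idem₂_mul_proj₂ [14, 15, 17, 18], .rw coassoc [1, 2], .rw (.natR true .b) [4, 9, 10],
      .wr inj₁_comul_idem₁ [0, 1], .rw (.natR true .b) [5, 10], .rw (.natR true .b) [4, 9],
      .wr inj₁_comul_idem₁ [6, 7], .rw res_a [13, 14, 16, 17, 18, 19],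
      .rw idem₁_counit [18, 19, 20], .rw counit_right [7, 18], .rw assoc [16, 20],
      .rw inj₁_mul_idem₁ [10, 20, 21], .rw res_b' [12, 13, 14, 15, 17, 18, 19, 20],
      .rw idem₂_counit [18, 19, 20], .rw counit_right [4, 18], .rw one_idem₁ [10, 11, 12],
      .rw unit_right [10, 11], .rw inj₁_proj₁ [9, 10], .wr (.natR true .b) [6, 9],
      .wr (.natR true .b) [7, 10], .rw inj₁_comul_idem₁ [0, 1, 4, 5]]),
    -- The laws for φ₂,₁ and φ₁,₂ again, with the braiding between the projections and the
    -- injections, which is where their definitions put it.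
    (⟨[.y, .x],
       [inj₂ 0, comul 0, proj₂ 0, proj₂ 1, inj₁ 2, comul 2, proj₁ 2, proj₁ 3, braid .y .x 1,
       inj₂ 0, inj₁ 1, mul 0, proj₁ 0, inj₂ 1, inj₁ 2, mul 1, proj₂ 1],
       [inj₂ 0, inj₁ 1, mul 0, comul 0, proj₁ 0, proj₂ 1]⟩,
      [.wr (.natR true .x) [8, 12], .wr (.natL true .b) [9, 10],
      .wr phi21_reduced [0, 1, 2, 3, 4, 5, 6, 7, 8, 9, 10, 11, 12, 13, 14, 15, 16]]),
    (⟨[.x, .y],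
       [inj₁ 0, comul 0, proj₂ 0, proj₁ 1, inj₂ 2, comul 2, proj₂ 2, proj₁ 3, braid .x .y 1,
       inj₂ 0, inj₂ 1, mul 0, proj₂ 0, inj₁ 1, inj₁ 2, mul 1, proj₁ 1],
       [inj₁ 0, inj₂ 1, mul 0, comul 0, proj₂ 0, proj₁ 1]⟩,
      [.rw (.natR true .y) [4, 8], .rw (.natL true .b) [6, 7],
      .wr phi12_reduced [0, 1, 2, 3, 4, 5, 6, 7, 8, 9, 10, 11, 12, 13, 14, 15, 16]]),
    -- In the bialgebra law for Δm(i₂ ⊗ i₂) the right leg of the second factor is split as Π₁·Π₂: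
    -- its Π₁ part acts on the right leg of the first factor and its Π₂ part is multiplied
    -- afterwards, as in σ̂. The law for ρ̂ is dual.
    (⟨[.y, .y],
       [inj₂ 0, inj₂ 1, mul 0, comul 0, proj₁ 0, proj₂ 1],
       [inj₂ 0, comul 0, proj₂ 0, proj₂ 1, inj₂ 2, comul 2, proj₂ 2, proj₂ 3, inj₂ 2, comul 2,
       proj₂ 2, proj₁ 3, braid .y .y 1, inj₂ 0, inj₂ 1, mul 0, proj₁ 0, inj₂ 1, inj₁ 2, mul 1,
       proj₂ 1, inj₂ 1, inj₂ 2, mul 1, proj₂ 1]⟩,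
      [.rw bialgebra [2, 3], .wr idem₂_mul_proj₂ [7, 8], .wr (.natR true .b) [4, 7],
      .wr (.natR true .b) [5, 8], .rw inj₂_comul_idem₂ [0, 1, 2],
      .sni split [0, 1, 2, 3, 4, 5, 6, 7] 3, .wr coassoc [7, 11], .wr assoc [16, 17],
      .wr idem₂_mul_proj₂ [17, 18], .wr inj₂_comul_idem₂ [0, 1, 2, 3, 4],
      .rw inj₂_comul_idem₂ [4, 5, 15], .rw coact_idem₂ [7, 8, 9, 12, 13, 14, 15],
      .wr inj₂_comul_idem₂ [4, 5, 6, 7, 19], .wr (.natL true .b) [7, 8],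
      .wr (.natL true .b) [8, 9], .rw inj₂_comul_idem₂ [0, 1, 2],
      .wr inj₂_comul_idem₂ [0, 1, 2, 3, 4], .rw (.natR true .b) [3, 9],
      .rw (.natL true .y) [7, 8], .rw inj₂_comul_idem₂ [3, 4, 17], .rw inj₂_comul_idem₂ [0, 1, 2]]),
    (⟨[.x, .y],
       [inj₁ 0, inj₂ 1, mul 0, comul 0, proj₁ 0, proj₁ 1],
       [inj₁ 0, comul 0, proj₁ 0, proj₁ 1, inj₁ 1, comul 1, proj₂ 1, proj₁ 2, inj₂ 3, comul 3,
       proj₁ 3, proj₁ 4, braid .x .x 2, inj₂ 1, inj₁ 2, mul 1, proj₁ 1, inj₁ 0, inj₁ 1, mul 0,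
       proj₁ 0, inj₁ 1, inj₁ 2, mul 1, proj₁ 1]⟩,
      [.rw bialgebra [2, 3], .wr inj₁_comul_idem₁ [0, 1], .rw (.natR true .b) [3, 6],
      .rw (.natR true .b) [2, 5], .rw inj₁_mul_idem₁ [8, 9, 10], .sni split [0, 1] 0,
      .rw assoc [7, 11], .rw coassoc [1, 2], .wr inj₁_comul_idem₁ [0, 1],
      .wr inj₁_mul_idem₁ [16, 17, 18, 19, 20], .rw inj₁_mul_idem₁ [3, 13, 14],
      .rw act_idem₁ [5, 6, 7, 8, 11, 12, 13], .wr inj₁_mul_idem₁ [3, 15, 16, 17, 18],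
      .rw (.natL true .b) [12, 13], .rw (.natL true .b) [11, 12], .rw inj₁_mul_idem₁ [18, 19, 20],
      .wr inj₁_mul_idem₁ [18, 19, 20, 21, 22], .wr (.natR true .b) [11, 17],
      .wr (.natL true .x) [12, 13], .rw inj₁_mul_idem₁ [3, 16, 17],
      .rw inj₁_mul_idem₁ [20, 21, 22]]),
    -- For two factors in B₁ the left leg of the second may be projected to B₁ when the product of
    -- the left legs is projected by p₁; relations 1 and 3 remove its Π₂ part. This is what the
    -- formula for Δ₁m₁ requires. The last law is its dual, for Δ₂m₂.
    (⟨[.x, .x],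
       [inj₁ 0, inj₁ 1, comul 0, comul 2, braid .b .b 1, mul 0, mul 1, proj₁ 0],
       [inj₁ 0, inj₁ 1, comul 0, comul 2, proj₁ 2, inj₁ 2, braid .b .b 1, mul 0, mul 1, proj₁ 0]⟩,
      [.sni split [0, 1, 2, 3] 2, .sni split [0, 1] 0, .rw assoc [7, 17],
      .rw (.natL true .b) [14, 15], .wr assoc [16, 17], .rw inj₁_mul_idem₁ [4, 18, 19],
      .sni split [0, 1, 2, 3, 4, 5, 6, 7, 8, 9, 10, 11, 12, 13] 1, .rw assoc [19, 23],
      .rw inj₁_mul_idem₁ [16, 23, 24], .wr inj₁_mul_idem₁ [4, 26, 27, 28, 29],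
      .rw bialgebra [13, 14], .wr idem₂_mul_proj₂ [19, 20], .wr (.natR true .b) [15, 19],
      .rw inj₂_comul_idem₂ [6, 7, 8], .rw comul_proj₂ [5, 6, 7, 8, 10],
      .wr (.natR true .b) [16, 20], .wr inj₁_comul_idem₁ [0, 1],
      .rw inj₁_comul_idem₁ [0, 1, 10, 11], .rw (.natR true .b) [9, 17],
      .rw (.natR true .b) [8, 16], .rw idem₂_mul_proj₂ [19, 20, 21, 22], .wr coassoc [2, 5],
      .rw coassoc [1, 2], .wr (.natL true .b) [13, 14], .rw (.natR true .b) [7, 14, 15],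
      .wr inj₁_comul_idem₁ [0, 1], .rw (.natR true .b) [8, 15], .wr inj₁_comul_idem₁ [12, 13],
      .rw res_a [18, 19, 21, 22, 23, 24], .rw idem₁_counit [22, 23, 24],
      .rw counit_right [13, 22], .wr (.natR true .b) [13, 17], .rw inj₁_comul_idem₁ [0, 1, 7, 8],
      -- Relation 3 contains no braiding, so a crossing and its inverse are inserted to undo the
      -- braiding in front of it; they are cancelled at the end.
      .sni (.cancel true .b .b) [0, 1, 2, 3, 4, 5, 6, 7, 8, 9, 10, 11, 12, 13, 14, 15, 16, 17, 18,
          19, 20, 21] 4,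
      .rw coassoc [8, 9], .wr inj₁_comul_idem₁ [7, 8], .wr inj₁_comul_idem₁ [0, 1],
      .rw (.natL true .b) [24, 25], .rw (.natL true .b) [23, 24],
      .rw (.natL true .b) [22, 23, 32], .rw (.natL true .b) [21, 22],
      .rw res_c [19, 22, 23, 24, 25, 26, 27], .rw one_idem₁ [17, 18, 19],
      .rw idem₂_counit [22, 23, 24], .rw unit_right [17, 18], .rw counit_left [19, 20],
      .wr (.natL true .b) [20, 21], .wr inj₁_mul_idem₁ [4, 15, 16, 17, 18],
      .rw inj₁_comul_idem₁ [0, 1, 7, 8], .rw inj₁_comul_idem₁ [7, 8, 15, 16],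
      .rw (.cancel true .b .b) [15, 16], .wr assoc [12, 13], .rw split [2, 3, 4, 5, 6, 7]]),
    (⟨[.b, .y],
       [inj₂ 1, comul 0, comul 2, braid .b .b 1, mul 0, mul 1, proj₂ 0, proj₂ 1],
       [inj₂ 1, comul 0, comul 2, braid .b .b 1, proj₂ 1, inj₂ 1, mul 0, mul 1, proj₂ 0, proj₂ 1]⟩,
      [.sni split [0, 1, 2, 3] 1, .sni split [0, 1, 2] 3, .wr coassoc [2, 12],
      .wr (.natL true .b) [4, 5], .rw coassoc [3, 4], .rw inj₂_comul_idem₂ [1, 2, 16],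
      .sni split [0, 1, 2, 3, 4, 5] 3, .wr coassoc [5, 9], .rw inj₂_comul_idem₂ [4, 5, 12],
      .wr inj₂_comul_idem₂ [1, 2, 3, 4, 26], .rw bialgebra [14, 15],
      .wr inj₁_comul_idem₁ [11, 12], .rw (.natR true .b) [14, 18],
      .rw inj₁_mul_idem₁ [25, 26, 27], .rw inj₁_mul [25, 27, 28, 29, 30],
      .rw (.natR true .b) [13, 17], .wr idem₂_mul_proj₂ [32, 33],
      .rw idem₂_mul_proj₂ [24, 25, 34, 35], .wr (.natR true .b) [16, 24],
      .wr (.natR true .b) [17, 25], .rw inj₁_comul_idem₁ [11, 12, 13, 14], .rw assoc [26, 29],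
      .wr assoc [29, 30], .rw (.natL true .b) [17, 18], .wr (.natR true .b) [17, 18, 25],
      .wr idem₂_mul_proj₂ [30, 31], .wr (.natR true .b) [18, 25], .wr idem₂_mul_proj₂ [20, 21],
      .rw res_a' [11, 12, 13, 14, 16, 17], .rw one_idem₂ [10, 11, 12], .rw unit_left [10, 19],
      .rw (.natR true .b) [13, 17], .rw idem₂_mul_proj₂ [22, 23, 29, 30],
      .sni (.cancel false .b .b) [0] 0, .wr assoc [21, 22], .wr idem₂_mul_proj₂ [22, 23],
      .wr idem₂_mul_proj₂ [31, 32], .wr (.natL true .b) [9, 10], .wr (.natL true .b) [10, 11],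
      .wr (.natL true .b) [2, 11, 12], .wr (.natL true .b) [11, 12],
      .rw res_c' [6, 7, 8, 9, 10, 11, 14], .rw idem₂_counit [12, 13, 14], .rw one_idem₁ [5, 6, 7],
      .rw counit_left [9, 10], .rw unit_right [5, 6], .rw (.natL true .b) [2, 3],
      .wr inj₂_comul_idem₂ [5, 6, 7, 8, 19], .rw idem₂_mul_proj₂ [13, 14, 20, 21],
      .rw idem₂_mul_proj₂ [3, 4, 11, 12], .rw (.cancel false .b .b) [1, 2], .rw coassoc [2, 3],
      .rw split [8, 9, 10, 11, 12, 13]]) ]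

/-- `basicRules` and their consequences. -/
def basicLaws : List (Rule Strand Box) := basicRules ++ basicLemmas.map Prod.fst

/-- All laws of a bialgebra with a pair of injections and projections that satisfy the strong
projection relations. -/
def strongLaws : List (Rule Strand Box) :=
  (basicLaws ++ strongRules) ++ strongLemmas.map Prod.fst

lemma checkAll_basicLemmas : checkAll basicRules basicLemmas = true := by
  decide +kernel

lemma checkAll_strongLemmas : checkAll (basicLaws ++ strongRules) strongLemmas = true := by
  decide +kernel

end Splitting

end CrossProduct

-- Validity of the laws in a given bialgebra.

namespace CrossProduct

open Diagram
open scoped MonObj ComonObj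

variable {C : Type u} [Category.{v} C] [MonoidalCategory C] [BraidedCategory C]
variable {B : C} [BimonObj B] {B₁ B₂ : C} {i₁ : B₁ ⟶ B} {p₁ : B ⟶ B₁} {i₂ : B₂ ⟶ B} {p₂ : B ⟶ B₂}

/-- The equational form of `IsProjectionPair`. -/
structure IsSplitPair (B : C) [BimonObj B] (i₁ : B₁ ⟶ B) (p₁ : B ⟶ B₁) (i₂ : B₂ ⟶ B)
    (p₂ : B ⟶ B₂) : Prop where
  retract₁ : i₁ ≫ p₁ = 𝟙 B₁
  retract₂ : i₂ ≫ p₂ = 𝟙 B₂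
  inj₁_mul : (i₁ ⊗ₘ i₁) ≫ μ[B] ≫ p₁ ≫ i₁ = (i₁ ⊗ₘ i₁) ≫ μ[B]
  one_idem₁ : η[B] ≫ p₁ ≫ i₁ = η[B]
  comul_proj₂ : p₂ ≫ i₂ ≫ Δ[B] ≫ (p₂ ⊗ₘ p₂) = Δ[B] ≫ (p₂ ⊗ₘ p₂)
  idem₂_counit : p₂ ≫ i₂ ≫ ε[B] = ε[B]
  inv₁ : ((i₁ ⊗ₘ i₂) ≫ μ[B]) ≫ Δ[B] ≫ (p₁ ⊗ₘ p₂) = 𝟙 (B₁ ⊗ B₂)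
  inv₂ : (Δ[B] ≫ (p₁ ⊗ₘ p₂)) ≫ (i₁ ⊗ₘ i₂) ≫ μ[B] = 𝟙 B

namespace Splitting

lemma basicRules_hold (H : IsSplitPair B i₁ p₁ i₂ p₂) :
    AllHold (interp B i₁ p₁ i₂ p₂) basicRules := by
  have unit_left : (λ_ B).inv ≫ η[B] ▷ B ≫ μ[B] = 𝟙 B := by simp
  have unit_right : (ρ_ B).inv ≫ B ◁ η[B] ≫ μ[B] = 𝟙 B := by simp
  have counit_left : Δ[B] ≫ ε[B] ▷ B ≫ (λ_ B).hom = 𝟙 B := by simp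
  have counit_right : Δ[B] ≫ B ◁ ε[B] ≫ (ρ_ B).hom = 𝟙 B := by simp
  have bialgebra := BimonObj.mul_comul B
  -- Written out, the middle interchange is a single braiding between associators, so the diagram of
  -- the bialgebra law can be read off.
  rw [tensorμ] at bialgebra
  have mul_counit : μ[B] ≫ ε[B] = (ε[B] ⊗ₘ ε[B]) ≫ (λ_ (𝟙_ C)).hom := by simp
  -- The order is that of `basicRules`, to which the numbers in `Law` refer.
  exact .cons_of_eq (MonObj.mul_assoc B) <| .cons_of_eq unit_left <| .cons_of_eq unit_right <|
    .cons_of_eq (ComonObj.comul_assoc B).symm <| .cons_of_eq counit_left <|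
    .cons_of_eq counit_right <| .cons_of_eq bialgebra <| .cons_of_eq (Bimon.one_comul B) <|
    .cons_of_eq mul_counit <| .cons_of_eq (BimonObj.one_counit B) <|
    .cons_of_eq H.retract₁ <| .cons_of_eq H.retract₂ <| .cons_of_eq H.inv₂ <|
    .cons_of_eq H.inv₁ <| .cons_of_eq H.inj₁_mul <| .cons_of_eq H.one_idem₁ <|
    .cons_of_eq H.comul_proj₂ <| .cons_of_eq H.idem₂_counit .nil

theorem basicLaws_hold (H : IsSplitPair B i₁ p₁ i₂ p₂) :
    AllHold (interp B i₁ p₁ i₂ p₂) basicLaws :=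
  (basicRules_hold H).extend basicLemmas checkAll_basicLemmas

set_option synthInstance.maxSize 1000 in
set_option synthInstance.maxHeartbeats 200000 in
lemma strongRules_hold (S : IsStrongProjection B (p₁ ≫ i₁) (p₂ ≫ i₂)) :
    AllHold (interp B i₁ p₁ i₂ p₂) strongRules := by
  obtain ⟨ha, ha', hb, hb', hc, hc', hd, hd'⟩ := S
  unfold Phi at ha hb hd
  unfold PhiRot at ha' hb' hd'
  unfold delta at hc hc'
  exact .cons_of_eq ha <| .cons_of_eq ha' <| .cons_of_eq hb <| .cons_of_eq hb' <|
    .cons_of_eq hc <| .cons_of_eq hc' <| .cons_of_eq hd <| .cons_of_eq hd' .nil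

theorem strongLaws_hold (H : IsSplitPair B i₁ p₁ i₂ p₂)
    (S : IsStrongProjection B (p₁ ≫ i₁) (p₂ ≫ i₂)) :
    AllHold (interp B i₁ p₁ i₂ p₂) strongLaws :=
  ((basicLaws_hold H).append (strongRules_hold S)).extend strongLemmas checkAll_strongLemmas

end Splitting

end CrossProduct

-- The Hopf datum of a split pair.

namespace CrossProduct

open Diagram
open scoped MonObj ComonObj

variable {C : Type u} [Category.{v} C] [MonoidalCategory C] [BraidedCategory C]
variable {B : C} [BimonObj B] {B₁ B₂ : C} {i₁ : B₁ ⟶ B} {p₁ : B ⟶ B₁} {i₂ : B₂ ⟶ B} {p₂ : B ⟶ B₂}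

namespace Splitting

open Law

/-- The algebra structure of `B₁`. -/
abbrev monObj (H : IsSplitPair B i₁ p₁ i₂ p₂) : MonObj B₁ where
  one := η[B] ≫ p₁
  mul := (i₁ ⊗ₘ i₁) ≫ μ[B] ≫ p₁
  one_mul := (basicLaws_hold H).eq_of_check [.x] [
    .rw one_idem₁ [0, 1, 2], .rw unit_left [0, 2], .rw inj₁_proj₁ [0, 1]]
  mul_one := (basicLaws_hold H).eq_of_check [.x] [
    .rw one_idem₁ [1, 2, 3], .rw unit_right [1, 2], .rw inj₁_proj₁ [0, 1]]
  mul_assoc := (basicLaws_hold H).eq_of_check [.x, .x, .x] [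
    .rw inj₁_mul [0, 1, 2, 3, 4], .rw assoc [2, 4], .rw inj₁_mul_idem₁ [0, 4, 5]]

/-- The coalgebra structure of `B₂`. -/
abbrev comonObj (H : IsSplitPair B i₁ p₁ i₂ p₂) : ComonObj B₂ where
  counit := i₂ ≫ ε[B]
  comul := i₂ ≫ Δ[B] ≫ (p₂ ⊗ₘ p₂)
  counit_comul := (basicLaws_hold H).eq_of_check [.y] [
    .rw idem₂_counit [2, 3, 4], .rw counit_left [1, 2], .rw inj₂_proj₂ [0, 1]]
  comul_counit := (basicLaws_hold H).eq_of_check [.y] [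
    .rw idem₂_counit [3, 4, 5], .rw counit_right [1, 3], .rw inj₂_proj₂ [0, 1]]
  comul_assoc := (basicLaws_hold H).eq_of_check [.y] [
    .rw comul_proj₂ [3, 4, 5, 6, 7], .wr coassoc [1, 3], .rw inj₂_comul_idem₂ [0, 1, 5]]

/-- The Hopf datum of a pair of injections and projections. -/
def datum (H : IsSplitPair B i₁ p₁ i₂ p₂) : HopfDatumCore B₁ B₂ where
  -- No projection relation enters here: the morphisms exist for every split pair. The converse
  -- direction depends on this, as it identifies a given datum with `datum H` before the relations
  -- are known.
  alg₁ := monObj H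
  coalg₂ := comonObj H
  comul₁ := i₁ ≫ Δ[B] ≫ (p₁ ⊗ₘ p₁)
  counit₁ := i₁ ≫ ε[B]
  mul₂ := (i₂ ⊗ₘ i₂) ≫ μ[B] ≫ p₂
  one₂ := η[B] ≫ p₂
  actL := (i₂ ⊗ₘ i₁) ≫ μ[B] ≫ p₁
  actR := (i₂ ⊗ₘ i₁) ≫ μ[B] ≫ p₂
  coactL := i₁ ≫ Δ[B] ≫ (p₂ ⊗ₘ p₁)
  coactR := i₂ ≫ Δ[B] ≫ (p₂ ⊗ₘ p₁)
  cyc := i₂ ≫ Δ[B] ≫ (p₁ ⊗ₘ p₁)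
  coc := (i₂ ⊗ₘ i₂) ≫ μ[B] ≫ p₁

section Drawn

variable (H : IsSplitPair B i₁ p₁ i₂ p₂)

instance drawn_mul₁ : Drawn (interp B i₁ p₁ i₂ p₂) (datum H).mul₁
    [inj₁ 0, inj₁ 1, mul 0, proj₁ 0] :=
  inferInstanceAs (Drawn (interp B i₁ p₁ i₂ p₂) ((i₁ ⊗ₘ i₁) ≫ μ[B] ≫ p₁) [inj₁ 0, inj₁ 1, mul 0,
      proj₁ 0])

instance drawn_one₁ : Drawn (interp B i₁ p₁ i₂ p₂) (datum H).one₁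
    [one 0, proj₁ 0] :=
  inferInstanceAs (Drawn (interp B i₁ p₁ i₂ p₂) (η[B] ≫ p₁) [one 0, proj₁ 0])

instance drawn_comul₂ : Drawn (interp B i₁ p₁ i₂ p₂) (datum H).comul₂
    [inj₂ 0, comul 0, proj₂ 0, proj₂ 1] :=
  inferInstanceAs (Drawn (interp B i₁ p₁ i₂ p₂) (i₂ ≫ Δ[B] ≫ (p₂ ⊗ₘ p₂)) [inj₂ 0, comul 0,
      proj₂ 0, proj₂ 1])

instance drawn_counit₂ : Drawn (interp B i₁ p₁ i₂ p₂) (datum H).counit₂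
    [inj₂ 0, counit 0] :=
  inferInstanceAs (Drawn (interp B i₁ p₁ i₂ p₂) (i₂ ≫ ε[B]) [inj₂ 0, counit 0])

instance drawn_comul₁ : Drawn (interp B i₁ p₁ i₂ p₂) (datum H).comul₁
    [inj₁ 0, comul 0, proj₁ 0, proj₁ 1] :=
  inferInstanceAs (Drawn (interp B i₁ p₁ i₂ p₂) (i₁ ≫ Δ[B] ≫ (p₁ ⊗ₘ p₁)) [inj₁ 0, comul 0,
      proj₁ 0, proj₁ 1])

instance drawn_counit₁ : Drawn (interp B i₁ p₁ i₂ p₂) (datum H).counit₁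
    [inj₁ 0, counit 0] :=
  inferInstanceAs (Drawn (interp B i₁ p₁ i₂ p₂) (i₁ ≫ ε[B]) [inj₁ 0, counit 0])

instance drawn_mul₂ : Drawn (interp B i₁ p₁ i₂ p₂) (datum H).mul₂
    [inj₂ 0, inj₂ 1, mul 0, proj₂ 0] :=
  inferInstanceAs (Drawn (interp B i₁ p₁ i₂ p₂) ((i₂ ⊗ₘ i₂) ≫ μ[B] ≫ p₂) [inj₂ 0, inj₂ 1, mul 0,
      proj₂ 0])

instance drawn_one₂ : Drawn (interp B i₁ p₁ i₂ p₂) (datum H).one₂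
    [one 0, proj₂ 0] :=
  inferInstanceAs (Drawn (interp B i₁ p₁ i₂ p₂) (η[B] ≫ p₂) [one 0, proj₂ 0])

instance drawn_actL : Drawn (interp B i₁ p₁ i₂ p₂) (datum H).actL
    [inj₂ 0, inj₁ 1, mul 0, proj₁ 0] :=
  inferInstanceAs (Drawn (interp B i₁ p₁ i₂ p₂) ((i₂ ⊗ₘ i₁) ≫ μ[B] ≫ p₁) [inj₂ 0, inj₁ 1, mul 0,
      proj₁ 0])

instance drawn_actR : Drawn (interp B i₁ p₁ i₂ p₂) (datum H).actR
    [inj₂ 0, inj₁ 1, mul 0, proj₂ 0] :=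
  inferInstanceAs (Drawn (interp B i₁ p₁ i₂ p₂) ((i₂ ⊗ₘ i₁) ≫ μ[B] ≫ p₂) [inj₂ 0, inj₁ 1, mul 0,
      proj₂ 0])

instance drawn_coactL : Drawn (interp B i₁ p₁ i₂ p₂) (datum H).coactL
    [inj₁ 0, comul 0, proj₂ 0, proj₁ 1] :=
  inferInstanceAs (Drawn (interp B i₁ p₁ i₂ p₂) (i₁ ≫ Δ[B] ≫ (p₂ ⊗ₘ p₁)) [inj₁ 0, comul 0,
      proj₂ 0, proj₁ 1])

instance drawn_coactR : Drawn (interp B i₁ p₁ i₂ p₂) (datum H).coactR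
    [inj₂ 0, comul 0, proj₂ 0, proj₁ 1] :=
  inferInstanceAs (Drawn (interp B i₁ p₁ i₂ p₂) (i₂ ≫ Δ[B] ≫ (p₂ ⊗ₘ p₁)) [inj₂ 0, comul 0,
      proj₂ 0, proj₁ 1])

instance drawn_cyc : Drawn (interp B i₁ p₁ i₂ p₂) (datum H).cyc
    [inj₂ 0, comul 0, proj₁ 0, proj₁ 1] :=
  inferInstanceAs (Drawn (interp B i₁ p₁ i₂ p₂) (i₂ ≫ Δ[B] ≫ (p₁ ⊗ₘ p₁)) [inj₂ 0, comul 0,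
      proj₁ 0, proj₁ 1])

instance drawn_coc : Drawn (interp B i₁ p₁ i₂ p₂) (datum H).coc
    [inj₂ 0, inj₂ 1, mul 0, proj₁ 0] :=
  inferInstanceAs (Drawn (interp B i₁ p₁ i₂ p₂) ((i₂ ⊗ₘ i₂) ≫ μ[B] ≫ p₁) [inj₂ 0, inj₂ 1, mul 0,
      proj₁ 0])

end Drawn

end Splitting

end CrossProduct

-- Collapse of φ₂,₁, φ₁,₂, σ̂, ρ̂ and the axioms of a Hopf datum.

namespace CrossProduct

open Diagram
open scoped MonObj ComonObj

variable {C : Type u} [Category.{v} C] [MonoidalCategory C] [BraidedCategory C]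
variable {B : C} [BimonObj B] {B₁ B₂ : C} {i₁ : B₁ ⟶ B} {p₁ : B ⟶ B₁} {i₂ : B₂ ⟶ B} {p₂ : B ⟶ B₂}

namespace Splitting

open Law

/-- From here on φ₂,₁ can be drawn as a product in B followed by a coproduct, and likewise for the
other three composites. Relation 1 enters at this point. -/
lemma phi21_eq
    (H : IsSplitPair B i₁ p₁ i₂ p₂) (S : IsStrongProjection B (p₁ ≫ i₁) (p₂ ≫ i₂)) :
    (datum H).phi21 = (i₂ ⊗ₘ i₁) ≫ μ[B] ≫ Δ[B] ≫ (p₁ ⊗ₘ p₂) := by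
  unfold HopfDatumCore.phi21
  exact (strongLaws_hold H S).eq_of_check [.y, .x] [.rw phi21 [0, 1, 2, 3, 4, 5, 6, 7, 8, 9, 10,
      11, 12, 13, 14, 15, 16]]

lemma drawn_phi21
    (H : IsSplitPair B i₁ p₁ i₂ p₂) (S : IsStrongProjection B (p₁ ≫ i₁) (p₂ ≫ i₂)) :
    Drawn (interp B i₁ p₁ i₂ p₂) (datum H).phi21
    [inj₂ 0, inj₁ 1, mul 0, comul 0, proj₁ 0, proj₂ 1] :=
  .of_eq (f := (i₂ ⊗ₘ i₁) ≫ μ[B] ≫ Δ[B] ≫ (p₁ ⊗ₘ p₂))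
    inferInstance (phi21_eq H S).symm

lemma phi12_eq
    (H : IsSplitPair B i₁ p₁ i₂ p₂) (S : IsStrongProjection B (p₁ ≫ i₁) (p₂ ≫ i₂)) :
    (datum H).phi12 = (i₁ ⊗ₘ i₂) ≫ μ[B] ≫ Δ[B] ≫ (p₂ ⊗ₘ p₁) := by
  unfold HopfDatumCore.phi12
  exact (strongLaws_hold H S).eq_of_check [.x, .y] [.rw phi12 [0, 1, 2, 3, 4, 5, 6, 7, 8, 9, 10,
      11, 12, 13, 14, 15, 16]]

lemma drawn_phi12
    (H : IsSplitPair B i₁ p₁ i₂ p₂) (S : IsStrongProjection B (p₁ ≫ i₁) (p₂ ≫ i₂)) :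
    Drawn (interp B i₁ p₁ i₂ p₂) (datum H).phi12
    [inj₁ 0, inj₂ 1, mul 0, comul 0, proj₂ 0, proj₁ 1] :=
  .of_eq (f := (i₁ ⊗ₘ i₂) ≫ μ[B] ≫ Δ[B] ≫ (p₂ ⊗ₘ p₁))
    inferInstance (phi12_eq H S).symm

lemma sigmaHat_eq
    (H : IsSplitPair B i₁ p₁ i₂ p₂) (S : IsStrongProjection B (p₁ ≫ i₁) (p₂ ≫ i₂)) :
    (datum H).sigmaHat = (i₂ ⊗ₘ i₂) ≫ μ[B] ≫ Δ[B] ≫ (p₁ ⊗ₘ p₂) := by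
  unfold HopfDatumCore.sigmaHat
  exact (strongLaws_hold H S).eq_of_check [.y, .y] [
      .wr sigmaHat [0, 1, 2, 3, 4, 5, 6, 7, 8, 9, 10, 11, 12, 13, 14, 15, 16, 17, 18, 19, 20, 21,
          22, 23, 24]]

lemma drawn_sigmaHat
    (H : IsSplitPair B i₁ p₁ i₂ p₂) (S : IsStrongProjection B (p₁ ≫ i₁) (p₂ ≫ i₂)) :
    Drawn (interp B i₁ p₁ i₂ p₂) (datum H).sigmaHat
    [inj₂ 0, inj₂ 1, mul 0, comul 0, proj₁ 0, proj₂ 1] :=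
  .of_eq (f := (i₂ ⊗ₘ i₂) ≫ μ[B] ≫ Δ[B] ≫ (p₁ ⊗ₘ p₂))
    inferInstance (sigmaHat_eq H S).symm

lemma rhoHat_eq
    (H : IsSplitPair B i₁ p₁ i₂ p₂) (S : IsStrongProjection B (p₁ ≫ i₁) (p₂ ≫ i₂)) :
    (datum H).rhoHat = (i₁ ⊗ₘ i₂) ≫ μ[B] ≫ Δ[B] ≫ (p₁ ⊗ₘ p₁) := by
  unfold HopfDatumCore.rhoHat
  exact (strongLaws_hold H S).eq_of_check [.x, .y] [
      .wr rhoHat [0, 1, 2, 3, 4, 5, 6, 7, 8, 9, 10, 11, 12, 13, 14, 15, 16, 17, 18, 19, 20, 21,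
          22, 23, 24]]

lemma drawn_rhoHat
    (H : IsSplitPair B i₁ p₁ i₂ p₂) (S : IsStrongProjection B (p₁ ≫ i₁) (p₂ ≫ i₂)) :
    Drawn (interp B i₁ p₁ i₂ p₂) (datum H).rhoHat
    [inj₁ 0, inj₂ 1, mul 0, comul 0, proj₁ 0, proj₁ 1] :=
  .of_eq (f := (i₁ ⊗ₘ i₂) ≫ μ[B] ≫ Δ[B] ≫ (p₁ ⊗ₘ p₁))
    inferInstance (rhoHat_eq H S).symm

-- Once the four composites are collapsed, every axiom is a law of B in which the identity of B, or
-- an inner strand, is split as m(Π₁ ⊗ Π₂)Δ. The unit and counit identities use only the basic laws.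
set_option synthInstance.maxSize 1000 in
set_option synthInstance.maxHeartbeats 200000 in
set_option maxHeartbeats 4000000 in
theorem isHopfDatum
    (H : IsSplitPair B i₁ p₁ i₂ p₂) (S : IsStrongProjection B (p₁ ≫ i₁) (p₂ ≫ i₂)) :
    (datum H).IsHopfDatum := by
  have L := strongLaws_hold H S
  -- These hypotheses make the four composites be drawn in collapsed form instead of by their
  -- definitions.
  have := drawn_phi21 H S
  have := drawn_phi12 H S
  have := drawn_sigmaHat H S
  have := drawn_rhoHat H S
  exact
  { one₁_counit₁ := L.eq_of_check [] [.rw one_idem₁ [0, 1, 2], .rw one_counit [0, 1]]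
    mul₁_counit₁ := L.eq_of_check [.x, .x] [.rw idem₁_counit [3, 4, 5], .rw mul_counit [2, 3]]
    one₂_counit₂ := L.eq_of_check [] [.rw idem₂_counit [1, 2, 3], .rw one_counit [0, 1]]
    one₂_comul₂ := L.eq_of_check [] [.rw one_idem₂ [0, 1, 2], .rw one_comul [0, 1]]
    coactL_coassoc := L.eq_of_check [.x] [
      .rw inj₁_comul_idem₁ [0, 1, 3, 4], .wr coassoc [1, 3], .wr comul_proj₂ [2, 3, 4]]
    coactL_counit₂ := L.eq_of_check [.x] [
      .rw idem₂_counit [2, 3, 4], .rw counit_left [1, 2], .rw inj₁_proj₁ [0, 1]]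
    actR_assoc := L.eq_of_check [.y, .x, .x] [
      .rw idem₂_mul_proj₂ [3, 4, 6, 7], .rw assoc [2, 4], .wr inj₁_mul [1, 2, 3]]
    one₁_actR := L.eq_of_check [.y] [
      .rw one_idem₁ [1, 2, 3], .rw unit_right [1, 2], .rw inj₂_proj₂ [0, 1]]
    one₁_comul₁ := L.eq_of_check [] [.rw one_idem₁ [0, 1, 2], .rw one_comul [0, 1]]
    comul₁_counit₁ := L.eq_of_check [.x] [
      .rw idem₁_counit [3, 4, 5], .rw counit_right [1, 3], .rw inj₁_proj₁ [0, 1]]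
    counit₁_comul₁ := L.eq_of_check [.x] [
      .rw idem₁_counit [2, 3, 4], .rw counit_left [1, 2], .rw inj₁_proj₁ [0, 1]]
    mul₂_counit₂ := L.eq_of_check [.y, .y] [.rw idem₂_counit [3, 4, 5], .rw mul_counit [2, 3]]
    mul₂_one₂ := L.eq_of_check [.y] [
      .rw one_idem₂ [1, 2, 3], .rw unit_right [1, 2], .rw inj₂_proj₂ [0, 1]]
    one₂_mul₂ := L.eq_of_check [.y] [
      .rw one_idem₂ [0, 1, 2], .rw unit_left [0, 2], .rw inj₂_proj₂ [0, 1]]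
    one₂_actR := L.eq_of_check [.x] [
      .rw one_idem₂ [0, 1, 2], .rw unit_left [0, 2], .rw inj₁_proj₂ [0, 1]]
    actR_counit₂ := L.eq_of_check [.y, .x] [.rw idem₂_counit [3, 4, 5], .rw mul_counit [2, 3]]
    coactL_counit₁ := L.eq_of_check [.x] [
      .rw idem₁_counit [3, 4, 5], .rw counit_right [1, 3], .rw inj₁_proj₂ [0, 1]]
    one₁_coactL := L.eq_of_check [] [.rw one_idem₁ [0, 1, 2], .rw one_comul [0, 1]]
    one₂_actL := L.eq_of_check [.x] [
      .rw one_idem₂ [0, 1, 2], .rw unit_left [0, 2], .rw inj₁_proj₁ [0, 1]]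
    one₁_actL := L.eq_of_check [.y] [
      .rw one_idem₁ [1, 2, 3], .rw unit_right [1, 2], .rw inj₂_proj₁ [0, 1]]
    actL_counit₁ := L.eq_of_check [.y, .x] [.rw idem₁_counit [3, 4, 5], .rw mul_counit [2, 3]]
    coactR_counit₁ := L.eq_of_check [.y] [
      .rw idem₁_counit [3, 4, 5], .rw counit_right [1, 3], .rw inj₂_proj₂ [0, 1]]
    coactR_counit₂ := L.eq_of_check [.y] [
      .rw idem₂_counit [2, 3, 4], .rw counit_left [1, 2], .rw inj₂_proj₁ [0, 1]]
    one₂_coactR := L.eq_of_check [] [.rw one_idem₂ [0, 1, 2], .rw one_comul [0, 1]]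
    one₂_coc := L.eq_of_check [.y] [
      .rw one_idem₂ [0, 1, 2], .rw unit_left [0, 2], .rw inj₂_proj₁ [0, 1]]
    coc_one₂ := L.eq_of_check [.y] [
      .rw one_idem₂ [1, 2, 3], .rw unit_right [1, 2], .rw inj₂_proj₁ [0, 1]]
    coc_counit₁ := L.eq_of_check [.y, .y] [.rw idem₁_counit [3, 4, 5], .rw mul_counit [2, 3]]
    cyc_counit₁ := L.eq_of_check [.y] [
      .rw idem₁_counit [3, 4, 5], .rw counit_right [1, 3], .rw inj₂_proj₁ [0, 1]]
    counit₁_cyc := L.eq_of_check [.y] [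
      .rw idem₁_counit [2, 3, 4], .rw counit_left [1, 2], .rw inj₂_proj₁ [0, 1]]
    one₂_cyc := L.eq_of_check [] [.rw one_idem₂ [0, 1, 2], .rw one_comul [0, 1]]
    -- On the left p₂ absorbs the inner Π₂, and associativity of m applies. The inner product of the
    -- last two factors is then split, which produces σ̂.
    mul₂_assoc := L.eq_of_check [.y, .y, .y] [
      .rw idem₂_mul_proj₂ [3, 4, 6, 7], .rw assoc [2, 4], .wr split_mul_right [4],
      .wr idem₂_mul_proj₂ [10, 11]]
    comul₁_coassoc := L.eq_of_check [.x] [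
      .rw inj₁_comul_idem₁ [0, 1, 3, 4], .wr coassoc [1, 3], .wr split_comul_left [1],
      .wr inj₁_comul_idem₁ [0, 1]]
    -- Here both sides contain splittings; removing them reduces each to p₁ of the triple product.
    actL_assoc := L.eq_of_check [.y, .y, .x] [
      .wr inj₁_mul_idem₁ [5, 10, 11, 12, 13], .rw split_mul [3, 4, 5, 6, 7, 9, 10],
      .rw assoc [2, 4], .wr split_mul_right [4], .wr split_mul [10],
      .rw inj₁_mul_idem₁ [10, 16, 17]]
    coactR_coassoc := L.eq_of_check [.y] [
      .wr inj₂_comul_idem₂ [0, 1, 2, 3, 8], .rw split_comul [1, 2, 4, 5, 6, 7, 8],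
      .wr coassoc [1, 3], .wr split_comul_left [1], .wr split_comul [1],
      .rw inj₂_comul_idem₂ [0, 1, 7]]
    mul₁_actL := L.eq_of_check [.y, .x, .x] [
      .rw inj₁_mul [1, 2, 3, 4, 5], .wr assoc [3, 4], .wr split_mul [4],
      .rw inj₁_mul_idem₁ [5, 10, 11]]
    mul₂_actR := L.eq_of_check [.y, .y, .x] [
      .rw idem₂_mul_proj₂ [3, 4, 6, 7], .rw assoc [2, 4], .wr split_mul_right [4],
      .wr idem₂_mul_proj₂ [10, 11]]
    coactL_comul₁ := L.eq_of_check [.x] [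
      .rw inj₁_comul_idem₁ [0, 1, 3, 4], .wr coassoc [1, 3], .wr split_comul_left [1],
      .wr inj₁_comul_idem₁ [0, 1]]
    coactR_comul₂ := L.eq_of_check [.y] [
      .rw comul_proj₂ [2, 3, 4, 5, 6], .rw coassoc [1, 2], .wr split_comul [1],
      .rw inj₂_comul_idem₂ [0, 1, 6]]
    coc_compat := L.eq_of_check [.y, .y, .y] [
      .wr inj₁_mul_idem₁ [5, 10, 11, 12, 13], .rw split_mul [3, 4, 5, 6, 7, 9, 10],
      .rw assoc [2, 4], .wr split_mul_right [4], .wr split_mul [10],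
      .rw inj₁_mul_idem₁ [10, 16, 17]]
    cyc_compat := L.eq_of_check [.y] [
      .wr inj₂_comul_idem₂ [0, 1, 2, 3, 8], .rw split_comul [1, 2, 4, 5, 6, 7, 8],
      .wr coassoc [1, 3], .wr split_comul_left [1], .wr split_comul [1],
      .rw inj₂_comul_idem₂ [0, 1, 7]]
    -- The one place where relation 3 is felt on this side, through `inj₁_mul_idem₁_comul`; dually
    -- below for `mul₂_comul₂`.
    mul₁_comul₁ := L.eq_of_check [.x, .x] [
      .rw inj₁_mul [0, 1, 2, 3, 4], .rw bialgebra [2, 3],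
      .rw inj₁_mul_idem₁_comul [0, 1, 2, 3, 4, 5, 6, 7], .wr inj₁_comul_idem₁ [0, 1],
      .wr split_comul_left [1], .rw assoc [7, 15], .rw (.natL true .b) [12, 13],
      .rw (.natR true .x) [8, 12], .rw inj₁_mul_idem₁ [3, 14, 15], .wr inj₁_comul_idem₁ [8, 9],
      .wr inj₁_comul_idem₁ [0, 1]]
    mul₂_comul₂ := L.eq_of_check [.y, .y] [
      .rw comul_proj₂ [3, 4, 5, 6, 7], .rw bialgebra [2, 3],
      .rw idem₂_comul_proj₂ [1, 2, 3, 4, 5, 6, 7, 8], .wr (.natL true .b) [4, 5],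
      .wr (.natL true .b) [5, 6], .wr idem₂_braid_mul [6, 9, 10], .wr split_mul_right [11],
      .wr coassoc [5, 11], .rw (.natL true .b) [8, 9], .rw (.natR true .y) [3, 8],
      .rw inj₂_comul_idem₂ [3, 4, 15], .wr idem₂_mul_proj₂ [19, 20], .wr idem₂_mul_proj₂ [11, 12]]
    -- Between two collapsed maps the identity m(Π₁ ⊗ Π₂)Δ appears and disappears, leaving a single
    -- Δm between injections and projections. The bialgebra law is applied to it and the resulting
    -- strands are split as the right side prescribes. The other three compatibilities between these
    -- composites follow the same pattern.
    phi21_rhoHat := L.eq_of_check [.y, .x] [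
      .rw split [3, 4, 5, 6, 7, 8], .rw bialgebra [2, 3], .wr split_comul_left [1],
      .wr split_comul [4], .wr split_idem₂ [4, 11], .wr coassoc [1, 4],
      .wr inj₁_comul_idem₁ [20, 21], .wr split_comul_braid_mul [21, 22, 23],
      .rw (.natR true .b) [19, 24], .rw (.natR true .b) [26, 30], .rw assoc [33, 36],
      .rw assoc [14, 25], .wr split_idem₁ [4, 25], .rw assoc [31, 37],
      .rw (.natL true .b) [33, 34], .rw (.natR true .b) [17, 22], .rw (.natR true .y) [30, 33],
      .rw (.natL true .b) [33, 34], .rw (.natL true .y) [20, 21], .rw (.natR true .b) [15, 22],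
      .rw (.natR true .y) [29, 33], .rw (.natL true .x) [20, 21], .rw inj₂_comul_idem₂ [8, 9, 15],
      .rw inj₂_comul_idem₂ [0, 1, 7], .rw inj₁_mul_idem₁ [41, 46, 47],
      .rw inj₁_mul_idem₁ [30, 39, 40], .rw inj₁_mul_idem₁ [6, 28, 29],
      .wr inj₁_comul_idem₁ [20, 21]]
    actR_comul₂ := L.eq_of_check [.y, .x] [
      .rw comul_proj₂ [3, 4, 5, 6, 7], .rw bialgebra [2, 3], .wr idem₂_braid_mul [4, 7, 8],
      .rw (.natR true .b) [3, 6], .wr (.natR true .b) [5, 8], .rw (.natR true .b) [3, 6],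
      .wr (.natR true .b) [5, 8], .wr inj₁_comul_idem₁ [4, 5],
      .wr split_comul_braid_mul [5, 6, 7], .rw (.natL true .b) [12, 13],
      .rw (.natR true .b) [3, 8], .rw (.natR true .y) [9, 12], .rw (.natL true .y) [6, 7],
      .wr inj₁_comul_idem₁ [3, 4], .wr idem₂_mul_proj₂ [15, 16], .wr idem₂_mul_proj₂ [8, 9]]
    mul₁_coactL := L.eq_of_check [.x, .x] [
      .rw inj₁_mul [0, 1, 2, 3, 4], .rw bialgebra [2, 3], .wr split_comul_braid_mul [3, 4, 5],
      .rw (.natL true .b) [10, 11], .wr inj₁_comul_idem₁ [0, 1], .rw (.natR true .b) [3, 8],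
      .rw (.natR true .y) [9, 12], .rw (.natL true .x) [6, 7], .rw inj₁_mul_idem₁ [15, 16, 17],
      .wr inj₁_comul_idem₁ [3, 4], .wr idem₂_mul_proj₂ [15, 16], .wr idem₂_mul_proj₂ [8, 9]]
    sigmaHat_phi12 := L.eq_of_check [.y, .y] [
      .rw split [3, 4, 5, 6, 7, 8], .rw bialgebra [2, 3], .wr split_comul_braid_mul [3, 4, 5],
      .sni split [0, 1] 1, .rw (.natR true .b) [7, 12], .rw (.natR true .b) [14, 18],
      .rw (.natL true .b) [16, 17], .rw (.natR true .b) [6, 11], .rw (.natR true .y) [13, 16],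
      .rw (.natL true .b) [16, 17], .rw (.natL true .y) [9, 10], .rw (.natR true .b) [4, 11],
      .rw (.natR true .y) [12, 16], .rw (.natL true .x) [9, 10], .wr split_mul_right [22],
      .rw assoc [21, 25], .wr (.natR true .y) [14, 20], .wr (.natL true .x) [16, 17],
      .wr (.natR true .x) [8, 12], .wr (.natL true .b) [15, 16], .wr (.natL true .x) [10, 11],
      .wr (.natL true .b) [9, 10], .wr split_idem₁ [20, 25], .wr (.natR true .b) [17, 20],
      .wr (.natR true .b) [11, 13], .wr coassoc [14, 21], .wr split_idem₂ [14, 32],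
      .wr coassoc [8, 14], .wr coassoc [1, 2], .rw assoc [37, 40], .rw (.natL true .b) [23, 24],
      .rw (.natR true .b) [6, 12], .rw (.natR true .y) [14, 23], .rw (.natL true .b) [23, 24],
      .rw (.natL true .y) [10, 11], .rw (.natR true .b) [4, 12], .rw (.natR true .y) [13, 23],
      .rw (.natL true .x) [10, 11], .rw inj₂_comul_idem₂ [16, 17, 37],
      .rw inj₂_comul_idem₂ [5, 6, 15], .rw inj₂_comul_idem₂ [0, 1, 4],
      .rw inj₁_mul_idem₁ [40, 46, 47], .rw inj₁_mul_idem₁ [32, 38, 39],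
      .wr idem₂_mul_proj₂ [30, 31], .wr idem₂_mul_proj₂ [16, 17]]
    phi21_phi12 := L.eq_of_check [.y, .x] [
      .rw split [3, 4, 5, 6, 7, 8], .rw bialgebra [2, 3], .wr inj₁_comul_idem₁ [2, 3],
      .wr split_comul_braid_mul [3, 4, 5], .wr split_comul [1], .rw (.natR true .b) [7, 12],
      .rw (.natR true .b) [14, 18], .rw assoc [21, 24], .rw (.natL true .b) [16, 17],
      .rw (.natR true .b) [6, 11], .rw (.natR true .y) [13, 16], .rw (.natL true .b) [16, 17],
      .rw (.natL true .y) [9, 10], .rw (.natR true .b) [4, 11], .rw (.natR true .y) [12, 16],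
      .rw (.natL true .x) [9, 10], .rw inj₂_comul_idem₂ [0, 1, 4],
      .rw inj₁_mul_idem₁ [21, 26, 27], .wr inj₁_comul_idem₁ [7, 8], .wr idem₂_mul_proj₂ [21, 22],
      .wr idem₂_mul_proj₂ [13, 14]]
    sigmaHat_rhoHat := L.eq_of_check [.y, .y] [
      .rw split [3, 4, 5, 6, 7, 8], .rw bialgebra [2, 3], .wr split_comul_braid_mul [3, 4, 5],
      .sni split [0, 1] 1, .rw (.natR true .b) [7, 12], .rw (.natR true .b) [14, 18],
      .rw (.natL true .b) [16, 17], .rw (.natR true .b) [6, 11], .rw (.natR true .y) [13, 16],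
      .rw (.natL true .b) [16, 17], .rw (.natL true .y) [9, 10], .rw (.natR true .b) [4, 11],
      .rw (.natR true .y) [12, 16], .rw (.natL true .x) [9, 10], .wr split_mul_right [22],
      .rw assoc [21, 25], .wr (.natR true .y) [14, 20], .wr (.natL true .x) [16, 17],
      .wr (.natR true .x) [8, 12], .wr (.natL true .b) [15, 16], .wr (.natL true .x) [10, 11],
      .wr (.natL true .b) [9, 10], .wr split_idem₁ [20, 25], .wr (.natR true .b) [17, 20],
      .wr (.natR true .b) [11, 13], .wr coassoc [14, 21], .wr split_idem₂ [14, 32],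
      .wr coassoc [8, 14], .wr split_comul_left [1], .wr coassoc [4, 8], .wr split_idem₂ [4, 11],
      .wr coassoc [1, 4], .rw assoc [49, 52], .rw assoc [14, 26], .wr split_idem₁ [4, 26],
      .rw assoc [32, 44], .rw (.natL true .b) [40, 41], .rw (.natR true .b) [17, 23],
      .rw (.natR true .y) [31, 40], .rw (.natL true .b) [40, 41], .rw (.natL true .y) [21, 22],
      .rw (.natR true .b) [15, 23], .rw (.natR true .y) [30, 40], .rw (.natL true .x) [21, 22],
      .rw inj₂_comul_idem₂ [33, 34, 55], .rw inj₂_comul_idem₂ [16, 17, 32],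
      .rw inj₂_comul_idem₂ [8, 9, 15], .rw inj₂_comul_idem₂ [0, 1, 7],
      .rw inj₁_mul_idem₁ [60, 66, 67], .rw inj₁_mul_idem₁ [52, 58, 59],
      .rw inj₁_mul_idem₁ [33, 50, 51], .rw inj₁_mul_idem₁ [6, 31, 32]] }

end Splitting

end CrossProduct

-- The strong identities and the strong projection relations.

namespace CrossProduct

open Diagram
open scoped MonObj ComonObj

variable {C : Type u} [Category.{v} C] [MonoidalCategory C] [BraidedCategory C]
variable {B : C} [BimonObj B] {B₁ B₂ : C} {i₁ : B₁ ⟶ B} {p₁ : B ⟶ B₁} {i₂ : B₂ ⟶ B} {p₂ : B ⟶ B₂}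

namespace Splitting

open Law

-- Each additional identity is one of the eight projection relations. Injections and projections
-- slide through the braidings until they meet, Π's that are absorbed by a neighbouring m or Δ are
-- dropped, and p_j i_j = id supplies the outer Π's of the relation.
set_option synthInstance.maxSize 1000 in
set_option synthInstance.maxHeartbeats 200000 in
set_option maxHeartbeats 4000000 in
theorem isStrongHopfDatum
    (H : IsSplitPair B i₁ p₁ i₂ p₂) (S : IsStrongProjection B (p₁ ≫ i₁) (p₂ ≫ i₂)) :
    (datum H).IsStrongHopfDatum := by
  have L := strongLaws_hold H S
  exact
  { toIsHopfDatum := isHopfDatum H S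
    coactL_actR := L.eq_of_check [.x, .x] [
      .rw idem₂_mul_proj₂ [2, 3, 7, 8], .wr (.natL true .x) [3, 4], .rw (.natL true .x) [3, 4],
      .wr (.natL true .x) [3, 4], .rw (.natL true .x) [3, 4], .wr (.natL true .x) [3, 4],
      .rw (.natR true .b) [2, 4], .sni inj₂_proj₂ [0, 1, 2, 3, 4, 5] 0, .sni inj₁_proj₁ [] 1,
      .sni inj₁_proj₁ [] 0, .rw rel_a [1, 2, 3, 5, 6, 7, 8, 9, 10], .rw inj₁_proj₁ [0, 1],
      .rw inj₂_proj₂ [3, 4]]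
    coactL_actR' := L.eq_of_check [.y, .x] [
      .rw inj₁_comul_idem₁ [0, 1, 5, 6], .wr (.natR true .y) [3, 4], .rw (.natR true .y) [0, 4],
      .wr (.natR true .y) [3, 4], .rw (.natR true .y) [0, 4], .wr (.natR true .y) [3, 4],
      .rw (.natL true .b) [3, 4], .sni inj₂_proj₂ [0, 1, 2, 3, 4, 5, 6] 1,
      .sni inj₂_proj₂ [0, 1, 2, 3, 4] 0, .sni inj₁_proj₁ [] 1,
      .rw rel_a' [2, 3, 4, 5, 6, 7, 9, 10, 11], .rw inj₁_proj₁ [3, 4], .rw inj₂_proj₂ [6, 7]]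
    coactL_coactR_coc := L.eq_of_check [.x, .y] [
      .wr (.natL true .x) [10, 11], .wr (.natL true .x) [9, 10], .rw (.natL true .x) [9, 10],
      .rw (.natL true .x) [10, 11], .wr (.natL true .x) [10, 11], .wr (.natL true .x) [9, 10],
      .rw (.natL true .x) [9, 10], .rw (.natL true .x) [10, 11], .wr (.natL true .x) [10, 11],
      .wr (.natL true .x) [9, 10], .rw (.natR true .b) [7, 11], .rw (.natR true .b) [7, 9],
      .sni inj₂_proj₂ [] 1, .sni inj₁_proj₁ [0, 1, 2, 3, 4, 5, 6, 7, 8, 9, 10, 11, 12, 13, 14] 1,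
      .sni inj₁_proj₁ [0, 1, 2, 3, 4, 5, 6, 7, 8, 9, 10, 11, 12, 13] 0, .sni inj₁_proj₁ [] 0,
      .rw rel_b [1, 2, 3, 4, 5, 6, 7, 8, 10, 11, 12, 13, 14, 15, 16, 18, 19],
      .rw inj₁_proj₁ [4, 5], .rw inj₁_proj₁ [4, 5]]
    cyc_actL_actR := L.eq_of_check [.y, .y, .y] [
      .wr (.natR true .x) [3, 6], .wr (.natR true .x) [5, 6], .rw (.natR true .x) [0, 6],
      .rw (.natR true .x) [0, 4], .wr (.natR true .x) [3, 6], .wr (.natR true .x) [5, 6],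
      .rw (.natR true .x) [0, 6], .rw (.natR true .x) [0, 4], .wr (.natR true .x) [3, 6],
      .wr (.natR true .x) [5, 6], .rw (.natL true .b) [4, 5], .rw (.natL true .b) [5, 6],
      .sni inj₂_proj₂ [0, 1, 2, 3, 4, 5, 6, 7, 8, 9, 10, 11, 12, 13] 1, .sni inj₂_proj₂ [] 2,
      .sni inj₂_proj₂ [] 1, .sni inj₁_proj₁ [0, 1, 2, 3, 4, 5, 6, 7, 8, 9, 10] 0,
      .rw rel_b' [2, 3, 5, 6, 7, 8, 9, 10, 11, 13, 14, 15, 16, 17, 18, 19, 20],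
      .rw inj₂_proj₂ [2, 3], .rw inj₂_proj₂ [2, 3]]
    coactL_coc := L.eq_of_check [.y, .x] [
      .sni inj₂_proj₂ [] 0, .sni inj₁_proj₁ [0, 1, 2, 3, 4, 5, 6, 7, 8] 0, .sni inj₁_proj₁ [] 1,
      .rw rel_c [1, 2, 4, 5, 6, 7, 8, 9, 10, 11], .rw inj₁_proj₁ [4, 5], .rw inj₁_proj₁ [4, 5]]
    cyc_actR := L.eq_of_check [.y, .y] [
      .sni inj₂_proj₂ [0, 1, 2, 3, 4, 5, 6] 0, .sni inj₂_proj₂ [] 1,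
      .sni inj₁_proj₁ [0, 1, 2, 3, 4, 5, 6, 7, 8, 9, 10, 11] 1,
      .rw rel_c' [2, 3, 4, 5, 6, 7, 8, 9, 11, 12], .rw inj₂_proj₂ [0, 1], .rw inj₂_proj₂ [0, 1]]
    cyc_comul₁_actR := L.eq_of_check [.y, .x, .y] [
      .wr (.natR true .x) [6, 9], .wr (.natR true .x) [7, 10], .wr (.natL true .x) [16, 17],
      .rw inj₁_comul_idem₁ [5, 6, 15, 16], .wr (.natR true .x) [8, 14],
      .wr (.natR true .x) [11, 12], .wr (.natR true .x) [11, 13], .wr (.natR true .x) [12, 14],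
      .rw (.natR true .x) [0, 14], .rw (.natR true .x) [3, 12], .wr (.natR true .x) [11, 14],
      .wr (.natR true .x) [13, 14], .rw (.natR true .x) [0, 14], .rw (.natR true .x) [3, 12],
      .wr (.natR true .x) [11, 14], .wr (.natR true .x) [13, 14], .rw (.natR true .x) [4, 13],
      .rw (.natR true .x) [3, 12], .rw (.natL true .x) [9, 10], .rw (.natL true .b) [10, 11],
      .rw (.natL true .b) [11, 12], .rw (.natR true .b) [3, 9], .rw (.natR true .b) [14, 15],
      .rw (.natR true .b) [2, 8, 9],
      .sni inj₂_proj₂ [0, 1, 2, 3, 4, 5, 6, 7, 8, 9, 10, 11, 12, 13, 14, 15, 16, 17, 18] 1,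
      .sni inj₂_proj₂ [] 2,
      .sni inj₁_proj₁ [0, 1, 2, 3, 4, 5, 6, 7, 8, 9, 10, 11, 12, 13, 14, 15, 16, 17, 18, 19, 20,
          21, 22, 23, 24] 3,
      .sni inj₁_proj₁ [0, 1, 2, 3, 4, 5, 6, 7, 8, 9, 10, 11] 0, .sni inj₁_proj₁ [] 1,
      .rw rel_d [2, 3, 5, 6, 7, 8, 9, 10, 11, 12, 13, 14, 16, 17, 18, 19, 20, 21, 22, 23, 24, 25,
          28, 29],
      .rw inj₁_proj₁ [12, 13], .rw inj₁_proj₁ [17, 18], .rw inj₁_proj₁ [18, 19],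
      .rw inj₂_proj₂ [2, 3], .rw inj₂_proj₂ [12, 13], .wr (.natL true .b) [6, 7],
      .wr (.natR true .b) [10, 13], .wr (.natR true .b) [7, 10], .rw inj₁_proj₁ [1, 2],
      .wr (.natL true .b) [7, 8], .wr (.natL true .x) [6, 7], .rw (.natR true .x) [0, 8],
      .wr (.natR true .x) [7, 8], .rw (.natR true .x) [0, 8], .wr (.natR true .x) [7, 8],
      .rw (.natR true .x) [0, 8], .wr inj₁_comul_idem₁ [3, 4], .rw (.natL true .x) [10, 11]]
    coactL_mul₂_coc := L.eq_of_check [.y, .y, .x, .y] [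
      .wr (.natR true .y) [7, 9], .wr (.natL true .b) [8, 9], .wr (.natL true .y) [16, 17],
      .wr (.natL true .x) [15, 16], .rw (.natR true .b) [1, 9], .rw (.natL true .x) [15, 16],
      .rw (.natL true .y) [7, 8], .rw (.natL true .y) [16, 17], .wr (.natR true .y) [7, 9],
      .wr (.natL true .b) [8, 9], .wr (.natL true .y) [16, 17], .wr (.natL true .x) [15, 16],
      .rw (.natL true .b) [8, 9], .rw (.natL true .b) [7, 8], .rw idem₂_mul_proj₂ [8, 9, 18, 19],
      .rw (.natL true .x) [13, 14], .rw (.natL true .y) [14, 15], .rw (.natR true .b) [1, 7],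
      .wr (.natL true .y) [14, 15], .wr (.natL true .x) [13, 14], .wr (.natR true .b) [6, 7],
      .rw (.natR true .b) [11, 15], .rw (.natR true .b) [11, 13],
      .sni inj₂_proj₂ [0, 1, 2, 3, 4, 5, 6, 7, 8, 9, 10, 11, 12, 13, 14, 15, 16, 17, 18, 19] 1,
      .sni inj₂_proj₂ [] 3, .sni inj₂_proj₂ [] 0,
      .sni inj₁_proj₁ [0, 1, 2, 3, 4, 5, 6, 7, 8, 9, 10, 11, 12, 13, 14, 15, 16, 17, 18, 19, 20,
          21, 22] 0,
      .sni inj₁_proj₁ [] 2,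
      .rw rel_d' [1, 2, 5, 6, 7, 8, 9, 10, 11, 12, 13, 14, 16, 17, 18, 19, 20, 21, 22, 23, 24, 25,
          27, 28],
      .rw inj₁_proj₁ [6, 7], .rw inj₁_proj₁ [18, 19], .rw inj₂_proj₂ [0, 1],
      .rw inj₂_proj₂ [1, 2], .rw inj₂_proj₂ [4, 5], .wr (.natR true .b) [5, 13],
      .wr (.natR true .b) [8, 13], .rw inj₂_proj₂ [1, 2], .wr (.natL true .y) [7, 8],
      .wr (.natL true .y) [8, 9], .rw (.natL true .x) [4, 5], .rw (.natL true .y) [8, 9],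
      .wr (.natL true .x) [4, 5], .wr (.natL true .y) [8, 9], .rw (.natL true .y) [8, 9],
      .rw (.natL true .x) [4, 5], .wr (.natL true .y) [8, 9], .wr (.natL true .x) [4, 5],
      .rw (.natL true .y) [8, 9], .wr idem₂_mul_proj₂ [6, 7], .rw (.natL true .y) [9, 10],
      .rw (.natL true .x) [6, 7], .rw (.natL true .y) [8, 9], .rw (.natL true .y) [8, 9],
      .rw (.natL true .y) [4, 5]] }

namespace Law

/-! Names of the rewriting rules in `datumRules`. -/

-- The numbering continues that of the basic laws, as it does for the strong projection relations.
-- The overlap is harmless because the two lists are alternatives and are never used together.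
def coactL_actR : Ref Strand := .thm 43
def coactL_actR' : Ref Strand := .thm 44
def coactL_coactR_coc : Ref Strand := .thm 45
def cyc_actL_actR : Ref Strand := .thm 46
def coactL_coc : Ref Strand := .thm 47
def cyc_actR : Ref Strand := .thm 48
def cyc_comul₁_actR : Ref Strand := .thm 49
def coactL_mul₂_coc : Ref Strand := .thm 50

end Law

/-- The additional identities of a strong Hopf datum, for `datum H`. -/
def datumRules : List (Rule Strand Box) :=
  [ ⟨[.x, .x],
      [inj₁ 0, comul 0, proj₂ 0, proj₁ 1, braid .x .x 1, inj₂ 0, inj₁ 1, mul 0, proj₂ 0],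
      [inj₁ 0, comul 0, proj₂ 0, proj₁ 1, inj₁ 2, counit 2]⟩,
    ⟨[.y, .x],
      [inj₁ 1, comul 1, proj₂ 1, proj₁ 2, braid .y .y 0, inj₂ 1, inj₁ 2, mul 1, proj₂ 1],
      [one 0, proj₂ 0, inj₂ 1, inj₁ 2, mul 1, proj₂ 1]⟩,
    ⟨[.x, .y],
      [inj₁ 0, comul 0, proj₂ 0, proj₁ 1, inj₂ 0, comul 0, proj₂ 0, proj₁ 1, braid .x .y 2,
      braid .x .y 1, inj₂ 0, inj₂ 1, mul 0, proj₁ 0],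
      [one 0, proj₁ 0, one 1, proj₁ 1, inj₂ 3, counit 3]⟩,
    ⟨[.y, .y, .y],
      [inj₂ 2, comul 2, proj₁ 2, proj₁ 3, braid .y .x 1, braid .y .x 0, inj₂ 2, inj₁ 3, mul 2,
      proj₁ 2, inj₂ 1, inj₁ 2, mul 1, proj₂ 1],
      [one 0, proj₁ 0, inj₂ 2, counit 2, inj₂ 2, counit 2]⟩,
    ⟨[.y, .x],
      [inj₁ 1, comul 1, proj₂ 1, proj₁ 2, inj₂ 0, inj₂ 1, mul 0, proj₁ 0],
      [inj₂ 0, counit 0, one 0, proj₁ 0]⟩,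
    ⟨[.y, .y],
      [inj₂ 1, comul 1, proj₁ 1, proj₁ 2, inj₂ 0, inj₁ 1, mul 0, proj₂ 0],
      [inj₂ 1, counit 1, one 1, proj₁ 1]⟩,
    ⟨[.y, .x, .y],
      [inj₂ 2, comul 2, proj₁ 2, proj₁ 3, inj₁ 2, comul 2, proj₁ 2, proj₁ 3, braid .x .x 1,
      inj₁ 2, comul 2, proj₂ 2, proj₁ 3, braid .y .x 0, braid .x .x 3, inj₂ 2, inj₁ 3, mul 2,
      proj₁ 2, inj₂ 1, inj₁ 2, mul 1, proj₂ 1],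
      [inj₂ 2, comul 2, proj₁ 2, proj₁ 3, inj₁ 2, comul 2, proj₁ 2, proj₁ 3, braid .x .x 1,
      braid .y .x 0, braid .x .x 2, inj₂ 1, inj₁ 2, mul 1, proj₂ 1]⟩,
    ⟨[.y, .y, .x, .y],
      [inj₁ 2, comul 2, proj₂ 2, proj₁ 3, inj₂ 2, comul 2, proj₂ 2, proj₁ 3, braid .y .y 1,
      braid .x .y 4, inj₂ 2, inj₁ 3, mul 2, proj₂ 2, braid .y .y 2, inj₂ 1, inj₂ 2, mul 1,
      proj₂ 1, inj₂ 0, inj₂ 1, mul 0, proj₁ 0],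
      [inj₁ 2, comul 2, proj₂ 2, proj₁ 3, braid .y .y 1, braid .x .y 3, braid .y .y 2, inj₂ 1,
      inj₂ 2, mul 1, proj₂ 1, inj₂ 0, inj₂ 1, mul 0, proj₁ 0]⟩ ]

set_option synthInstance.maxSize 1000 in
set_option synthInstance.maxHeartbeats 200000 in
lemma datumRules_hold (H : IsSplitPair B i₁ p₁ i₂ p₂) (h : (datum H).IsStrongHopfDatum) :
    AllHold (interp B i₁ p₁ i₂ p₂) datumRules := by
  exact
    .cons_of_eq h.coactL_actR <|
    .cons_of_eq h.coactL_actR' <|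
    .cons_of_eq h.coactL_coactR_coc <|
    .cons_of_eq h.cyc_actL_actR <|
    .cons_of_eq h.coactL_coc <|
    .cons_of_eq h.cyc_actR <|
    .cons_of_eq h.cyc_comul₁_actR <|
    .cons_of_eq h.coactL_mul₂_coc .nil

set_option synthInstance.maxSize 1000 in
set_option synthInstance.maxHeartbeats 200000 in
set_option maxHeartbeats 4000000 in
/-- The strong projection relations follow from the additional identities of a strong Hopf
datum. -/
theorem isStrongProjection (H : IsSplitPair B i₁ p₁ i₂ p₂)
    (h : (datum H).IsStrongHopfDatum) :
    IsStrongProjection B (p₁ ≫ i₁) (p₂ ≫ i₂) := by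
  -- Besides the basic laws only the eight additional identities are used, not the Hopf axioms. The
  -- computations run opposite to those of `isStrongHopfDatum`.
  have L := (basicLaws_hold H).append (datumRules_hold H h)
  constructor <;> (try unfold Phi) <;> (try unfold PhiRot) <;> (try unfold delta)
  · exact L.eq_of_check [.b, .b] [
      .rw (.natL true .b) [4, 5], .wr (.natL true .b) [4, 5], .rw (.natL true .b) [4, 5],
      .wr (.natL true .b) [4, 5], .rw (.natL true .b) [4, 5], .wr inj₁_comul_idem₁ [1, 2],
      .rw (.natR true .x) [4, 6], .wr idem₂_mul_proj₂ [7, 8],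
      .rw coactL_actR [1, 2, 3, 4, 5, 7, 8, 9, 10], .rw idem₁_counit [7, 8, 9],
      .rw inj₁_comul_idem₁ [1, 2, 5, 6]]
  · exact L.eq_of_check [.b, .b] [
      .wr (.natL true .b) [3, 4], .wr (.natL true .b) [4, 5], .rw (.natL true .b) [4, 5],
      .wr (.natL true .b) [4, 5], .rw (.natL true .b) [4, 5], .wr (.natL true .b) [4, 5],
      .wr idem₂_braid_mul [5, 6, 7], .rw (.natL true .b) [6, 7], .rw (.natR true .y) [1, 6],
      .wr inj₁_comul_idem₁ [2, 3], .rw coactL_actR' [2, 3, 4, 5, 7, 8, 9, 10, 11],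
      .rw one_idem₂ [0, 1, 2], .rw idem₂_mul_proj₂ [1, 2, 5, 6]]
  · exact L.eq_of_check [.b, .b] [
      .wr (.natR true .b) [11, 15], .wr (.natR true .b) [12, 16], .rw (.natR true .b) [9, 13],
      .rw (.natL true .b) [10, 11], .rw (.natL true .x) [11, 12], .wr (.natR true .y) [11, 16],
      .wr (.natL true .b) [12, 13], .wr (.natL true .b) [11, 12], .rw (.natL true .b) [11, 12],
      .rw (.natL true .b) [12, 13], .rw (.natR true .y) [9, 12], .wr (.natL true .x) [11, 12],
      .wr (.natL true .b) [10, 11], .wr (.natR true .b) [12, 16], .rw (.natL true .b) [11, 12],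
      .rw (.natL true .b) [12, 13], .rw (.natR true .y) [9, 12], .wr inj₁_comul_idem₁ [1, 2],
      .rw (.natR true .y) [10, 12],
      .rw coactL_coactR_coc [1, 2, 3, 4, 5, 6, 7, 8, 9, 11, 12, 13, 14, 15],
      .rw one_idem₁ [0, 1, 2], .rw one_idem₁ [1, 2, 3], .rw idem₂_counit [4, 5, 6]]
  · exact L.eq_of_check [.b, .b, .b] [
      .wr (.natL true .b) [6, 7], .wr (.natL true .b) [7, 8], .wr (.natL true .b) [5, 6],
      .wr (.natL true .b) [6, 7], .rw (.natL true .b) [6, 7], .rw (.natL true .b) [7, 8],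
      .rw (.natR true .x) [1, 6], .wr (.natL true .b) [6, 7], .wr (.natL true .y) [5, 6],
      .wr (.natR true .b) [6, 8], .rw (.natR true .b) [1, 7], .rw (.natL true .y) [5, 6],
      .rw (.natL true .b) [6, 7], .wr (.natR true .x) [5, 8], .wr (.natL true .b) [7, 8],
      .wr (.natL true .b) [6, 7], .wr idem₂_braid_mul [8, 14, 15], .rw (.natR true .b) [1, 10],
      .rw (.natR true .b) [2, 8], .rw (.natL true .y) [6, 7], .rw (.natL true .y) [7, 8],
      .rw cyc_actL_actR [3, 4, 5, 6, 7, 9, 10, 11, 12, 13, 14, 15, 16, 17],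
      .rw one_idem₁ [0, 1, 2], .rw idem₂_counit [3, 4, 5], .rw idem₂_counit [4, 5, 6]]
  · exact L.eq_of_check [.b, .b] [
      .wr inj₁_comul_idem₁ [3, 4], .rw coactL_coc [1, 3, 4, 5, 6, 7, 8, 10],
      .rw one_idem₁ [0, 1, 2], .rw idem₂_counit [1, 2, 3]]
  · exact L.eq_of_check [.b, .b] [
      .wr idem₂_mul_proj₂ [5, 6], .rw cyc_actR [1, 3, 4, 5, 6, 7, 8, 10], .rw one_idem₁ [2, 3, 4],
      .rw idem₂_counit [3, 4, 5]]
  · exact L.eq_of_check [.b, .b, .b] [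
      .wr (.natR true .b) [8, 12], .wr (.natL true .b) [11, 12], .wr (.natL true .b) [12, 13],
      .wr (.natL true .b) [10, 11], .wr (.natL true .b) [11, 12], .wr (.natL true .b) [9, 10],
      .wr (.natL true .b) [10, 11], .wr (.natR true .b) [12, 14], .wr (.natR true .b) [13, 15],
      .rw (.natL true .b) [12, 13], .rw (.natL true .b) [13, 14], .rw (.natL true .b) [14, 15],
      .rw (.natR true .x) [4, 13], .wr (.natL true .b) [13, 14], .wr (.natL true .y) [12, 13],
      .wr (.natL true .b) [11, 12], .wr (.natR true .b) [13, 15], .rw (.natR true .b) [4, 14],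
      .rw (.natL true .b) [11, 12], .rw (.natL true .y) [12, 13], .rw (.natL true .b) [13, 14],
      .wr (.natR true .x) [12, 15], .wr (.natL true .b) [14, 15], .wr (.natL true .b) [13, 14],
      .wr (.natL true .b) [12, 13], .wr idem₂_braid_mul [15, 20, 21], .rw (.natR true .b) [6, 16],
      .rw (.natR true .b) [5, 15], .rw (.natR true .b) [1, 15], .wr inj₁_comul_idem₁ [2, 3],
      .rw (.natR true .b) [5, 14], .rw (.natR true .b) [4, 13], .rw (.natL true .b) [11, 12],
      .rw (.natL true .b) [12, 13], .rw (.natL true .y) [13, 14], .wr inj₁_comul_idem₁ [8, 9],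
      .rw (.natL true .b) [21, 22], .rw (.natR true .x) [19, 21], .rw (.natR true .x) [3, 11, 12],
      .rw (.natR true .x) [2, 10],
      .rw cyc_comul₁_actR [3, 4, 5, 6, 7, 8, 9, 10, 12, 13, 14, 15, 16, 17, 18, 19, 20, 21, 22,
          23, 24, 25, 28],
      .wr (.natR true .x) [14, 19], .wr (.natL true .b) [15, 16],
      .rw inj₁_comul_idem₁ [6, 7, 14, 15], .wr (.natR true .x) [9, 13],
      .wr (.natL true .y) [11, 12], .wr (.natL true .b) [10, 11], .wr (.natR true .b) [12, 13],
      .rw idem₂_braid_mul [0, 1, 13, 15, 16], .rw (.natR true .b) [1, 10],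
      .rw (.natR true .b) [11, 12], .rw (.natL true .x) [8, 9], .rw (.natL true .b) [9, 10],
      .wr (.natR true .b) [11, 15], .wr (.natL true .b) [9, 10], .wr (.natR true .x) [8, 11],
      .wr (.natL true .b) [9, 10], .rw (.natL true .b) [9, 10], .rw (.natR true .x) [1, 9],
      .rw (.natL true .b) [9, 10], .rw (.natR true .b) [11, 12], .wr (.natL true .b) [9, 10],
      .wr (.natL true .x) [8, 9], .wr (.natR true .b) [11, 15], .wr (.natR true .b) [9, 11],
      .rw (.natL true .b) [9, 10], .rw (.natL true .b) [8, 9], .rw (.natL true .b) [10, 11],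
      .rw (.natL true .b) [9, 10], .rw (.natR true .b) [1, 8], .rw (.natR true .b) [0, 7],
      .rw (.natR true .b) [11, 12], .rw (.natR true .b) [10, 11], .rw (.natL true .b) [5, 6, 10]]
  · exact L.eq_of_check [.b, .b, .b, .b] [
      .wr (.natR true .b) [15, 22], .wr (.natR true .b) [16, 23], .rw (.natR true .b) [13, 17],
      .rw (.natL true .b) [14, 15], .rw (.natL true .y) [15, 16], .wr (.natR true .y) [15, 23],
      .wr (.natL true .b) [16, 17], .wr (.natL true .b) [15, 16], .wr idem₂_mul_proj₂ [18, 19],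
      .wr (.natL true .b) [8, 9], .wr (.natL true .b) [9, 10], .rw (.natL true .b) [17, 18],
      .rw (.natL true .b) [18, 19], .rw (.natR true .y) [15, 18], .rw (.natL true .b) [9, 10],
      .wr (.natL true .y) [17, 18], .wr (.natL true .b) [16, 17], .wr (.natL true .b) [9, 10],
      .wr (.natR true .b) [18, 25], .wr idem₂_braid_mul [10, 13, 14],
      .rw (.natL true .b) [19, 20], .rw (.natL true .b) [20, 21], .rw (.natR true .y) [17, 20],
      .rw (.natL true .b) [11, 12], .rw (.natR true .y) [3, 11], .wr inj₁_comul_idem₁ [4, 5],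
      .rw (.natR true .y) [18, 20],
      .rw coactL_mul₂_coc [1, 4, 5, 6, 7, 8, 9, 10, 11, 12, 13, 14, 15, 16, 17, 19, 20, 21, 22,
          23, 24, 25, 26],
      .wr (.natR true .y) [11, 21], .rw inj₁_comul_idem₁ [4, 5, 9, 10],
      .wr (.natR true .y) [11, 19], .wr (.natL true .b) [12, 13], .wr (.natL true .b) [11, 12],
      .wr (.natR true .y) [7, 9], .wr (.natL true .b) [8, 9], .wr (.natL true .b) [9, 13, 14],
      .wr (.natL true .b) [13, 14], .rw idem₂_mul_proj₂ [7, 8, 12, 13],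
      .wr (.natL true .b) [12, 13], .rw (.natR true .b) [3, 13], .rw (.natL true .b) [7, 8],
      .rw (.natL true .y) [11, 12], .wr (.natL true .b) [7, 8], .wr (.natR true .y) [11, 16],
      .wr (.natL true .b) [12, 13], .rw (.natL true .b) [12, 13], .rw (.natR true .y) [3, 12],
      .rw (.natL true .b) [7, 8], .wr (.natL true .y) [11, 12], .wr (.natL true .b) [7, 8],
      .wr (.natR true .b) [12, 16], .rw (.natL true .b) [12, 13], .rw (.natL true .b) [11, 12]]

end Splitting

end CrossProduct

-- The cross product of the datum is isomorphic to B.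

namespace CrossProduct

open Diagram
open scoped MonObj ComonObj

variable {C : Type u} [Category.{v} C] [MonoidalCategory C] [BraidedCategory C]
variable {B : C} [BimonObj B] {B₁ B₂ : C} {i₁ : B₁ ⟶ B} {p₁ : B ⟶ B₁} {i₂ : B₂ ⟶ B} {p₂ : B ⟶ B₂}

/-- The comonoid structure transported along an isomorphism. -/
abbrev comonObjOfIso {M X : C} [ComonObj M] (e : M ≅ X) : ComonObj X where
  counit := e.inv ≫ ε[M]
  comul := e.inv ≫ Δ[M] ≫ (e.hom ⊗ₘ e.hom)
  counit_comul := by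
    simp only [← tensorHom_id, Category.assoc, tensorHom_comp_tensorHom, e.hom_inv_id_assoc,
      Category.comp_id, ComonObj.counit_comul_hom, e.inv_hom_id_assoc]
  comul_counit := by
    simp only [← id_tensorHom, Category.assoc, tensorHom_comp_tensorHom, e.hom_inv_id_assoc,
      Category.comp_id, ComonObj.comul_counit_hom, e.inv_hom_id_assoc]
  comul_assoc := by
    have h := congrArg (fun f => e.inv ≫ f ≫ (e.hom ⊗ₘ e.hom ⊗ₘ e.hom)) (ComonObj.comul_assoc M)
    simp only [← id_tensorHom, ← tensorHom_id, Category.assoc, ← associator_naturality,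
      tensorHom_comp_tensorHom, tensorHom_comp_tensorHom_assoc, Category.id_comp] at h
    simpa only [← id_tensorHom, ← tensorHom_id, Category.assoc, tensorHom_comp_tensorHom,
      tensorHom_comp_tensorHom_assoc, Category.comp_id, e.hom_inv_id_assoc] using h

/-- The bimonoid structure transported along an isomorphism. -/
abbrev bimonObjOfIso {M X : C} [BimonObj M] (e : M ≅ X) : BimonObj X :=
  { MonObj.ofIso e, comonObjOfIso e with
    mul_comul := by
      change ((e.inv ⊗ₘ e.inv) ≫ μ[M] ≫ e.hom) ≫ e.inv ≫ Δ[M] ≫ (e.hom ⊗ₘ e.hom) =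
        ((e.inv ≫ Δ[M] ≫ (e.hom ⊗ₘ e.hom)) ⊗ₘ (e.inv ≫ Δ[M] ≫ (e.hom ⊗ₘ e.hom))) ≫
          tensorμ X X X X ≫
          (((e.inv ⊗ₘ e.inv) ≫ μ[M] ≫ e.hom) ⊗ₘ ((e.inv ⊗ₘ e.inv) ≫ μ[M] ≫ e.hom))
      have h := congrArg (fun f => (e.inv ⊗ₘ e.inv) ≫ f ≫ (e.hom ⊗ₘ e.hom))
        (BimonObj.mul_comul M)
      simp only [Category.assoc, tensorHom_comp_tensorHom, tensorHom_comp_tensorHom_assoc] at h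
      have h' : (e.inv ≫ Δ[M] ≫ (e.hom ⊗ₘ e.hom)) ⊗ₘ (e.inv ≫ Δ[M] ≫ (e.hom ⊗ₘ e.hom)) =
          ((e.inv ≫ Δ[M]) ⊗ₘ (e.inv ≫ Δ[M])) ≫ ((e.hom ⊗ₘ e.hom) ⊗ₘ (e.hom ⊗ₘ e.hom)) := by
        simp only [Category.assoc, tensorHom_comp_tensorHom]
      rw [h', Category.assoc (_ ⊗ₘ _) (_ ⊗ₘ _), tensorμ_natural_assoc]
      simpa only [Category.assoc, tensorHom_comp_tensorHom, tensorHom_comp_tensorHom_assoc,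
        e.hom_inv_id, e.hom_inv_id_assoc, id_tensorHom_id, Category.id_comp] using h
    one_comul := by
      have h := congrArg (fun f => f ≫ (e.hom ⊗ₘ e.hom)) (Bimon.one_comul M)
      change (η[M] ≫ e.hom) ≫ e.inv ≫ Δ[M] ≫ (e.hom ⊗ₘ e.hom) =
        (λ_ (𝟙_ C)).inv ≫ ((η[M] ≫ e.hom) ⊗ₘ (η[M] ≫ e.hom))
      simpa only [Category.assoc, e.hom_inv_id_assoc, tensorHom_comp_tensorHom] using h
    mul_counit := by
      have h := congrArg (fun f => (e.inv ⊗ₘ e.inv) ≫ f) (BimonObj.mul_counit M)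
      change ((e.inv ⊗ₘ e.inv) ≫ μ[M] ≫ e.hom) ≫ e.inv ≫ ε[M] =
        ((e.inv ≫ ε[M]) ⊗ₘ (e.inv ≫ ε[M])) ≫ (λ_ (𝟙_ C)).hom
      simpa only [Category.assoc, e.hom_inv_id_assoc, Comon.tensorObj_counit,
        tensorHom_comp_tensorHom_assoc] using h
    one_counit := by
      change (η[M] ≫ e.hom) ≫ e.inv ≫ ε[M] = 𝟙 _
      simp }

lemma isBimonHom_inv {M X : C} [BimonObj M] (e : M ≅ X) :
    letI := bimonObjOfIso e
    IsBimonHom e.inv :=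
  letI := bimonObjOfIso e
  { mul_hom := by
      change ((e.inv ⊗ₘ e.inv) ≫ μ[M] ≫ e.hom) ≫ e.inv = _
      simp
    one_hom := by
      change (η[M] ≫ e.hom) ≫ e.inv = _
      simp
    hom_counit := rfl
    hom_comul := by
      change _ = (e.inv ≫ Δ[M] ≫ (e.hom ⊗ₘ e.hom)) ≫ (e.inv ⊗ₘ e.inv)
      simp }

namespace Splitting

open Law

/-- The isomorphism of `B₁ ⊗ B₂` and `B`. -/
@[simps]
def iso (H : IsSplitPair B i₁ p₁ i₂ p₂) : B₁ ⊗ B₂ ≅ B where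
  hom := (i₁ ⊗ₘ i₂) ≫ μ[B]
  inv := Δ[B] ≫ (p₁ ⊗ₘ p₂)
  hom_inv_id := H.inv₁
  inv_hom_id := H.inv₂

-- With φ₂,₁ and σ̂ collapsed, the cross multiplication differs from the product of four factors in
-- B only by two splittings of the identity and by projections of products that already lie in B₁.
set_option synthInstance.maxSize 1000 in
set_option synthInstance.maxHeartbeats 200000 in
lemma crossMul_iso
    (H : IsSplitPair B i₁ p₁ i₂ p₂) (S : IsStrongProjection B (p₁ ≫ i₁) (p₂ ≫ i₂)) :
    (datum H).crossMul ≫ (i₁ ⊗ₘ i₂) ≫ μ[B] =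
      (((i₁ ⊗ₘ i₂) ≫ μ[B]) ⊗ₘ ((i₁ ⊗ₘ i₂) ≫ μ[B])) ≫ μ[B] := by
  have := drawn_phi21 H S
  have := drawn_sigmaHat H S
  unfold HopfDatumCore.crossMul
  exact (strongLaws_hold H S).eq_of_check [.x, .y, .x, .y] [
      .rw inj₁_mul [0, 6, 7, 8, 9], .rw assoc [7, 15], .rw inj₁_mul_idem₁ [0, 15, 16],
      .rw inj₁_mul [0, 16, 17, 18, 19], .rw inj₁_mul [6, 13, 14, 15, 16], .rw assoc [15, 18],
      .rw split_mul_right [11, 12, 13, 14, 15, 16, 17], .rw split_mul [4, 5, 6, 7, 8, 10, 11],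
      .rw assoc [3, 5], .wr assoc [5, 6]]

set_option synthInstance.maxSize 1000 in
set_option synthInstance.maxHeartbeats 200000 in
lemma iso_inv_crossComul
    (H : IsSplitPair B i₁ p₁ i₂ p₂) (S : IsStrongProjection B (p₁ ≫ i₁) (p₂ ≫ i₂)) :
    (Δ[B] ≫ (p₁ ⊗ₘ p₂)) ≫ (datum H).crossComul =
      Δ[B] ≫ ((Δ[B] ≫ (p₁ ⊗ₘ p₂)) ⊗ₘ (Δ[B] ≫ (p₁ ⊗ₘ p₂))) := by
  have := drawn_phi12 H S
  have := drawn_rhoHat H S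
  unfold HopfDatumCore.crossComul
  exact (strongLaws_hold H S).eq_of_check [.b] [
      .rw comul_proj₂ [3, 4, 5, 6, 13], .rw comul_proj₂ [11, 12, 13, 14, 20],
      .rw split_comul_left [0, 1, 2, 3, 4, 5, 6], .rw coassoc [0, 1],
      .rw split_comul_left [2, 3, 4, 5, 6, 7, 8], .rw coassoc [2, 3], .wr coassoc [0, 2]]

lemma one_iso_inv (H : IsSplitPair B i₁ p₁ i₂ p₂) :
    η[B] ≫ Δ[B] ≫ (p₁ ⊗ₘ p₂) = (datum H).crossOne := by
  unfold HopfDatumCore.crossOne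
  exact (basicLaws_hold H).eq_of_check [] [
      .rw one_comul [0, 1]]

lemma iso_hom_counit (H : IsSplitPair B i₁ p₁ i₂ p₂) :
    ((i₁ ⊗ₘ i₂) ≫ μ[B]) ≫ ε[B] = (datum H).crossCounit := by
  unfold HopfDatumCore.crossCounit
  exact (basicLaws_hold H).eq_of_check [.x, .y] [
      .rw mul_counit [2, 3]]

lemma induces (H : IsSplitPair B i₁ p₁ i₂ p₂) :
    (datum H).Induces B (iso H) i₁ p₁ i₂ p₂ where
  inj₁_eq := by
    rw [iso_hom]
    exact (basicLaws_hold H).eq_of_check [.x] [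
        .sni unit_right [0] 0, .wr one_idem₂ [1]]
  inj₂_eq := by
    rw [iso_hom]
    exact (basicLaws_hold H).eq_of_check [.y] [
        .sni unit_left [0] 0, .wr one_idem₁ [0]]
  proj₁_eq := by
    rw [iso_inv]
    exact (basicLaws_hold H).eq_of_check [.b] [
        .sni counit_right [] 0, .wr idem₂_counit [2]]
  proj₂_eq := by
    rw [iso_inv]
    exact (basicLaws_hold H).eq_of_check [.b] [
        .sni counit_left [] 0, .wr idem₁_counit [1]]

theorem isBialgebraIso
    (H : IsSplitPair B i₁ p₁ i₂ p₂) (S : IsStrongProjection B (p₁ ≫ i₁) (p₂ ≫ i₂)) :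
    (datum H).IsBialgebraIso B (iso H) := by
  -- The structure on B₁ ⊗ B₂ is transported from B, so it is a bialgebra for free. It remains to
  -- see that it is the cross product structure, which can be tested after composing with the
  -- isomorphism.
  refine ⟨bimonObjOfIso (iso H).symm, ⟨?_, one_iso_inv H, ?_, iso_hom_counit H⟩, ?_⟩
  · rw [← cancel_mono (iso H).hom]
    refine .trans ?_ (crossMul_iso H S).symm
    change (((iso H).hom ⊗ₘ (iso H).hom) ≫ μ[B] ≫ (iso H).inv) ≫ (iso H).hom =
      ((iso H).hom ⊗ₘ (iso H).hom) ≫ μ[B]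
    simp only [Category.assoc, Iso.inv_hom_id, Category.comp_id]
  · rw [← cancel_epi (iso H).inv]
    refine .trans ?_ (iso_inv_crossComul H S).symm
    change (iso H).inv ≫ (iso H).hom ≫ Δ[B] ≫ ((iso H).inv ⊗ₘ (iso H).inv) =
      Δ[B] ≫ ((iso H).inv ⊗ₘ (iso H).inv)
    simp only [Iso.inv_hom_id_assoc]
  · exact isBimonHom_inv (iso H).symm

end Splitting

end CrossProduct

-- Equivalence of the descriptions by projections, idempotents and equations.

namespace CrossProduct

open Diagram
open scoped MonObj ComonObj

variable {C : Type u} [Category.{v} C] [MonoidalCategory C] [BraidedCategory C]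
variable {B : C} [BimonObj B] {B₁ B₂ : C} {i₁ : B₁ ⟶ B} {p₁ : B ⟶ B₁} {i₂ : B₂ ⟶ B} {p₂ : B ⟶ B₂}

/-- Because i₁ is a split monomorphism, an algebra structure that makes it a morphism is forced to
be p₁m(i₁ ⊗ i₁). Its existence is therefore equivalent to the two equations for Π₁; dually for p₂.
-/
lemma IsProjectionPair.isSplitPair (H : IsProjectionPair B i₁ p₁ i₂ p₂) :
    IsSplitPair B i₁ p₁ i₂ p₂ := by
  obtain ⟨r₁, r₂, ⟨_, h₁⟩, ⟨_, h₂⟩, inv₁, inv₂⟩ := H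
  refine ⟨r₁, r₂, ?_, ?_, ?_, ?_, inv₁, inv₂⟩
  · have h := IsMonHom.mul_hom i₁
    rw [← reassoc_of% h, reassoc_of% r₁, h]
  · have h := IsMonHom.one_hom i₁
    rw [← h, Category.assoc, reassoc_of% r₁]
  · have h := IsComonHom.hom_comul p₂
    rw [← h, reassoc_of% r₂]
  · have h := IsComonHom.hom_counit p₂
    rw [← h, reassoc_of% r₂]

lemma IsSplitPair.isProjectionPair (H : IsSplitPair B i₁ p₁ i₂ p₂) :
    IsProjectionPair B i₁ p₁ i₂ p₂ where
  retract₁ := H.retract₁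
  retract₂ := H.retract₂
  isMonHom :=
    letI := Splitting.monObj H
    ⟨Splitting.monObj H,
      { mul_hom := by
          change ((i₁ ⊗ₘ i₁) ≫ μ[B] ≫ p₁) ≫ i₁ = _
          simpa only [Category.assoc] using H.inj₁_mul
        one_hom := by
          change (η[B] ≫ p₁) ≫ i₁ = _
          simpa only [Category.assoc] using H.one_idem₁ }⟩
  isComonHom :=
    letI := Splitting.comonObj H
    ⟨Splitting.comonObj H, { hom_comul := H.comul_proj₂, hom_counit := H.idem₂_counit }⟩
  inv₁ := H.inv₁
  inv₂ := H.inv₂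

lemma IsSplitPair.isIdempotentPair (H : IsSplitPair B i₁ p₁ i₂ p₂) :
    IsIdempotentPair B (p₁ ≫ i₁) (p₂ ≫ i₂) := by
  obtain ⟨r₁, r₂, hm, ho, hc, hu, inv₁, inv₂⟩ := H
  have idem : ((p₁ ≫ i₁) ⊗ₘ (p₂ ≫ i₂)) = (p₁ ⊗ₘ p₂) ≫ (i₁ ⊗ₘ i₂) :=
    (tensorHom_comp_tensorHom ..).symm
  have retract : (i₁ ⊗ₘ i₂) ≫ (p₁ ⊗ₘ p₂) = 𝟙 _ := by
    rw [tensorHom_comp_tensorHom, r₁, r₂, id_tensorHom_id]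
  simp only [Category.assoc] at inv₁ inv₂
  refine ⟨?_, ?_, ?_, ho, ?_, ?_, ?_, ?_⟩
  · rw [Category.assoc, reassoc_of% r₁]
  · rw [Category.assoc, reassoc_of% r₂]
  · rw [← tensorHom_comp_tensorHom, Category.assoc, Category.assoc, hm]
  · rw [← tensorHom_comp_tensorHom, Category.assoc, reassoc_of% hc]
  · rw [Category.assoc, hu]
  · simp only [idem, Category.assoc, reassoc_of% retract, inv₂]
  · simp only [idem, Category.assoc, reassoc_of% inv₁]

/-- The injections and projections cancel against the Π's by p_j i_j = id. -/
lemma IsIdempotentPair.isSplitPair (r₁ : i₁ ≫ p₁ = 𝟙 B₁) (r₂ : i₂ ≫ p₂ = 𝟙 B₂)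
    (H : IsIdempotentPair B (p₁ ≫ i₁) (p₂ ≫ i₂)) : IsSplitPair B i₁ p₁ i₂ p₂ := by
  obtain ⟨-, -, hm, ho, hc, hu, inv₂, inv₁⟩ := H
  have idem : ((p₁ ≫ i₁) ⊗ₘ (p₂ ≫ i₂)) = (p₁ ⊗ₘ p₂) ≫ (i₁ ⊗ₘ i₂) :=
    (tensorHom_comp_tensorHom ..).symm
  have retract : (i₁ ⊗ₘ i₂) ≫ (p₁ ⊗ₘ p₂) = 𝟙 _ := by
    rw [tensorHom_comp_tensorHom, r₁, r₂, id_tensorHom_id]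
  have e₁ : i₁ ≫ p₁ ≫ i₁ = i₁ := by rw [reassoc_of% r₁]
  have e₂ : p₂ ≫ i₂ ≫ p₂ = p₂ := by rw [r₂, Category.comp_id]
  simp only [idem, Category.assoc] at inv₁ inv₂
  refine ⟨r₁, r₂, ?_, ho, ?_, ?_, ?_, ?_⟩
  · have h := congrArg (fun f => (i₁ ⊗ₘ i₁) ≫ f) hm
    simpa only [tensorHom_comp_tensorHom_assoc, e₁] using h.symm
  · have h := congrArg (fun f => f ≫ (p₂ ⊗ₘ p₂)) hc
    simpa only [Category.assoc, tensorHom_comp_tensorHom, e₂] using h.symm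
  · simpa only [Category.assoc] using hu
  -- Compressing the idempotent Π₁ ⊗ Π₂ to its image turns it into the identity of B₁ ⊗ B₂.
  · have h := congrArg (fun f => (i₁ ⊗ₘ i₂) ≫ f ≫ (p₁ ⊗ₘ p₂)) inv₁
    simpa only [Category.assoc, retract, reassoc_of% retract, Category.comp_id] using h
  · simpa only [Category.assoc, reassoc_of% retract] using inv₂

end CrossProduct

-- The signature of a Hopf datum and its unit and counit identities.

namespace CrossProduct

open Diagram

/-- The objects `B₁` and `B₂`. -/
inductive Factor
  | x
  | y
  deriving DecidableEq

namespace Crossed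

/-- The morphisms of a Hopf datum. -/
inductive Box
  | mul₁
  | one₁
  | comul₂
  | counit₂
  | comul₁
  | counit₁
  | mul₂
  | one₂
  | actL
  | actR
  | coactL
  | coactR
  | cyc
  | coc
  deriving DecidableEq

instance : Signature Factor Box where
  dom
    | .mul₁ => .two .x .x
    | .one₁ => .nil
    | .comul₂ => .one .y
    | .counit₂ => .one .y
    | .comul₁ => .one .x
    | .counit₁ => .one .x
    | .mul₂ => .two .y .y
    | .one₂ => .nil
    | .actL => .two .y .x
    | .actR => .two .y .x
    | .coactL => .one .x
    | .coactR => .one .y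
    | .cyc => .one .y
    | .coc => .two .y .y
  cod
    | .mul₁ => .one .x
    | .one₁ => .one .x
    | .comul₂ => .two .y .y
    | .counit₂ => .nil
    | .comul₁ => .two .x .x
    | .counit₁ => .nil
    | .mul₂ => .one .y
    | .one₂ => .one .y
    | .actL => .one .x
    | .actR => .one .y
    | .coactL => .two .y .x
    | .coactR => .two .y .x
    | .cyc => .two .x .x
    | .coc => .one .x

variable {C : Type u} [Category.{v} C] [MonoidalCategory C] [BraidedCategory C]
variable {B₁ B₂ : C} (h : HopfDatumCore B₁ B₂)

/-- The interpretation of the boxes. -/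
def interp : Interp Factor Box C where
  obj
    | .x => B₁
    | .y => B₂
  box
    | .mul₁ => h.mul₁
    | .one₁ => h.one₁
    | .comul₂ => h.comul₂
    | .counit₂ => h.counit₂
    | .comul₁ => h.comul₁
    | .counit₁ => h.counit₁
    | .mul₂ => h.mul₂
    | .one₂ => h.one₂
    | .actL => h.actL
    | .actR => h.actR
    | .coactL => h.coactL
    | .coactR => h.coactR
    | .cyc => h.cyc
    | .coc => h.coc

instance flat_x : Flat (interp h) B₁ .one := Flat.obj (interp h) .x
instance flat_y : Flat (interp h) B₂ .one := Flat.obj (interp h) .y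

instance drawn_mul₁ : Drawn (interp h) h.mul₁ [(0, .box .mul₁)] :=
  drawn_two_one (interp h) (.box .mul₁) .x .x .x _ rfl

instance drawn_one₁ : Drawn (interp h) h.one₁ [(0, .box .one₁)] :=
  drawn_zero_one (interp h) (.box .one₁) .x _ rfl

instance drawn_comul₂ : Drawn (interp h) h.comul₂ [(0, .box .comul₂)] :=
  drawn_one_two (interp h) (.box .comul₂) .y .y .y _ rfl

instance drawn_counit₂ : Drawn (interp h) h.counit₂ [(0, .box .counit₂)] :=
  drawn_one_zero (interp h) (.box .counit₂) .y _ rfl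

instance drawn_comul₁ : Drawn (interp h) h.comul₁ [(0, .box .comul₁)] :=
  drawn_one_two (interp h) (.box .comul₁) .x .x .x _ rfl

instance drawn_counit₁ : Drawn (interp h) h.counit₁ [(0, .box .counit₁)] :=
  drawn_one_zero (interp h) (.box .counit₁) .x _ rfl

instance drawn_mul₂ : Drawn (interp h) h.mul₂ [(0, .box .mul₂)] :=
  drawn_two_one (interp h) (.box .mul₂) .y .y .y _ rfl

instance drawn_one₂ : Drawn (interp h) h.one₂ [(0, .box .one₂)] :=
  drawn_zero_one (interp h) (.box .one₂) .y _ rfl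

instance drawn_actL : Drawn (interp h) h.actL [(0, .box .actL)] :=
  drawn_two_one (interp h) (.box .actL) .y .x .x _ rfl

instance drawn_actR : Drawn (interp h) h.actR [(0, .box .actR)] :=
  drawn_two_one (interp h) (.box .actR) .y .x .y _ rfl

instance drawn_coactL : Drawn (interp h) h.coactL [(0, .box .coactL)] :=
  drawn_one_two (interp h) (.box .coactL) .y .x .x _ rfl

instance drawn_coactR : Drawn (interp h) h.coactR [(0, .box .coactR)] :=
  drawn_one_two (interp h) (.box .coactR) .y .x .y _ rfl

instance drawn_cyc : Drawn (interp h) h.cyc [(0, .box .cyc)] :=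
  drawn_one_two (interp h) (.box .cyc) .x .x .y _ rfl

instance drawn_coc : Drawn (interp h) h.coc [(0, .box .coc)] :=
  drawn_two_one (interp h) (.box .coc) .y .y .x _ rfl

instance braid_xx : Drawn (interp h) (β_ B₁ B₁).hom [(0, .braid true .x .x)] :=
  drawn_braiding (interp h) .x .x

instance braid_xy : Drawn (interp h) (β_ B₁ B₂).hom [(0, .braid true .x .y)] :=
  drawn_braiding (interp h) .x .y

instance braid_yx : Drawn (interp h) (β_ B₂ B₁).hom [(0, .braid true .y .x)] :=
  drawn_braiding (interp h) .y .x

instance braid_yy : Drawn (interp h) (β_ B₂ B₂).hom [(0, .braid true .y .y)] :=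
  drawn_braiding (interp h) .y .y

/-- A box or a braiding together with the number of strands to its left. -/
abbrev Layer := ℕ × Gate Factor Box

def mul₁ (k : ℕ) : Layer := (k, .box .mul₁)
def one₁ (k : ℕ) : Layer := (k, .box .one₁)
def comul₂ (k : ℕ) : Layer := (k, .box .comul₂)
def counit₂ (k : ℕ) : Layer := (k, .box .counit₂)
def comul₁ (k : ℕ) : Layer := (k, .box .comul₁)
def counit₁ (k : ℕ) : Layer := (k, .box .counit₁)
def mul₂ (k : ℕ) : Layer := (k, .box .mul₂)
def one₂ (k : ℕ) : Layer := (k, .box .one₂)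
def actL (k : ℕ) : Layer := (k, .box .actL)
def actR (k : ℕ) : Layer := (k, .box .actR)
def coactL (k : ℕ) : Layer := (k, .box .coactL)
def coactR (k : ℕ) : Layer := (k, .box .coactR)
def cyc (k : ℕ) : Layer := (k, .box .cyc)
def coc (k : ℕ) : Layer := (k, .box .coc)
def braid (s t : Factor) (k : ℕ) : Layer := (k, .braid true s t)

namespace Law

/-! Names of the rewriting rules in `unitalRules`. -/

def one_mul₁ : Ref Factor := .thm 0
def mul_one₁ : Ref Factor := .thm 1
def counit_comul₂ : Ref Factor := .thm 2
def comul_counit₂ : Ref Factor := .thm 3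
def one₁_counit₁ : Ref Factor := .thm 4
def mul₁_counit₁ : Ref Factor := .thm 5
def one₂_counit₂ : Ref Factor := .thm 6
def one₂_comul₂ : Ref Factor := .thm 7
def coactL_counit₂ : Ref Factor := .thm 8
def one₁_actR : Ref Factor := .thm 9
def one₁_comul₁ : Ref Factor := .thm 10
def comul₁_counit₁ : Ref Factor := .thm 11
def counit₁_comul₁ : Ref Factor := .thm 12
def mul₂_counit₂ : Ref Factor := .thm 13
def mul₂_one₂ : Ref Factor := .thm 14
def one₂_mul₂ : Ref Factor := .thm 15
def one₂_actR : Ref Factor := .thm 16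
def actR_counit₂ : Ref Factor := .thm 17
def coactL_counit₁ : Ref Factor := .thm 18
def one₁_coactL : Ref Factor := .thm 19
def one₂_actL : Ref Factor := .thm 20
def one₁_actL : Ref Factor := .thm 21
def actL_counit₁ : Ref Factor := .thm 22
def coactR_counit₁ : Ref Factor := .thm 23
def coactR_counit₂ : Ref Factor := .thm 24
def one₂_coactR : Ref Factor := .thm 25
def one₂_coc : Ref Factor := .thm 26
def coc_one₂ : Ref Factor := .thm 27
def coc_counit₁ : Ref Factor := .thm 28
def cyc_counit₁ : Ref Factor := .thm 29
def counit₁_cyc : Ref Factor := .thm 30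
def one₂_cyc : Ref Factor := .thm 31

end Law

open Law

/-- The unital and counital identities of a Hopf datum. -/
def unitalRules : List (Rule Factor Box) :=
  [ ⟨[.x], [one₁ 0, mul₁ 0], []⟩,
    ⟨[.x], [one₁ 1, mul₁ 0], []⟩,
    ⟨[.y], [comul₂ 0, counit₂ 0], []⟩,
    ⟨[.y], [comul₂ 0, counit₂ 1], []⟩,
    ⟨[], [one₁ 0, counit₁ 0], []⟩,
    ⟨[.x, .x], [mul₁ 0, counit₁ 0], [counit₁ 0, counit₁ 0]⟩,
    ⟨[], [one₂ 0, counit₂ 0], []⟩,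
    ⟨[], [one₂ 0, comul₂ 0], [one₂ 0, one₂ 1]⟩,
    ⟨[.x], [coactL 0, counit₂ 0], []⟩,
    ⟨[.y], [one₁ 1, actR 0], []⟩,
    ⟨[], [one₁ 0, comul₁ 0], [one₁ 0, one₁ 1]⟩,
    ⟨[.x], [comul₁ 0, counit₁ 1], []⟩,
    ⟨[.x], [comul₁ 0, counit₁ 0], []⟩,
    ⟨[.y, .y], [mul₂ 0, counit₂ 0], [counit₂ 0, counit₂ 0]⟩,
    ⟨[.y], [one₂ 1, mul₂ 0], []⟩,
    ⟨[.y], [one₂ 0, mul₂ 0], []⟩,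
    ⟨[.x], [one₂ 0, actR 0], [counit₁ 0, one₂ 0]⟩,
    ⟨[.y, .x], [actR 0, counit₂ 0], [counit₂ 0, counit₁ 0]⟩,
    ⟨[.x], [coactL 0, counit₁ 1], [counit₁ 0, one₂ 0]⟩,
    ⟨[], [one₁ 0, coactL 0], [one₂ 0, one₁ 1]⟩,
    ⟨[.x], [one₂ 0, actL 0], []⟩,
    ⟨[.y], [one₁ 1, actL 0], [counit₂ 0, one₁ 0]⟩,
    ⟨[.y, .x], [actL 0, counit₁ 0], [counit₂ 0, counit₁ 0]⟩,
    ⟨[.y], [coactR 0, counit₁ 1], []⟩,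
    ⟨[.y], [coactR 0, counit₂ 0], [counit₂ 0, one₁ 0]⟩,
    ⟨[], [one₂ 0, coactR 0], [one₂ 0, one₁ 1]⟩,
    ⟨[.y], [one₂ 0, coc 0], [counit₂ 0, one₁ 0]⟩,
    ⟨[.y], [one₂ 1, coc 0], [counit₂ 0, one₁ 0]⟩,
    ⟨[.y, .y], [coc 0, counit₁ 0], [counit₂ 0, counit₂ 0]⟩,
    ⟨[.y], [cyc 0, counit₁ 1], [counit₂ 0, one₁ 0]⟩,
    ⟨[.y], [cyc 0, counit₁ 0], [counit₂ 0, one₁ 0]⟩,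
    ⟨[], [one₂ 0, cyc 0], [one₁ 0, one₁ 1]⟩ ]

variable {h}

lemma unitalRules_hold (A : h.IsHopfDatum) : AllHold (interp h) unitalRules := by
  have h₁ : (λ_ B₁).inv ≫ h.one₁ ▷ B₁ ≫ h.mul₁ = 𝟙 B₁ := by
    rw [h.alg₁.one_mul, Iso.inv_hom_id]
  have h₂ : (ρ_ B₁).inv ≫ B₁ ◁ h.one₁ ≫ h.mul₁ = 𝟙 B₁ := by
    rw [h.alg₁.mul_one, Iso.inv_hom_id]
  have h₃ : h.comul₂ ≫ h.counit₂ ▷ B₂ ≫ (λ_ B₂).hom = 𝟙 B₂ := by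
    rw [← Category.assoc, h.coalg₂.counit_comul, Iso.inv_hom_id]
  have h₄ : h.comul₂ ≫ B₂ ◁ h.counit₂ ≫ (ρ_ B₂).hom = 𝟙 B₂ := by
    rw [← Category.assoc, h.coalg₂.comul_counit, Iso.inv_hom_id]
  exact .cons_of_eq h₁ <| .cons_of_eq h₂ <| .cons_of_eq h₃ <| .cons_of_eq h₄ <|
    .cons_of_eq A.one₁_counit₁ <|
    .cons_of_eq A.mul₁_counit₁ <|
    .cons_of_eq A.one₂_counit₂ <|
    .cons_of_eq A.one₂_comul₂ <|
    .cons_of_eq A.coactL_counit₂ <|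
    .cons_of_eq A.one₁_actR <|
    .cons_of_eq A.one₁_comul₁ <|
    .cons_of_eq A.comul₁_counit₁ <|
    .cons_of_eq A.counit₁_comul₁ <|
    .cons_of_eq A.mul₂_counit₂ <|
    .cons_of_eq A.mul₂_one₂ <|
    .cons_of_eq A.one₂_mul₂ <|
    .cons_of_eq A.one₂_actR <|
    .cons_of_eq A.actR_counit₂ <|
    .cons_of_eq A.coactL_counit₁ <|
    .cons_of_eq A.one₁_coactL <|
    .cons_of_eq A.one₂_actL <|
    .cons_of_eq A.one₁_actL <|
    .cons_of_eq A.actL_counit₁ <|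
    .cons_of_eq A.coactR_counit₁ <|
    .cons_of_eq A.coactR_counit₂ <|
    .cons_of_eq A.one₂_coactR <|
    .cons_of_eq A.one₂_coc <|
    .cons_of_eq A.coc_one₂ <|
    .cons_of_eq A.coc_counit₁ <|
    .cons_of_eq A.cyc_counit₁ <|
    .cons_of_eq A.counit₁_cyc <|
    .cons_of_eq A.one₂_cyc .nil

end Crossed

-- Restrictions of the cross product structure to the two factors.

namespace HopfDatumCore

open Crossed Crossed.Law

variable {C : Type u} [Category.{v} C] [MonoidalCategory C] [BraidedCategory C]
variable {B₁ B₂ : C} (h : HopfDatumCore B₁ B₂)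

/-- `id ⊗ η₂` -/
def inl : B₁ ⟶ B₁ ⊗ B₂ := (ρ_ B₁).inv ≫ (𝟙 B₁ ⊗ₘ h.one₂)

/-- `η₁ ⊗ id` -/
def inr : B₂ ⟶ B₁ ⊗ B₂ := (λ_ B₂).inv ≫ (h.one₁ ⊗ₘ 𝟙 B₂)

/-- `id ⊗ ε₂` -/
def fst : B₁ ⊗ B₂ ⟶ B₁ := (𝟙 B₁ ⊗ₘ h.counit₂) ≫ (ρ_ B₁).hom

/-- `ε₁ ⊗ id` -/
def snd : B₁ ⊗ B₂ ⟶ B₂ := (h.counit₁ ⊗ₘ 𝟙 B₂) ≫ (λ_ B₂).hom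

variable {h}

set_option synthInstance.maxSize 1000
set_option synthInstance.maxHeartbeats 200000

lemma inl_inl_crossMul (A : h.IsHopfDatum) :
    (h.inl ⊗ₘ h.inl) ≫ h.crossMul = h.mul₁ ≫ h.inl := by
  unfold crossMul phi21 sigmaHat inl
  exact (unitalRules_hold A).eq_of_check [.x, .x] [
      .rw one₂_comul₂ [0, 1], .rw one₂_comul₂ [8, 9], .rw mul₂_one₂ [14, 15],
      .rw one₂_actL [0, 4], .rw one₂_coactR [6, 7], .rw one₁_actR [10, 11],
      .rw (.natR true .x) [0, 2], .rw one₂_actR [2, 3], .rw one₂_comul₂ [2, 3],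
      .rw comul₁_counit₁ [0, 8], .rw one₂_coc [1, 5], .rw mul_one₁ [1, 2],
      .rw (.natR true .y) [1, 3], .rw one₂_counit₂ [1, 2]]

/-- This product formula is what will force Λ = m(i₁ ⊗ i₂). In φ₂,₁ and σ̂ the units turn actions
and cocycle into identities and counits. -/
lemma inl_inr_crossMul (A : h.IsHopfDatum) :
    (h.inl ⊗ₘ h.inr) ≫ h.crossMul = 𝟙 (B₁ ⊗ B₂) := by
  unfold crossMul phi21 sigmaHat inl inr
  exact (unitalRules_hold A).eq_of_check [.x, .y] [
      .rw one₂_comul₂ [0, 1], .rw one₁_comul₁ [2, 3], .rw one₁_actR [6, 7], .rw one₂_actL [0, 4],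
      .rw (.natL true .y) [1, 2], .rw mul_one₁ [0, 1], .rw one₂_comul₂ [0, 1],
      .rw one₂_coc [0, 5], .rw mul_one₁ [0, 1], .rw (.natR true .y) [0, 3], .rw one₂_actR [3, 4],
      .rw one₂_mul₂ [0, 5], .rw coactR_counit₁ [1, 3], .rw counit_comul₂ [0, 1]]

/-- This and the next three lemmas read the cocycle, m₂ and the two actions off the cross
multiplication; together they make the datum recoverable. -/
lemma inr_inr_crossMul_fst (A : h.IsHopfDatum) :
    (h.inr ⊗ₘ h.inr) ≫ h.crossMul ≫ h.fst = h.coc := by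
  unfold crossMul phi21 sigmaHat inr fst
  exact (unitalRules_hold A).eq_of_check [.y, .y] [
      .rw one_mul₁ [0, 6], .rw one₁_comul₁ [1, 2], .rw one₁_actR [4, 5],
      .rw mul₂_counit₂ [11, 12], .rw comul_counit₂ [5, 12], .rw actR_counit₂ [9, 10],
      .rw coactR_counit₁ [5, 10], .rw (.natL true .y) [1, 2], .rw one₁_actL [1, 2],
      .rw one_mul₁ [0, 6], .rw counit_comul₂ [0, 1], .wr (.natR true .y) [1, 3],
      .rw comul_counit₂ [0, 1]]

lemma inr_inr_crossMul_snd (A : h.IsHopfDatum) :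
    (h.inr ⊗ₘ h.inr) ≫ h.crossMul ≫ h.snd = h.mul₂ := by
  unfold crossMul phi21 sigmaHat inr snd
  exact (unitalRules_hold A).eq_of_check [.y, .y] [
      .rw one_mul₁ [0, 6], .rw mul₁_counit₁ [11, 12], .rw one₁_comul₁ [1, 2],
      .rw one₁_actR [5, 6], .rw actL_counit₁ [3, 4], .rw counit_comul₂ [0, 1],
      .rw coc_counit₁ [7, 8], .rw counit_comul₂ [3, 4], .rw (.natL true .y) [0, 1],
      .rw one₁_counit₁ [0, 1], .wr (.natL true .y) [2, 3], .rw coactR_counit₂ [1, 2],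
      .rw counit_comul₂ [2, 3], .rw one₁_actR [0, 1]]

lemma inr_inl_crossMul_fst (A : h.IsHopfDatum) :
    (h.inr ⊗ₘ h.inl) ≫ h.crossMul ≫ h.fst = h.actL := by
  unfold crossMul phi21 sigmaHat inl inr fst
  exact (unitalRules_hold A).eq_of_check [.y, .x] [
      .rw one_mul₁ [0, 5], .rw one₂_comul₂ [6, 7], .rw mul₂_counit₂ [13, 14],
      .rw one₂_counit₂ [13, 14], .rw actR_counit₂ [11, 12], .rw coactR_counit₁ [7, 12],
      .rw (.natL true .y) [6, 7], .rw comul_counit₂ [5, 9], .rw coc_one₂ [5, 6],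
      .rw mul_one₁ [4, 5], .rw actR_counit₂ [4, 5], .rw comul₁_counit₁ [1, 5],
      .wr (.natR true .x) [1, 3], .rw comul_counit₂ [0, 1]]

lemma inr_inl_crossMul_snd (A : h.IsHopfDatum) :
    (h.inr ⊗ₘ h.inl) ≫ h.crossMul ≫ h.snd = h.actR := by
  unfold crossMul phi21 sigmaHat inl inr snd
  exact (unitalRules_hold A).eq_of_check [.y, .x] [
      .rw one_mul₁ [0, 5], .rw mul₁_counit₁ [11, 12], .rw one₂_comul₂ [7, 8],
      .rw mul₂_one₂ [13, 14], .rw actL_counit₁ [3, 4], .rw counit_comul₂ [0, 1],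
      .rw one₂_coactR [5, 6], .rw one₁_actR [9, 10], .rw coc_counit₁ [7, 8],
      .rw counit_comul₂ [4, 5], .rw (.natL true .y) [4, 5], .rw one₂_counit₂ [0, 1],
      .wr (.natL true .y) [1, 2], .rw counit₁_comul₁ [0, 1]]

lemma crossComul_snd_snd (A : h.IsHopfDatum) :
    h.crossComul ≫ (h.snd ⊗ₘ h.snd) = h.snd ≫ h.comul₂ := by
  unfold crossComul phi12 rhoHat snd
  exact (unitalRules_hold A).eq_of_check [.x, .y] [
      .rw mul₁_counit₁ [6, 7], .rw mul₁_counit₁ [14, 15], .rw counit₁_comul₁ [0, 1],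
      .rw actL_counit₁ [4, 5], .rw coactL_counit₂ [0, 1], .rw coactR_counit₁ [7, 11],
      .wr (.natL true .x) [2, 3], .rw counit₁_cyc [1, 2], .rw mul_one₁ [0, 1],
      .rw counit_comul₂ [1, 2], .wr (.natR true .y) [2, 4], .rw coactL_counit₁ [0, 1],
      .rw one₂_mul₂ [0, 3]]

lemma crossComul_fst_snd (A : h.IsHopfDatum) :
    h.crossComul ≫ (h.fst ⊗ₘ h.snd) = 𝟙 (B₁ ⊗ B₂) := by
  unfold crossComul phi12 rhoHat fst snd
  exact (unitalRules_hold A).eq_of_check [.x, .y] [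
      .rw mul₁_counit₁ [14, 15], .rw mul₂_counit₂ [12, 13], .rw coactL_counit₂ [8, 9],
      .rw coactR_counit₁ [9, 13], .wr (.natR true .y) [9, 11], .rw counit_comul₂ [9, 10],
      .rw mul₁_counit₁ [7, 8], .rw cyc_counit₁ [3, 8], .rw counit_comul₂ [7, 8],
      .rw (.natL true .x) [2, 3], .rw coactL_counit₁ [1, 5], .rw comul₁_counit₁ [0, 5],
      .rw one₂_actL [0, 2], .rw mul_one₁ [0, 1]]

/-- This and the next three lemmas are the dual readings, of Δ₁, the two coactions and the cycle,
off the cross comultiplication. -/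
lemma inl_crossComul_fst_fst (A : h.IsHopfDatum) :
    h.inl ≫ h.crossComul ≫ (h.fst ⊗ₘ h.fst) = h.comul₁ := by
  unfold crossComul phi12 rhoHat inl fst
  exact (unitalRules_hold A).eq_of_check [.x] [
      .rw comul_counit₂ [10, 16], .rw one₂_comul₂ [2, 3], .rw mul₂_counit₂ [12, 13],
      .rw coactL_counit₂ [8, 9], .rw one₂_coactR [8, 9], .rw mul_one₁ [11, 12],
      .rw one₂_cyc [2, 3], .rw mul_one₁ [6, 7], .rw (.natL true .x) [2, 3], .rw one₁_actL [2, 3],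
      .rw mul_one₁ [1, 2], .rw coactL_counit₂ [1, 2], .rw (.natL true .x) [1, 2],
      .rw one₂_counit₂ [1, 2]]

lemma inl_crossComul_snd_fst (A : h.IsHopfDatum) :
    h.inl ≫ h.crossComul ≫ (h.snd ⊗ₘ h.fst) = h.coactL := by
  unfold crossComul phi12 rhoHat inl fst snd
  exact (unitalRules_hold A).eq_of_check [.x] [
      .rw comul_counit₂ [11, 16], .rw mul₁_counit₁ [7, 8], .rw one₂_comul₂ [3, 4],
      .rw counit₁_comul₁ [0, 1], .rw actL_counit₁ [4, 5], .rw coactL_counit₂ [0, 1],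
      .rw one₂_coactR [6, 7], .rw mul_one₁ [9, 10], .rw one₂_cyc [0, 1], .rw mul_one₁ [3, 4],
      .rw (.natL true .x) [0, 1], .rw one₁_counit₁ [0, 1], .rw (.natL true .x) [1, 2],
      .rw mul₂_one₂ [1, 2]]

lemma inr_crossComul_fst_fst (A : h.IsHopfDatum) :
    h.inr ≫ h.crossComul ≫ (h.fst ⊗ₘ h.fst) = h.cyc := by
  unfold crossComul phi12 rhoHat inr fst
  exact (unitalRules_hold A).eq_of_check [.y] [
      .rw comul_counit₂ [10, 16], .rw one₁_comul₁ [0, 1], .rw one_mul₁ [0, 7],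
      .rw mul₂_counit₂ [10, 11], .rw coactL_counit₂ [7, 8], .rw one₁_coactL [0, 1],
      .rw one₂_actL [0, 5], .rw (.natR true .x) [0, 3], .rw one_mul₁ [2, 3],
      .wr (.natL true .x) [3, 4], .rw coactR_counit₂ [2, 3], .rw mul_one₁ [2, 3],
      .rw comul_counit₂ [0, 2]]

lemma inr_crossComul_snd_fst (A : h.IsHopfDatum) :
    h.inr ≫ h.crossComul ≫ (h.snd ⊗ₘ h.fst) = h.coactR := by
  unfold crossComul phi12 rhoHat inr fst snd
  exact (unitalRules_hold A).eq_of_check [.y] [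
      .rw comul_counit₂ [11, 16], .rw mul₁_counit₁ [7, 8], .rw one₁_comul₁ [0, 1],
      .rw one₁_counit₁ [0, 1], .rw one₁_coactL [0, 1], .rw one₂_actL [0, 5],
      .rw (.natR true .x) [0, 3], .rw one_mul₁ [3, 4], .rw counit₁_cyc [1, 2],
      .rw counit_comul₂ [2, 3], .rw one₁_coactL [0, 1], .rw one₂_mul₂ [0, 4],
      .rw (.natR true .y) [0, 2], .rw one_mul₁ [1, 2]]

lemma one₁_inl (A : h.IsHopfDatum) :
    h.one₁ ≫ h.inl = h.crossOne := by
  unfold crossOne inl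
  exact (unitalRules_hold A).eq_of_check [] []

lemma crossOne_fst (A : h.IsHopfDatum) :
    h.crossOne ≫ h.fst = h.one₁ := by
  unfold crossOne fst
  exact (unitalRules_hold A).eq_of_check [] [
      .rw one₂_counit₂ [1, 2]]

lemma crossOne_snd (A : h.IsHopfDatum) :
    h.crossOne ≫ h.snd = h.one₂ := by
  unfold crossOne snd
  exact (unitalRules_hold A).eq_of_check [] [
      .rw one₁_counit₁ [0, 1]]

lemma snd_counit₂ (A : h.IsHopfDatum) :
    h.snd ≫ h.counit₂ = h.crossCounit := by
  unfold crossCounit snd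
  exact (unitalRules_hold A).eq_of_check [.x, .y] []

lemma inl_crossCounit (A : h.IsHopfDatum) :
    h.inl ≫ h.crossCounit = h.counit₁ := by
  unfold crossCounit inl
  exact (unitalRules_hold A).eq_of_check [.x] [
      .rw one₂_counit₂ [1, 2]]

lemma inr_crossCounit (A : h.IsHopfDatum) :
    h.inr ≫ h.crossCounit = h.counit₂ := by
  unfold crossCounit inr
  exact (unitalRules_hold A).eq_of_check [.y] [
      .rw one₁_counit₁ [0, 1]]

lemma inl_fst (A : h.IsHopfDatum) :
    h.inl ≫ h.fst = 𝟙 B₁ := by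
  unfold inl fst
  exact (unitalRules_hold A).eq_of_check [.x] [
      .rw one₂_counit₂ [0, 1]]

lemma inr_snd (A : h.IsHopfDatum) :
    h.inr ≫ h.snd = 𝟙 B₂ := by
  unfold inr snd
  exact (unitalRules_hold A).eq_of_check [.y] [
      .rw one₁_counit₁ [0, 1]]

end HopfDatumCore

end CrossProduct

-- Recovering the Hopf datum from the cross product.

namespace CrossProduct

open scoped MonObj ComonObj

namespace HopfDatumCore

section

variable {C : Type u} [Category.{v} C] [MonoidalCategory C]
variable {B : C} {B₁ B₂ : C} {i₁ : B₁ ⟶ B} {p₁ : B ⟶ B₁} {i₂ : B₂ ⟶ B} {p₂ : B ⟶ B₂}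
variable {h : HopfDatumCore B₁ B₂} {e : B₁ ⊗ B₂ ≅ B}

lemma Induces.inj₁ (I : h.Induces B e i₁ p₁ i₂ p₂) : i₁ = h.inl ≫ e.hom := by
  rw [I.inj₁_eq, inl, Category.assoc]

lemma Induces.inj₂ (I : h.Induces B e i₁ p₁ i₂ p₂) : i₂ = h.inr ≫ e.hom := by
  rw [I.inj₂_eq, inr, Category.assoc]

lemma Induces.proj₁ (I : h.Induces B e i₁ p₁ i₂ p₂) : p₁ = e.inv ≫ h.fst := I.proj₁_eq

lemma Induces.proj₂ (I : h.Induces B e i₁ p₁ i₂ p₂) : p₂ = e.inv ≫ h.snd := I.proj₂_eq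

lemma ext {h h' : HopfDatumCore B₁ B₂} (mul₁ : h.mul₁ = h'.mul₁) (one₁ : h.one₁ = h'.one₁)
    (comul₂ : h.comul₂ = h'.comul₂) (counit₂ : h.counit₂ = h'.counit₂)
    (comul₁ : h.comul₁ = h'.comul₁) (counit₁ : h.counit₁ = h'.counit₁) (mul₂ : h.mul₂ = h'.mul₂)
    (one₂ : h.one₂ = h'.one₂) (actL : h.actL = h'.actL) (actR : h.actR = h'.actR)
    (coactL : h.coactL = h'.coactL) (coactR : h.coactR = h'.coactR) (cyc : h.cyc = h'.cyc)
    (coc : h.coc = h'.coc) : h = h' := by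
  obtain ⟨⟨⟩, ⟨⟩⟩ := h
  obtain ⟨⟨⟩, ⟨⟩⟩ := h'
  dsimp only [HopfDatumCore.mul₁, HopfDatumCore.one₁, HopfDatumCore.comul₂,
    HopfDatumCore.counit₂] at *
  subst_vars
  rfl

end

variable {C : Type u} [Category.{v} C] [MonoidalCategory C] [BraidedCategory C]
variable {B : C} [BimonObj B] {B₁ B₂ : C} {i₁ : B₁ ⟶ B} {p₁ : B ⟶ B₁} {i₂ : B₂ ⟶ B} {p₂ : B ⟶ B₂}
variable {h : HopfDatumCore B₁ B₂} {e : B₁ ⊗ B₂ ≅ B}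

/-- Arbitrary maps before and after let the multiplication of B be exchanged for the cross
multiplication in place, wherever injections and projections surround it. -/
lemma IsBialgebraIso.mul_eq (E : h.IsBialgebraIso B e) {X Y Z : C} (f : X ⟶ B₁ ⊗ B₂)
    (g : Y ⟶ B₁ ⊗ B₂) (k : B ⟶ Z) :
    ((f ≫ e.hom) ⊗ₘ (g ≫ e.hom)) ≫ μ[B] ≫ k = (f ⊗ₘ g) ≫ h.crossMul ≫ e.hom ≫ k := by
  obtain ⟨S, A, M⟩ := E
  have hm := IsMonHom.mul_hom e.hom
  rw [← A.mul_eq, ← tensorHom_comp_tensorHom, Category.assoc, ← reassoc_of% hm]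

lemma IsBialgebraIso.comul_eq (E : h.IsBialgebraIso B e) {X Y Z : C} (f : B₁ ⊗ B₂ ⟶ X)
    (g : B₁ ⊗ B₂ ⟶ Y) (k : Z ⟶ B) :
    k ≫ Δ[B] ≫ ((e.inv ≫ f) ⊗ₘ (e.inv ≫ g)) = k ≫ e.inv ≫ h.crossComul ≫ (f ⊗ₘ g) := by
  obtain ⟨S, A, M⟩ := E
  have hc := IsComonHom.hom_comul e.hom
  have hc' : Δ[B] = e.inv ≫ Δ[B₁ ⊗ B₂] ≫ (e.hom ⊗ₘ e.hom) := by rw [← hc, e.inv_hom_id_assoc]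
  rw [← A.comul_eq, hc']
  simp only [Category.assoc, tensorHom_comp_tensorHom, e.hom_inv_id_assoc]

lemma IsBialgebraIso.one_eq (E : h.IsBialgebraIso B e) : η[B] = h.crossOne ≫ e.hom := by
  obtain ⟨S, A, M⟩ := E
  rw [← A.one_eq, IsMonHom.one_hom e.hom]

lemma IsBialgebraIso.counit_eq (E : h.IsBialgebraIso B e) : ε[B] = e.inv ≫ h.crossCounit := by
  obtain ⟨S, A, M⟩ := E
  rw [← A.counit_eq, ← IsComonHom.hom_counit e.hom, e.inv_hom_id_assoc]

/-- The injections determine the isomorphism, which is the uniqueness of Λ. -/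
lemma Induces.hom_eq (A : h.IsHopfDatum) (E : h.IsBialgebraIso B e)
    (I : h.Induces B e i₁ p₁ i₂ p₂) : (i₁ ⊗ₘ i₂) ≫ μ[B] = e.hom := by
  have hm := E.mul_eq h.inl h.inr (𝟙 B)
  rw [Category.comp_id, Category.comp_id, reassoc_of% inl_inr_crossMul A] at hm
  rw [I.inj₁, I.inj₂, hm]

lemma Induces.inv_eq (A : h.IsHopfDatum) (E : h.IsBialgebraIso B e)
    (I : h.Induces B e i₁ p₁ i₂ p₂) : Δ[B] ≫ (p₁ ⊗ₘ p₂) = e.inv := by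
  have hc := E.comul_eq h.fst h.snd (𝟙 B)
  rw [Category.id_comp, Category.id_comp, crossComul_fst_snd A, Category.comp_id] at hc
  rw [I.proj₁, I.proj₂, hc]

/-- Only the unit and counit identities of the datum are involved, through the restrictions computed
above; the strong identities play no role. -/
theorem Induces.isSplitPair (A : h.IsHopfDatum) (E : h.IsBialgebraIso B e)
    (I : h.Induces B e i₁ p₁ i₂ p₂) : IsSplitPair B i₁ p₁ i₂ p₂ where
  retract₁ := by
    rw [I.inj₁, I.proj₁, Category.assoc, e.hom_inv_id_assoc, inl_fst A]
  retract₂ := by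
    rw [I.inj₂, I.proj₂, Category.assoc, e.hom_inv_id_assoc, inr_snd A]
  inj₁_mul := by
    have h₁ := E.mul_eq h.inl h.inl (p₁ ≫ i₁)
    have h₂ := E.mul_eq h.inl h.inl (𝟙 B)
    rw [← I.inj₁, reassoc_of% inl_inl_crossMul A] at h₁ h₂
    rw [Category.comp_id, Category.comp_id] at h₂
    rw [h₁, h₂, I.proj₁, I.inj₁, Category.assoc, e.hom_inv_id_assoc, reassoc_of% inl_fst A]
  one_idem₁ := by
    rw [E.one_eq, I.proj₁, I.inj₁]
    simp only [Category.assoc, e.hom_inv_id_assoc, reassoc_of% crossOne_fst A,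
      reassoc_of% one₁_inl A]
  comul_proj₂ := by
    have h₁ := E.comul_eq h.snd h.snd (p₂ ≫ i₂)
    have h₂ := E.comul_eq h.snd h.snd (𝟙 B)
    rw [← I.proj₂, crossComul_snd_snd A] at h₁ h₂
    rw [Category.id_comp, Category.id_comp] at h₂
    rw [← Category.assoc, ← Category.assoc, Category.assoc (p₂ ≫ i₂), h₁, h₂, I.inj₂, I.proj₂]
    simp only [Category.assoc, e.hom_inv_id_assoc, reassoc_of% inr_snd A]
  idem₂_counit := by
    rw [E.counit_eq, I.proj₂, I.inj₂]
    simp only [Category.assoc, e.hom_inv_id_assoc, inr_crossCounit A, snd_counit₂ A]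
  inv₁ := by rw [I.hom_eq A E, I.inv_eq A E, e.hom_inv_id]
  inv₂ := by rw [I.hom_eq A E, I.inv_eq A E, e.inv_hom_id]

/-- A Hopf datum is determined by the injections and projections of its cross product. -/
theorem Induces.eq_datum (A : h.IsHopfDatum) (E : h.IsBialgebraIso B e)
    (I : h.Induces B e i₁ p₁ i₂ p₂) : h = Splitting.datum (I.isSplitPair A E) := by
  -- The isomorphism cancels between injections and projections, so that each component of the datum
  -- becomes one of the computed restrictions of the cross product.
  have mul {X Y Z : C} (f : X ⟶ B₁ ⊗ B₂) (g : Y ⟶ B₁ ⊗ B₂) (k : B₁ ⊗ B₂ ⟶ Z) :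
      ((f ≫ e.hom) ⊗ₘ (g ≫ e.hom)) ≫ μ[B] ≫ e.inv ≫ k = (f ⊗ₘ g) ≫ h.crossMul ≫ k := by
    rw [E.mul_eq, e.hom_inv_id_assoc]
  have comul {X Y Z : C} (k : Z ⟶ B₁ ⊗ B₂) (f : B₁ ⊗ B₂ ⟶ X) (g : B₁ ⊗ B₂ ⟶ Y) :
      (k ≫ e.hom) ≫ Δ[B] ≫ ((e.inv ≫ f) ⊗ₘ (e.inv ≫ g)) = k ≫ h.crossComul ≫ (f ⊗ₘ g) := by
    rw [E.comul_eq, Category.assoc, e.hom_inv_id_assoc]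
  have one {X : C} (f : B₁ ⊗ B₂ ⟶ X) : η[B] ≫ e.inv ≫ f = h.crossOne ≫ f := by
    rw [E.one_eq, Category.assoc, e.hom_inv_id_assoc]
  have counit {X : C} (f : X ⟶ B₁ ⊗ B₂) : (f ≫ e.hom) ≫ ε[B] = f ≫ h.crossCounit := by
    rw [E.counit_eq, Category.assoc, e.hom_inv_id_assoc]
  apply HopfDatumCore.ext
  · change h.mul₁ = (i₁ ⊗ₘ i₁) ≫ μ[B] ≫ p₁
    rw [I.inj₁, I.proj₁, mul, reassoc_of% inl_inl_crossMul A, inl_fst A, Category.comp_id]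
  · change h.one₁ = η[B] ≫ p₁
    rw [I.proj₁, one, crossOne_fst A]
  · change h.comul₂ = i₂ ≫ Δ[B] ≫ (p₂ ⊗ₘ p₂)
    rw [I.inj₂, I.proj₂, comul, crossComul_snd_snd A, reassoc_of% inr_snd A]
  · change h.counit₂ = i₂ ≫ ε[B]
    rw [I.inj₂, counit, inr_crossCounit A]
  · change h.comul₁ = i₁ ≫ Δ[B] ≫ (p₁ ⊗ₘ p₁)
    rw [I.inj₁, I.proj₁, comul, inl_crossComul_fst_fst A]
  · change h.counit₁ = i₁ ≫ ε[B]
    rw [I.inj₁, counit, inl_crossCounit A]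
  · change h.mul₂ = (i₂ ⊗ₘ i₂) ≫ μ[B] ≫ p₂
    rw [I.inj₂, I.proj₂, mul, inr_inr_crossMul_snd A]
  · change h.one₂ = η[B] ≫ p₂
    rw [I.proj₂, one, crossOne_snd A]
  · change h.actL = (i₂ ⊗ₘ i₁) ≫ μ[B] ≫ p₁
    rw [I.inj₁, I.inj₂, I.proj₁, mul, inr_inl_crossMul_fst A]
  · change h.actR = (i₂ ⊗ₘ i₁) ≫ μ[B] ≫ p₂
    rw [I.inj₁, I.inj₂, I.proj₂, mul, inr_inl_crossMul_snd A]
  · change h.coactL = i₁ ≫ Δ[B] ≫ (p₂ ⊗ₘ p₁)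
    rw [I.inj₁, I.proj₁, I.proj₂, comul, inl_crossComul_snd_fst A]
  · change h.coactR = i₂ ≫ Δ[B] ≫ (p₂ ⊗ₘ p₁)
    rw [I.inj₂, I.proj₁, I.proj₂, comul, inr_crossComul_snd_fst A]
  · change h.cyc = i₂ ≫ Δ[B] ≫ (p₁ ⊗ₘ p₁)
    rw [I.inj₂, I.proj₁, comul, inr_crossComul_fst_fst A]
  · change h.coc = (i₂ ⊗ₘ i₂) ≫ μ[B] ≫ p₁
    rw [I.inj₂, I.proj₁, mul, inr_inr_crossMul_fst A]

end HopfDatumCore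

end CrossProduct

-- The equivalences.

namespace CrossProduct

section

variable {C : Type u} [Category.{v} C] [MonoidalCategory C] [BraidedCategory C]
variable {B : C} [BimonObj B] {B₁ B₂ : C} {i₁ : B₁ ⟶ B} {p₁ : B ⟶ B₁} {i₂ : B₂ ⟶ B} {p₂ : B ⟶ B₂}

lemma HopfDatumCore.IsStrongHopfDatum.isSplitPair {h : HopfDatumCore B₁ B₂} {e : B₁ ⊗ B₂ ≅ B}
    (A : h.IsStrongHopfDatum) (E : h.IsBialgebraIso B e) (I : h.Induces B e i₁ p₁ i₂ p₂) :
    IsSplitPair B i₁ p₁ i₂ p₂ ∧ IsStrongProjection B (p₁ ≫ i₁) (p₂ ≫ i₂) := by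
  have H := I.isSplitPair A.toIsHopfDatum E
  refine ⟨H, Splitting.isStrongProjection H ?_⟩
  -- The given datum is the one attached to its own pair, so its strong identities are the
  -- hypotheses of `isStrongProjection`.
  rwa [← I.eq_datum A.toIsHopfDatum E]

lemma IsSplitPair.existsUnique (H : IsSplitPair B i₁ p₁ i₂ p₂)
    (S : IsStrongProjection B (p₁ ≫ i₁) (p₂ ≫ i₂)) :
    ∃! x : HopfDatumCore B₁ B₂ × (B₁ ⊗ B₂ ≅ B),
      x.1.IsStrongHopfDatum ∧ x.1.IsBialgebraIso B x.2 ∧ x.1.Induces B x.2 i₁ p₁ i₂ p₂ := by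
  refine ⟨(Splitting.datum H, Splitting.iso H), ⟨Splitting.isStrongHopfDatum H S,
    Splitting.isBialgebraIso H S, Splitting.induces H⟩, ?_⟩
  rintro ⟨h, e⟩ ⟨A, E, I⟩
  exact Prod.ext (I.eq_datum A.toIsHopfDatum E)
    (Iso.ext (I.hom_eq A.toIsHopfDatum E).symm)

theorem tfae_of_pair (i₁ : B₁ ⟶ B) (p₁ : B ⟶ B₁) (i₂ : B₂ ⟶ B) (p₂ : B ⟶ B₂) :
    List.TFAE [
      ∃ (h : HopfDatumCore B₁ B₂) (e : B₁ ⊗ B₂ ≅ B),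
        h.IsStrongHopfDatum ∧ h.IsBialgebraIso B e ∧ h.Induces B e i₁ p₁ i₂ p₂,
      ∃! x : HopfDatumCore B₁ B₂ × (B₁ ⊗ B₂ ≅ B),
        x.1.IsStrongHopfDatum ∧ x.1.IsBialgebraIso B x.2 ∧ x.1.Induces B x.2 i₁ p₁ i₂ p₂,
      i₁ ≫ p₁ = 𝟙 B₁ ∧ i₂ ≫ p₂ = 𝟙 B₂ ∧
        IsIdempotentPair B (p₁ ≫ i₁) (p₂ ≫ i₂) ∧ IsStrongProjection B (p₁ ≫ i₁) (p₂ ≫ i₂),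
      IsProjectionPair B i₁ p₁ i₂ p₂ ∧ IsStrongProjection B (p₁ ≫ i₁) (p₂ ≫ i₂)] := by
  tfae_have 1 → 4
  | ⟨h, e, A, E, I⟩ => ⟨(A.isSplitPair E I).1.isProjectionPair, (A.isSplitPair E I).2⟩
  tfae_have 4 → 2
  | ⟨H, S⟩ => H.isSplitPair.existsUnique S
  tfae_have 2 → 1
  | ⟨⟨h, e⟩, H, _⟩ => ⟨h, e, H⟩
  tfae_have 4 → 3
  | ⟨H, S⟩ => ⟨H.retract₁, H.retract₂, H.isSplitPair.isIdempotentPair, S⟩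
  tfae_have 3 → 4
  | ⟨r₁, r₂, H, S⟩ => ⟨(H.isSplitPair r₁ r₂).isProjectionPair, S⟩
  tfae_finish

end

end CrossProduct

theorem mainTheorem2 {C : Type u} [Category.{v} C] [MonoidalCategory C] [BraidedCategory C]
    [IsIdempotentComplete C] (B : C) [BimonObj B] :
    List.TFAE [
      ∃ (B₁ B₂ : C) (h : HopfDatumCore B₁ B₂) (e : B₁ ⊗ B₂ ≅ B),
        h.IsStrongHopfDatum ∧ h.IsBialgebraIso B e,
      ∃ P₁ P₂ : B ⟶ B, IsIdempotentPair B P₁ P₂ ∧ IsStrongProjection B P₁ P₂,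
      ∃ (B₁ B₂ : C) (i₁ : B₁ ⟶ B) (p₁ : B ⟶ B₁) (i₂ : B₂ ⟶ B) (p₂ : B ⟶ B₂),
        IsProjectionPair B i₁ p₁ i₂ p₂ ∧ IsStrongProjection B (p₁ ≫ i₁) (p₂ ≫ i₂)] ∧
    ∀ (B₁ B₂ : C) (i₁ : B₁ ⟶ B) (p₁ : B ⟶ B₁) (i₂ : B₂ ⟶ B) (p₂ : B ⟶ B₂),
      List.TFAE [
        ∃ (h : HopfDatumCore B₁ B₂) (e : B₁ ⊗ B₂ ≅ B),
          h.IsStrongHopfDatum ∧ h.IsBialgebraIso B e ∧ h.Induces B e i₁ p₁ i₂ p₂,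
        ∃! x : HopfDatumCore B₁ B₂ × (B₁ ⊗ B₂ ≅ B),
          x.1.IsStrongHopfDatum ∧ x.1.IsBialgebraIso B x.2 ∧ x.1.Induces B x.2 i₁ p₁ i₂ p₂,
        i₁ ≫ p₁ = 𝟙 B₁ ∧ i₂ ≫ p₂ = 𝟙 B₂ ∧
          IsIdempotentPair B (p₁ ≫ i₁) (p₂ ≫ i₂) ∧ IsStrongProjection B (p₁ ≫ i₁) (p₂ ≫ i₂),
        IsProjectionPair B i₁ p₁ i₂ p₂ ∧ IsStrongProjection B (p₁ ≫ i₁) (p₂ ≫ i₂)] := by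
  refine ⟨?_, fun B₁ B₂ i₁ p₁ i₂ p₂ => tfae_of_pair i₁ p₁ i₂ p₂⟩
  tfae_have 1 → 3
  | ⟨B₁, B₂, h, e, A, E⟩ => by
    -- Without prescribed maps, the four maps are taken to be those induced by the isomorphism.
    have I : h.Induces B e _ _ _ _ := ⟨rfl, rfl, rfl, rfl⟩
    exact ⟨B₁, B₂, _, _, _, _, (A.isSplitPair E I).1.isProjectionPair, (A.isSplitPair E I).2⟩
  tfae_have 3 → 1
  | ⟨B₁, B₂, i₁, p₁, i₂, p₂, H, S⟩ =>
    ⟨B₁, B₂, _, _, Splitting.isStrongHopfDatum H.isSplitPair S,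
      Splitting.isBialgebraIso H.isSplitPair S⟩
  tfae_have 3 → 2
  | ⟨B₁, B₂, i₁, p₁, i₂, p₂, H, S⟩ => ⟨_, _, H.isSplitPair.isIdempotentPair, S⟩
  tfae_have 2 → 3
  | ⟨P₁, P₂, H, S⟩ => by
    -- The objects B₁ and B₂ are the images of the idempotents; only here must idempotents split in
    -- C.
    obtain ⟨B₁, i₁, p₁, r₁, rfl⟩ := IsIdempotentComplete.idempotents_split B P₁ H.idem₁
    obtain ⟨B₂, i₂, p₂, r₂, rfl⟩ := IsIdempotentComplete.idempotents_split B P₂ H.idem₂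
    exact ⟨B₁, B₂, i₁, p₁, i₂, p₂, (H.isSplitPair r₁ r₂).isProjectionPair, S⟩
  tfae_finish
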